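/- Let $N\ge 1$, $\Omega=\mathbb T^{N-1}\times(0,1)$ with $\mathbb T^{N-1}=\mathbb R^{N-1}/\mathbb Z^{N-1}$, so that $\partial\Omega=\mathbb T^{N-1}\times\{0,1\}$; let $d(x)=\operatorname{dist}(x,\partial\Omega)=\min(x_N,1-x_N)$ and $\Omega_\varepsilon=\{x\in\Omega: d(x)\ge\varepsilon\}$. Let $\varphi(\varepsilon)>0$ for $\varepsilon\in(0,\frac12)$, with $\lim_{\varepsilon\downarrow0}\varepsilon\varphi(\varepsilon)=\kappa\in(0,\infty)$, and put $b_\varepsilon=\chi_{\Omega_\varepsilon}+\varphi(\varepsilon)\chi_{\Omega\setminus\Omega_\varepsilon}$. Let $X_\varepsilon=L^2_\varepsilon(\Omega)$ be the space $L^2(\Omega)$ with the inner product $\int_\Omega b_\varepsilon uv\,dx$, and let $X_0^\kappa$ be $L^2(\Omega)\times L^2(\partial\Omega)$ with the inner product $\int_\Omega u_1u_2\,dx+\kappa\int_{\partial\Omega}\xi_1\xi_2\,d\mathcal H^{N-1}$. For $\varepsilon\in(0,\frac12)$ let $a_\varepsilon$ be a continuous function on $\overline\Omega$ of the form $a_\varepsilon(x)=a_\varepsilon(d(x))$,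 without zeros in $\Omega$, such that $a_\varepsilon\to1$ locally uniformly in $\Omega$ as $\varepsilon\downarrow0$; $a_\varepsilon\ge\underline a$ on $\Omega_\varepsilon$ for some constant $\underline a>0$ independent of $\varepsilon$; for $p=1$ or $p=\frac12$, $$\frac1\varepsilon\int_0^\varepsilon\Big(\int_s^\varepsilon\frac{d\sigma}{a_\varepsilon(\sigma)}\Big)^p ds\to0\qquad(\varepsilon\downarrow0);$$ and $\sup_{\varepsilon\in(0,1/2)}\sup_{\Omega}a_\varepsilon<\infty$. Define, for $u\in X_\varepsilon$ and $(u,v)\in X_0^\kappa$, $$E_\varepsilon(u)=\begin{cases}\frac12\int_\Omega a_\varepsilon|\nabla u|^2dx,&u\in H^1_{loc}(\Omega),\\+\infty,&\text{otherwise,}\end{cases}\qquad E_0(u,v)=\begin{cases}\frac12\int_\Omega|\nabla u|^2dx,&u\in H^1(\Omega),\ \gamma u=v,\\+\infty,&\text{otherwise,}\end{cases}$$ where $\gamma:H^1(\Omega)\to L^2(\partial\Omega)$ is the trace operator. Let $\iota_\varepsilon:X_\varepsilon\to X_0^\kappa$, $\iota_\varepsilon(u)=(u,m_\varepsilon u)$,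 where $(m_\varepsilon u)(x',0)=\frac1\varepsilon\int_0^\varepsilon u(x',s)\,ds$ and $(m_\varepsilon u)(x',1)=\frac1\varepsilon\int_{1-\varepsilon}^1u(x',s)\,ds$. Then $E_\varepsilon$ $\Gamma$-converges to $E_0$ with respect to $\iota_\varepsilon$ as $\varepsilon\downarrow0$, that is: (i) if $u^\varepsilon\in X_\varepsilon$ and $\iota_\varepsilon(u^\varepsilon)\to w$ in $X_0^\kappa$, then $E_0(w)\le\liminf_{\varepsilon\downarrow0}E_\varepsilon(u^\varepsilon)$; (ii) for every $w\in X_0^\kappa$ there are $u^\varepsilon\in X_\varepsilon$ with $\iota_\varepsilon(u^\varepsilon)\to w$ in $X_0^\kappa$ and $\lim_{\varepsilon\downarrow0}E_\varepsilon(u^\varepsilon)=E_0(w)$. In particular this holds for $a_\varepsilon(x)=\min\{d(x)/\varepsilon,1\}$. -/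

import Mathlib

open MeasureTheory Set Filter Topology
open scoped ENNReal ContDiff

noncomputable section

namespace ThinLayer

/-! ### The flat cylinder `Ω = 𝕋ⁿ × (0, 1)`, of dimension `N = n + 1` -/

/-- The ambient space `𝕋ⁿ × ℝ`, where `𝕋ⁿ = ℝⁿ / ℤⁿ`. -/
abbrev Cyl (n : ℕ) : Type := UnitAddTorus (Fin n) × ℝ

/-- The open cylinder `Ω = 𝕋ⁿ × (0, 1)`. -/
def Omega (n : ℕ) : Set (Cyl n) := univ ×ˢ Ioo (0 : ℝ) 1

/-- Lebesgue measure on `Ω`. -/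
def volOmega (n : ℕ) : Measure (Cyl n) :=
  (volume : Measure (UnitAddTorus (Fin n))).prod (volume.restrict (Ioo (0 : ℝ) 1))

/-- The surface measure `ℋⁿ` on `∂Ω = 𝕋ⁿ × {0, 1}`. -/
def surf (n : ℕ) : Measure (Cyl n) :=
  (volume : Measure (UnitAddTorus (Fin n))).prod (Measure.dirac (0 : ℝ) + Measure.dirac (1 : ℝ))

/-- The distance `d(x)` of a point `x` of `Ω` to `∂Ω`. -/
def bdryDist {n : ℕ} (x : Cyl n) : ℝ := min x.2 (1 - x.2)

/-- `Ω_δ = {x ∈ Ω : d(x) ≥ δ}`. For `δ > 0` these sets are compact and they exhaust `Ω`. -/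
def innerDomain (n : ℕ) (δ : ℝ) : Set (Cyl n) := {x | x ∈ Omega n ∧ δ ≤ bdryDist x}

/-- The covering map `ℝⁿ⁺¹ → 𝕋ⁿ × ℝ`; the last coordinate is `x_N`. -/
def cover (n : ℕ) (y : EuclideanSpace ℝ (Fin (n + 1))) : Cyl n :=
  (fun i => ((y i.castSucc : ℝ) : UnitAddCircle), y (Fin.last n))

/-- The classical partial derivative `∂_i ψ` of a function on `𝕋ⁿ × ℝ`. -/
def pderiv {n : ℕ} (i : Fin (n + 1)) (ψ : Cyl n → ℝ) (x : Cyl n) : ℝ :=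
  deriv (fun t : ℝ => ψ (x + cover n (EuclideanSpace.single i t))) 0

/-- The classical gradient of a function on `𝕋ⁿ × ℝ`. -/
def grad {n : ℕ} (ψ : Cyl n → ℝ) (x : Cyl n) : EuclideanSpace ℝ (Fin (n + 1)) :=
  WithLp.toLp 2 fun i => pderiv i ψ x

/-! ### Sobolev functions and traces -/

/-- Test functions: the members of `C_c^∞(Ω)`. -/
def IsTest {n : ℕ} (φ : Cyl n → ℝ) : Prop :=
  ContDiff ℝ ∞ (φ ∘ cover n) ∧ HasCompactSupport φ ∧ tsupport φ ⊆ Omega n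

/-- `G ∈ L¹_loc(Ω)` is a weak gradient of `u` in `Ω`. -/
def IsWeakGrad {n : ℕ} (u : Cyl n → ℝ) (G : Cyl n → EuclideanSpace ℝ (Fin (n + 1))) : Prop :=
  (∀ δ : ℝ, 0 < δ → Integrable G ((volOmega n).restrict (innerDomain n δ))) ∧
  ∀ (i : Fin (n + 1)) (φ : Cyl n → ℝ), IsTest φ →
    ∫ x, u x * pderiv i φ x ∂(volOmega n) = - ∫ x, G x i * φ x ∂(volOmega n)

/-- `u ∈ H¹_loc(Ω)`. -/
def MemH1loc {n : ℕ} (u : Cyl n → ℝ) : Prop :=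
  (∀ δ : ℝ, 0 < δ → MemLp u 2 ((volOmega n).restrict (innerDomain n δ))) ∧
  ∃ G, IsWeakGrad u G ∧ ∀ δ : ℝ, 0 < δ → MemLp G 2 ((volOmega n).restrict (innerDomain n δ))

/-- `u ∈ H¹(Ω)`. -/
def MemH1 {n : ℕ} (u : Cyl n → ℝ) : Prop :=
  MemLp u 2 (volOmega n) ∧ ∃ G, IsWeakGrad u G ∧ MemLp G 2 (volOmega n)

/-- `γ u = v`, where `γ : H¹(Ω) → L²(∂Ω)` is the trace operator, i.e. the continuous extension
of `ψ ↦ ψ|_∂Ω`, `ψ ∈ C¹(closure Ω)`: there are such `ψ_k` with `ψ_k → u` in `H¹(Ω)` and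
`ψ_k|_∂Ω → v` in `L²(∂Ω)`. -/
def IsTrace {n : ℕ} (u v : Cyl n → ℝ) : Prop :=
  ∃ (G : Cyl n → EuclideanSpace ℝ (Fin (n + 1))) (ψ : ℕ → Cyl n → ℝ),
    IsWeakGrad u G ∧ (∀ k, ContDiff ℝ 1 (ψ k ∘ cover n)) ∧
    Tendsto (fun k => eLpNorm (fun x => ψ k x - u x) 2 (volOmega n)) atTop (𝓝 0) ∧
    Tendsto (fun k => eLpNorm (fun x => grad (ψ k) x - G x) 2 (volOmega n)) atTop (𝓝 0) ∧
    Tendsto (fun k => eLpNorm (fun x => ψ k x - v x) 2 (surf n)) atTop (𝓝 0)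

/-- `½ ∫_Ω w |∇u|² dx` for a weight `w ≥ 0`. The weak gradient is unique up to null sets, so the
infimum runs over equal numbers. -/
def dirichlet {n : ℕ} (w : Cyl n → ℝ) (u : Cyl n → ℝ) : ℝ≥0∞ :=
  ⨅ (G : Cyl n → EuclideanSpace ℝ (Fin (n + 1))) (_ : IsWeakGrad u G),
    2⁻¹ * ∫⁻ x, ENNReal.ofReal (w x) * ‖G x‖ₑ ^ 2 ∂(volOmega n)

/-! ### The energies -/

open Classical in
/-- The energy `E_ε(u)` with the conductivity `a_ε(x) = a ε (d(x))`. -/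
def energy {n : ℕ} (a : ℝ → ℝ → ℝ) (ε : ℝ) (u : Cyl n → ℝ) : ℝ≥0∞ :=
  if MemH1loc u then dirichlet (fun x => a ε (bdryDist x)) u else ⊤

open Classical in
/-- The limit energy `E₀(u, v)`. -/
def energy₀ {n : ℕ} (u v : Cyl n → ℝ) : ℝ≥0∞ :=
  if MemH1 u ∧ IsTrace u v then dirichlet (fun _ => 1) u else ⊤

/-- The standing assumptions on `a_ε`, `0 < ε < 1/2`, as functions of the distance
`d ∈ [0, 1/2]` to the boundary: continuity, no zero inside `Ω`, `a_ε → 1` locally uniformly in `Ω`,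
non-degeneracy with exponent `p`, and a uniform upper bound. -/
structure Admissible (p : ℝ) (a : ℝ → ℝ → ℝ) : Prop where
  continuousOn : ∀ ε ∈ Ioo (0 : ℝ) (1 / 2), ContinuousOn (a ε) (Icc 0 (1 / 2))
  ne_zero : ∀ ε ∈ Ioo (0 : ℝ) (1 / 2), ∀ d ∈ Ioc (0 : ℝ) (1 / 2), a ε d ≠ 0
  tendsto_one : TendstoLocallyUniformlyOn a (fun _ => 1) (𝓝[>] 0) (Ioc 0 (1 / 2))
  lower : ∃ c : ℝ, 0 < c ∧ ∀ ε ∈ Ioo (0 : ℝ) (1 / 2), ∀ d ∈ Icc ε (1 / 2), c ≤ a ε d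
  nondegenerate : Tendsto (fun ε : ℝ => (ENNReal.ofReal ε)⁻¹ *
    ∫⁻ s in Ioo 0 ε, (∫⁻ σ in Ioo s ε, ENNReal.ofReal (1 / a ε σ)) ^ p) (𝓝[>] 0) (𝓝 0)
  upper : ∃ C : ℝ, ∀ ε ∈ Ioo (0 : ℝ) (1 / 2), ∀ d ∈ Icc (0 : ℝ) (1 / 2), a ε d ≤ C

/-! ### The spaces `L²_ε(Ω)` and `X₀^κ`, and the immersions -/

open Classical in
/-- The capacity `b_ε`, equal to `1` on `Ω_ε` and to `φ(ε)` on `Ω ∖ Ω_ε`. -/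
def capacity {n : ℕ} (φ : ℝ → ℝ) (ε : ℝ) (x : Cyl n) : ℝ :=
  if ε ≤ bdryDist x then 1 else φ ε

/-- The measure `b_ε dx` on `Ω`. -/
def capMeasure (n : ℕ) (φ : ℝ → ℝ) (ε : ℝ) : Measure (Cyl n) :=
  (volOmega n).withDensity fun x => ENNReal.ofReal (capacity φ ε x)

/-- `L²_ε(Ω)`, with the inner product `∫_Ω b_ε u v dx`. -/
abbrev L2cap (n : ℕ) (φ : ℝ → ℝ) (ε : ℝ) : Type := Lp ℝ 2 (capMeasure n φ ε)

/-- `X₀^κ = L²(Ω) × L²(∂Ω)`, with the inner product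
`∫_Ω u₁ u₂ dx + κ ∫_∂Ω ξ₁ ξ₂ dℋⁿ`. -/
abbrev X₀ (n : ℕ) (κ : ℝ) : Type :=
  WithLp 2 (Lp ℝ 2 (volOmega n) × Lp ℝ 2 (ENNReal.ofReal κ • surf n))

/-- The boundary average `m_ε u` on `∂Ω = 𝕋ⁿ × {0, 1}`. -/
def bdryAvg {n : ℕ} (ε : ℝ) (u : Cyl n → ℝ) (x : Cyl n) : ℝ :=
  if x.2 = 0 then ε⁻¹ * ∫ s in (0 : ℝ)..ε, u (x.1, s)
  else if x.2 = 1 then ε⁻¹ * ∫ s in (1 - ε)..(1 : ℝ), u (x.1, s)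
  else 0

instance (n : ℕ) : IsFiniteMeasure (volOmega n) := by
  unfold volOmega; infer_instance

theorem measurable_bdryDist {n : ℕ} : Measurable (bdryDist (n := n)) :=
  measurable_snd.min (measurable_const.sub measurable_snd)

theorem measurable_capacity {n : ℕ} (φ : ℝ → ℝ) (ε : ℝ) :
    Measurable (capacity (n := n) φ ε) :=
  Measurable.ite (measurableSet_le measurable_const measurable_bdryDist)
    measurable_const measurable_const

/-- As a vector space, `L²_ε(Ω)` is `L²(Ω)`. -/
theorem memLp_capMeasure_iff {n : ℕ} {φ : ℝ → ℝ} {ε : ℝ} (hφ : 0 < φ ε) (u : Cyl n → ℝ) :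
    MemLp u 2 (capMeasure n φ ε) ↔ MemLp u 2 (volOmega n) := by
  have hm : Measurable fun x : Cyl n => ENNReal.ofReal (capacity φ ε x) :=
    (measurable_capacity φ ε).ennreal_ofReal
  have hup : ∀ x : Cyl n, ENNReal.ofReal (capacity φ ε x) ≤ ENNReal.ofReal (max 1 (φ ε)) := by
    intro x
    apply ENNReal.ofReal_le_ofReal
    unfold capacity
    split_ifs
    · exact le_max_left _ _
    · exact le_max_right _ _
  have hlow : ∀ x : Cyl n, ENNReal.ofReal (min 1 (φ ε)) ≤ ENNReal.ofReal (capacity φ ε x) := by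
    intro x
    apply ENNReal.ofReal_le_ofReal
    unfold capacity
    split_ifs
    · exact min_le_left _ _
    · exact min_le_right _ _
  have hpos : ENNReal.ofReal (min 1 (φ ε)) ≠ 0 := by
    simp [hφ]
  constructor
  · intro h
    refine h.of_measure_le_smul (c := (ENNReal.ofReal (min 1 (φ ε)))⁻¹)
      (ENNReal.inv_ne_top.2 hpos) ?_
    have h1 : ENNReal.ofReal (min 1 (φ ε)) • volOmega n ≤ capMeasure n φ ε := by
      rw [← withDensity_const]
      exact withDensity_mono (Eventually.of_forall hlow)
    calc volOmega n
        = (ENNReal.ofReal (min 1 (φ ε)))⁻¹ • (ENNReal.ofReal (min 1 (φ ε)) • volOmega n) := by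
          rw [smul_smul, ENNReal.inv_mul_cancel hpos ENNReal.ofReal_ne_top, one_smul]
      _ ≤ _ := by gcongr
  · intro h
    refine h.of_measure_le_smul (c := ENNReal.ofReal (max 1 (φ ε))) ENNReal.ofReal_ne_top ?_
    rw [← withDensity_const]
    exact withDensity_mono (Eventually.of_forall hup)

theorem memLp_integral_snd {n : ℕ} {ν : Measure ℝ} [IsFiniteMeasure ν] {u : Cyl n → ℝ}
    (hu : MemLp u 2 ((volume : Measure (UnitAddTorus (Fin n))).prod ν)) :
    MemLp (fun y => ∫ s, u (y, s) ∂ν) 2 (volume : Measure (UnitAddTorus (Fin n))) := by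
  have hmeas : AEStronglyMeasurable (fun y => ∫ s, u (y, s) ∂ν)
      (volume : Measure (UnitAddTorus (Fin n))) := hu.1.integral_prod_right'
  refine ⟨hmeas, ?_⟩
  have hsq : ∀ {α : Type} [MeasurableSpace α] (μ : Measure α) (f : α → ℝ),
      eLpNorm f 2 μ ^ 2 = ∫⁻ x, ‖f x‖ₑ ^ 2 ∂μ := by
    intro α _ μ f
    have := eLpNorm_nnreal_pow_eq_lintegral (f := f) (μ := μ) (p := 2) two_ne_zero
    simpa using this
  have hfin : ∫⁻ x, ‖u x‖ₑ ^ 2 ∂((volume : Measure (UnitAddTorus (Fin n))).prod ν) < ⊤ := by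
    rw [← hsq]
    exact ENNReal.pow_lt_top hu.2
  rw [lintegral_prod _ (hu.1.enorm.pow_const 2)] at hfin
  have key : ∫⁻ y, ‖∫ s, u (y, s) ∂ν‖ₑ ^ 2 ∂(volume : Measure (UnitAddTorus (Fin n))) < ⊤ := by
    have hle : ∫⁻ y, ‖∫ s, u (y, s) ∂ν‖ₑ ^ 2 ∂(volume : Measure (UnitAddTorus (Fin n))) ≤
        ∫⁻ y, ν univ * ∫⁻ s, ‖u (y, s)‖ₑ ^ 2 ∂ν ∂(volume : Measure (UnitAddTorus (Fin n))) := by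
      apply lintegral_mono_ae
      filter_upwards [hu.1.prodMk_left] with y hy
      have h1 : ‖∫ s, u (y, s) ∂ν‖ₑ ≤ eLpNorm (fun s => u (y, s)) 1 ν := by
        rw [eLpNorm_one_eq_lintegral_enorm]
        exact enorm_integral_le_lintegral_enorm _
      have h2 := eLpNorm_le_eLpNorm_mul_rpow_measure_univ (p := 1) (q := 2) (by norm_num) hy
      calc ‖∫ s, u (y, s) ∂ν‖ₑ ^ 2
          ≤ (eLpNorm (fun s => u (y, s)) 2 ν *
              ν univ ^ (1 / (1 : ℝ≥0∞).toReal - 1 / (2 : ℝ≥0∞).toReal)) ^ 2 := by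
            gcongr
            exact h1.trans h2
        _ = ν univ * ∫⁻ s, ‖u (y, s)‖ₑ ^ 2 ∂ν := by
            rw [mul_pow, hsq, mul_comm, ← ENNReal.rpow_mul_natCast]
            norm_num
    refine hle.trans_lt ?_
    rw [lintegral_const_mul' _ _ (measure_ne_top ν univ)]
    exact ENNReal.mul_lt_top (measure_lt_top ν univ) hfin
  rw [← hsq] at key
  by_contra hcon
  rw [not_lt, top_le_iff] at hcon
  simp [hcon] at key

theorem memLp_slab {n : ℕ} {u : Cyl n → ℝ} (hu : MemLp u 2 (volOmega n)) {s t : ℝ}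
    (hs : 0 ≤ s) (hst : s ≤ t) (ht : t ≤ 1) :
    MemLp (fun y => ∫ r in s..t, u (y, r)) 2 (volume : Measure (UnitAddTorus (Fin n))) := by
  have h : volume.restrict (Ioo s t) ≤ volume.restrict (Ioo (0 : ℝ) 1) :=
    Measure.restrict_mono (Ioo_subset_Ioo hs ht) le_rfl
  have h' : MemLp u 2 ((volume : Measure (UnitAddTorus (Fin n))).prod
      (volume.restrict (Ioo s t))) := hu.mono_measure (Measure.prod_mono le_rfl h)
  have := memLp_integral_snd h'
  simpa only [intervalIntegral.integral_of_le hst, integral_Ioc_eq_integral_Ioo] using this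

/-- `m_ε` maps `L²(Ω)` to `L²(∂Ω)`. -/
theorem memLp_bdryAvg {n : ℕ} {ε : ℝ} (h0 : 0 < ε) (h1 : ε < 1) {u : Cyl n → ℝ}
    (hu : MemLp u 2 (volOmega n)) (κ : ℝ) :
    MemLp (bdryAvg ε u) 2 (ENNReal.ofReal κ • surf n) := by
  refine MemLp.smul_measure ?_ ENNReal.ofReal_ne_top
  have e : ∀ c : ℝ, MeasurableEmbedding (fun y : UnitAddTorus (Fin n) => (y, c)) :=
    fun c => measurableEmbedding_prod_mk_right c
  have hA : MemLp (bdryAvg ε u) 2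
      ((volume : Measure (UnitAddTorus (Fin n))).prod (Measure.dirac (0 : ℝ))) := by
    rw [Measure.prod_dirac, (e 0).memLp_map_measure_iff]
    have := (memLp_slab hu le_rfl h0.le h1.le).const_mul ε⁻¹
    refine this.congr_norm ?_ ?_
    · refine this.1.congr (Eventually.of_forall fun y => ?_)
      simp [bdryAvg]
    · exact Eventually.of_forall fun y => by simp [bdryAvg]
  have hB : MemLp (bdryAvg ε u) 2
      ((volume : Measure (UnitAddTorus (Fin n))).prod (Measure.dirac (1 : ℝ))) := by
    rw [Measure.prod_dirac, (e 1).memLp_map_measure_iff]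
    have := (memLp_slab hu (s := 1 - ε) (t := 1) (by linarith) (by linarith)
      le_rfl).const_mul ε⁻¹
    refine this.congr_norm ?_ ?_
    · refine this.1.congr (Eventually.of_forall fun y => ?_)
      simp [bdryAvg]
    · exact Eventually.of_forall fun y => by simp [bdryAvg]
  unfold surf
  rw [Measure.prod_add]
  refine ⟨hA.1.add_measure hB.1, ?_⟩
  have hsq : ∀ (μ : Measure (Cyl n)) (f : Cyl n → ℝ),
      eLpNorm f 2 μ ^ 2 = ∫⁻ x, ‖f x‖ₑ ^ 2 ∂μ := by
    intro μ f
    have := eLpNorm_nnreal_pow_eq_lintegral (f := f) (μ := μ) (p := 2) two_ne_zero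
    simpa using this
  have key : eLpNorm (bdryAvg ε u) 2 ((volume : Measure (UnitAddTorus (Fin n))).prod
      (Measure.dirac (0 : ℝ)) + (volume : Measure (UnitAddTorus (Fin n))).prod
      (Measure.dirac (1 : ℝ))) ^ 2 < ⊤ := by
    rw [hsq, lintegral_add_measure, ← hsq, ← hsq]
    exact ENNReal.add_lt_top.2 ⟨ENNReal.pow_lt_top hA.2, ENNReal.pow_lt_top hB.2⟩
  by_contra hcon
  rw [not_lt, top_le_iff] at hcon
  simp [hcon] at key

/-- The range `(0, 1/2)` of the parameter `ε`. -/
abbrev Param : Type := Ioo (0 : ℝ) (1 / 2)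

/-- The limit `ε ↓ 0`. -/
def toZero : Filter Param := comap Subtype.val (𝓝[>] (0 : ℝ))

/-- The immersion `ι_ε u = (u, m_ε u)` of `L²_ε(Ω)` into `X₀^κ`. -/
def immersion (n : ℕ) (κ : ℝ) (φ : ℝ → ℝ) (hφ : ∀ ε ∈ Ioo (0 : ℝ) (1 / 2), 0 < φ ε)
    (ε : Param) (u : L2cap n φ ε) : X₀ n κ :=
  have hu : MemLp u 2 (volOmega n) := (memLp_capMeasure_iff (hφ ε ε.2) _).1 (Lp.memLp u)
  WithLp.toLp 2 (hu.toLp u,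
    (memLp_bdryAvg ε.2.1 (ε.2.2.trans (by norm_num)) hu κ).toLp (bdryAvg ε u))

/-- `E_ε` Γ-converges to `E₀` with respect to the maps `ι_ε : X_ε → X₀`, as `ε ↓ 0`. -/
structure GammaConverges {X : Param → Type*} {Y : Type*} [TopologicalSpace Y]
    (E : ∀ ε, X ε → ℝ≥0∞) (E₀ : Y → ℝ≥0∞) (ι : ∀ ε, X ε → Y) : Prop where
  le_liminf : ∀ (u : ∀ ε, X ε) (w : Y), Tendsto (fun ε => ι ε (u ε)) toZero (𝓝 w) →
    E₀ w ≤ liminf (fun ε => E ε (u ε)) toZero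
  recovery : ∀ w : Y, ∃ u : ∀ ε, X ε,
    Tendsto (fun ε => E ε (u ε)) toZero (𝓝 (E₀ w)) ∧ Tendsto (fun ε => ι ε (u ε)) toZero (𝓝 w)

end ThinLayer

end

/-!
Let `u_ε` have bounded energy and let `ι_ε u_ε → (u, v)`. The fields `√a_ε ∇u_ε` are bounded in
`L²(Ω)`; since `a_ε → 1` locally uniformly, their weak limits are weak gradients of `u`, so that
`u ∈ H¹(Ω)`, and the inequality between the energies is the weak lower semicontinuity of the norm.
The point is that `v = γ u`. On a vertical line, the Cauchy–Schwarz inequality with weight `a_ε`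
gives `|u_ε(s) - u_ε(ε)|² ≤ (∫_s^ε dσ / a_ε) ∫_s^ε a_ε |∂_N u_ε|² dσ`. Averaging over the layer, the
nondegeneracy condition (with `p = 1/2`, to which larger exponents reduce by Jensen's inequality)
bounds the distance in `L²(∂Ω)` between `m_ε u_ε` and the average of `u_ε` over `(ε, δ)` by
`o(1) + O(√δ)`. Letting `ε → 0` and then `δ → 0` identifies `v` with the trace of `u`.

For the recovery sequence of a pair of finite energy take `u_ε = u`: the energies converge by
dominated convergence, as `a_ε` is bounded, and `m_ε u → γ u`. For a pair of infinite energy only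
`ι_ε u_ε → (u, v)` is needed; let `u_ε` be `u` outside the layer and `v` inside it.
-/

noncomputable section

namespace ThinLayer

open scoped Convolution

section L2

variable {α F : Type*} [MeasurableSpace α] {μ : Measure α} [NormedAddCommGroup F]

theorem rpow_half_sq (x : ℝ≥0∞) : (x ^ (1 / 2 : ℝ)) ^ 2 = x := by
  rw [← ENNReal.rpow_mul_natCast]; norm_num

theorem lintegral_mul_sq_le {f g : α → ℝ≥0∞} (hf : AEMeasurable f μ) (hg : AEMeasurable g μ) :
    (∫⁻ x, f x * g x ∂μ) ^ 2 ≤ (∫⁻ x, f x ^ 2 ∂μ) * ∫⁻ x, g x ^ 2 ∂μ := by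
  have h := ENNReal.lintegral_mul_le_Lp_mul_Lq μ Real.HolderConjugate.two_two hf hg
  simp only [Pi.mul_apply, ENNReal.rpow_two] at h
  calc (∫⁻ x, f x * g x ∂μ) ^ 2
      ≤ ((∫⁻ x, f x ^ 2 ∂μ) ^ (1 / 2 : ℝ) * (∫⁻ x, g x ^ 2 ∂μ) ^ (1 / 2 : ℝ)) ^ 2 := by gcongr
    _ = _ := by rw [mul_pow, rpow_half_sq, rpow_half_sq]

theorem lintegral_sq_le_measure_univ_mul {g : α → ℝ≥0∞} (hg : AEMeasurable g μ) :
    (∫⁻ x, g x ∂μ) ^ 2 ≤ μ univ * ∫⁻ x, g x ^ 2 ∂μ := by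
  simpa using lintegral_mul_sq_le (f := 1) aemeasurable_one hg

theorem eLpNorm_two_sq (f : α → F) (μ : Measure α) :
    eLpNorm f 2 μ ^ 2 = ∫⁻ x, ‖f x‖ₑ ^ 2 ∂μ := by
  simpa using eLpNorm_nnreal_pow_eq_lintegral (f := f) (μ := μ) (p := 2) two_ne_zero

theorem eLpNorm_two_le_of_lintegral_le {f : α → F} {C : ℝ≥0∞}
    (h : ∫⁻ x, ‖f x‖ₑ ^ 2 ∂μ ≤ C ^ 2) : eLpNorm f 2 μ ≤ C :=
  (ENNReal.pow_le_pow_left_iff two_ne_zero).1 ((eLpNorm_two_sq f μ).trans_le h)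

end L2

/-! ### The cylinder and its covering map -/

instance (n : ℕ) : IsProbabilityMeasure (volume : Measure (UnitAddTorus (Fin n))) :=
  ⟨by rw [volume_pi, Measure.pi_univ]; simp⟩

instance (n : ℕ) : IsProbabilityMeasure (volOmega n) :=
  ⟨by rw [volOmega, Measure.prod_apply MeasurableSet.univ]; simp⟩

instance (n : ℕ) : (volume : Measure (Cyl n)).IsAddHaarMeasure :=
  Measure.prod.instIsAddHaarMeasure (volume : Measure (Fin n → UnitAddCircle))
    (volume : Measure ℝ)

instance (n : ℕ) : SFinite (volume : Measure (Cyl n)) :=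
  inferInstanceAs (SFinite ((volume : Measure (UnitAddTorus (Fin n))).prod (volume : Measure ℝ)))

theorem volOmega_eq_restrict (n : ℕ) :
    volOmega n = (volume : Measure (Cyl n)).restrict (Omega n) := by
  rw [volOmega, Omega, Measure.volume_eq_prod, ← Measure.prod_restrict, Measure.restrict_univ]

theorem volOmega_le_volume (n : ℕ) : volOmega n ≤ volume :=
  (volOmega_eq_restrict n).trans_le Measure.restrict_le_self

theorem isOpen_Omega (n : ℕ) : IsOpen (Omega n) := isOpen_univ.prod isOpen_Ioo

theorem ae_mem_Omega (n : ℕ) : ∀ᵐ x ∂volOmega n, x ∈ Omega n := by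
  rw [volOmega_eq_restrict]
  exact ae_restrict_mem (isOpen_Omega n).measurableSet

theorem measurableSet_innerDomain (n : ℕ) (δ : ℝ) : MeasurableSet (innerDomain n δ) :=
  (isOpen_Omega n).measurableSet.inter (measurableSet_le measurable_const measurable_bdryDist)

section cover

variable {n : ℕ}

theorem cover_add (x y : EuclideanSpace ℝ (Fin (n + 1))) :
    cover n (x + y) = cover n x + cover n y := by
  refine Prod.ext (funext fun i => ?_) rfl
  simp [cover]

theorem cover_zero (n : ℕ) : cover n 0 = 0 := by
  simpa using cover_add (n := n) 0 0

theorem cover_neg (x : EuclideanSpace ℝ (Fin (n + 1))) : cover n (-x) = -cover n x := by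
  rw [eq_neg_iff_add_eq_zero, ← cover_add, neg_add_cancel, cover_zero]

theorem cover_single_last (t : ℝ) :
    cover n (EuclideanSpace.single (Fin.last n) t) = (0, t) := by
  refine Prod.ext (funext fun i => ?_) ?_
  · simp [cover, Fin.castSucc_ne_last]
  · simp [cover]

theorem isOpenQuotientMap_cover (n : ℕ) : IsOpenQuotientMap (cover n) := by
  have hquot : IsOpenQuotientMap
      (Prod.map (Pi.map fun (_ : Fin n) (t : ℝ) => (t : UnitAddCircle)) (id : ℝ → ℝ)) :=
    (IsOpenQuotientMap.piMap fun _ => QuotientAddGroup.isOpenQuotientMap_mk).prodMap .id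
  let splitLast : EuclideanSpace ℝ (Fin (n + 1)) ≃ₜ (Fin n → ℝ) × ℝ :=
    { toFun := fun y => (fun i => y i.castSucc, y (Fin.last n))
      invFun := fun z => WithLp.toLp 2 (Fin.snoc z.1 z.2)
      left_inv := fun y => by
        ext i
        refine Fin.lastCases ?_ (fun i => ?_) i <;> simp
      right_inv := fun z => by simp
      continuous_toFun := by fun_prop
      continuous_invFun := by
        refine (PiLp.continuous_toLp 2 _).comp (continuous_pi fun i => ?_)
        refine Fin.lastCases ?_ (fun i => ?_) i
        · simpa using continuous_snd
        · simpa [Function.comp_def] using (continuous_apply i).comp continuous_fst }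
  exact hquot.comp splitLast.isOpenQuotientMap

theorem continuous_cover (n : ℕ) : Continuous (cover n) := (isOpenQuotientMap_cover n).continuous

theorem surjective_cover (n : ℕ) : Function.Surjective (cover n) :=
  (isOpenQuotientMap_cover n).surjective

theorem continuous_of_comp_cover {Y : Type*} [TopologicalSpace Y] {f : Cyl n → Y}
    (h : Continuous (f ∘ cover n)) : Continuous f :=
  (isOpenQuotientMap_cover n).isQuotientMap.continuous_iff.2 h

end cover

/-! ### Functions of class `C¹` on the cylinder -/

section ContDiffOne

variable {n : ℕ} {ψ : Cyl n → ℝ}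

/-- The derivative at `x` of a function on the cylinder, as a linear form on the universal
cover `ℝⁿ⁺¹`. -/
def cylDeriv (ψ : Cyl n → ℝ) (x : Cyl n) : EuclideanSpace ℝ (Fin (n + 1)) →L[ℝ] ℝ :=
  fderiv ℝ (fun h => ψ (x + cover n h)) 0

theorem cylDeriv_cover (ψ : Cyl n → ℝ) (y : EuclideanSpace ℝ (Fin (n + 1))) :
    cylDeriv ψ (cover n y) = fderiv ℝ (ψ ∘ cover n) y := by
  have : (fun h => ψ (cover n y + cover n h)) = fun h => (ψ ∘ cover n) (y + h) := by
    funext h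
    simp only [Function.comp_apply, cover_add]
  rw [cylDeriv, this, fderiv_comp_add_left, add_zero]

theorem hasFDerivAt_add_cover (hψ : ContDiff ℝ 1 (ψ ∘ cover n)) (x : Cyl n)
    (y : EuclideanSpace ℝ (Fin (n + 1))) :
    HasFDerivAt (fun y => ψ (x + cover n y)) (cylDeriv ψ (x + cover n y)) y := by
  obtain ⟨ξ, rfl⟩ := surjective_cover n x
  simp only [← cover_add, cylDeriv_cover]
  exact ((hψ.differentiable one_ne_zero) (ξ + y)).hasFDerivAt.comp y
    ((hasFDerivAt_id y).const_add ξ)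

theorem hasDerivAt_add_cover_single (hψ : ContDiff ℝ 1 (ψ ∘ cover n)) (x : Cyl n)
    (i : Fin (n + 1)) (t : ℝ) :
    HasDerivAt (fun t : ℝ => ψ (x + cover n (EuclideanSpace.single i t)))
      (cylDeriv ψ (x + cover n (EuclideanSpace.single i t)) (EuclideanSpace.single i 1)) t := by
  have hline : HasDerivAt (fun t : ℝ => EuclideanSpace.single i t)
      (EuclideanSpace.single i (1 : ℝ)) t := by
    have : (fun t : ℝ => EuclideanSpace.single i t) =
        fun t : ℝ => t • EuclideanSpace.single i (1 : ℝ) := by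
      funext t
      ext j
      by_cases hj : j = i <;> simp [hj]
    rw [this]
    simpa using (hasDerivAt_id t).smul_const (EuclideanSpace.single i (1 : ℝ))
  exact (hasFDerivAt_add_cover hψ x _).comp_hasDerivAt t hline

theorem pderiv_eq_cylDeriv (hψ : ContDiff ℝ 1 (ψ ∘ cover n)) (i : Fin (n + 1)) (x : Cyl n) :
    pderiv i ψ x = cylDeriv ψ x (EuclideanSpace.single i 1) := by
  have hzero : EuclideanSpace.single i (0 : ℝ) = 0 := by simp
  rw [pderiv, (hasDerivAt_add_cover_single hψ x i 0).deriv, hzero, cover_zero, add_zero]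

theorem hasDerivAt_snd (hψ : ContDiff ℝ 1 (ψ ∘ cover n)) (y : UnitAddTorus (Fin n)) (s : ℝ) :
    HasDerivAt (fun s => ψ (y, s)) (pderiv (Fin.last n) ψ (y, s)) s := by
  simpa [cover_single_last, pderiv_eq_cylDeriv hψ] using
    hasDerivAt_add_cover_single hψ (y, 0) (Fin.last n) s

theorem continuous_of_contDiff (hψ : ContDiff ℝ 1 (ψ ∘ cover n)) : Continuous ψ :=
  continuous_of_comp_cover hψ.continuous

theorem continuous_cylDeriv (hψ : ContDiff ℝ 1 (ψ ∘ cover n)) : Continuous (cylDeriv ψ) := by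
  apply continuous_of_comp_cover
  rw [show cylDeriv ψ ∘ cover n = fderiv ℝ (ψ ∘ cover n) from funext (cylDeriv_cover ψ)]
  exact hψ.continuous_fderiv one_ne_zero

theorem continuous_pderiv (hψ : ContDiff ℝ 1 (ψ ∘ cover n)) (i : Fin (n + 1)) :
    Continuous (pderiv i ψ) := by
  rw [funext (pderiv_eq_cylDeriv hψ i)]
  exact (continuous_cylDeriv hψ).clm_apply continuous_const

theorem continuous_grad (hψ : ContDiff ℝ 1 (ψ ∘ cover n)) : Continuous (grad ψ) :=
  (PiLp.continuous_toLp 2 _).comp (continuous_pi fun i => continuous_pderiv hψ i)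

theorem hasCompactSupport_cylDeriv (h : HasCompactSupport ψ) :
    HasCompactSupport (cylDeriv ψ) := by
  refine HasCompactSupport.of_support_subset_isCompact h fun x hx => ?_
  by_contra hxs
  refine hx ?_
  have hcover : Tendsto (fun h => x + cover n h) (𝓝 0) (𝓝 x) := by
    simpa [cover_zero] using ((continuous_cover n).const_add x).tendsto 0
  have hzero : (fun h => ψ (x + cover n h)) =ᶠ[𝓝 0] fun _ => 0 :=
    hcover.eventually (notMem_tsupport_iff_eventuallyEq.1 hxs)
  rw [cylDeriv, hzero.fderiv_eq, fderiv_fun_const, Pi.zero_apply]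

end ContDiffOne

/-! ### Weighted estimates on an interval -/

/-- The resistance `∫ W⁻¹` of the interval between `s` and `p`, for the conductivity `W`. -/
def resistance (W : ℝ → ℝ≥0∞) (p s : ℝ) : ℝ≥0∞ := ∫⁻ σ in uIoo s p, (W σ)⁻¹

section Interval

variable {f f' : ℝ → ℝ} {W : ℝ → ℝ≥0∞} {c d p s : ℝ}

theorem resistance_one (p s : ℝ) : resistance 1 p s = ENNReal.ofReal |p - s| := by
  simp [resistance, uIoo, max_sub_min_eq_abs]

theorem enorm_sub_le_lintegral_uIoo (hf : ∀ s, HasDerivAt f (f' s) s) (hf' : Continuous f') :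
    ‖f s - f p‖ₑ ≤ ∫⁻ σ in uIoo s p, ‖f' σ‖ₑ := by
  rw [← intervalIntegral.integral_eq_sub_of_hasDerivAt (fun x _ => hf x)
    (hf'.intervalIntegrable _ _), ← ofReal_norm, intervalIntegral.norm_intervalIntegral_eq,
    ofReal_norm, uIoc_comm, uIoc, ← restrict_Ioo_eq_restrict_Ioc]
  exact enorm_integral_le_lintegral_enorm _

theorem enorm_sub_le_resistance (hf : ∀ s, HasDerivAt f (f' s) s) (hf' : Continuous f')
    (hW : AEMeasurable W (volume.restrict (uIoo s p))) (hW0 : ∀ σ ∈ uIoo s p, W σ ≠ 0)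
    (hWt : ∀ σ ∈ uIoo s p, W σ ≠ ⊤) :
    ‖f s - f p‖ₑ ≤ resistance W p s ^ (1 / 2 : ℝ) *
      (∫⁻ σ in uIoo s p, W σ * ‖f' σ‖ₑ ^ 2) ^ (1 / 2 : ℝ) := by
  have hfactor : ∫⁻ σ in uIoo s p, ‖f' σ‖ₑ =
      ∫⁻ σ in uIoo s p, (W σ)⁻¹ ^ (1 / 2 : ℝ) * (W σ ^ (1 / 2 : ℝ) * ‖f' σ‖ₑ) := by
    refine setLIntegral_congr_fun measurableSet_Ioo fun σ hσ => ?_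
    rw [← mul_assoc, ENNReal.inv_rpow, ENNReal.inv_mul_cancel, one_mul]
    · simp [hW0 σ hσ]
    · simp [hWt σ hσ]
  rw [← ENNReal.pow_le_pow_left_iff two_ne_zero, mul_pow, rpow_half_sq, rpow_half_sq]
  calc ‖f s - f p‖ₑ ^ 2
      ≤ (∫⁻ σ in uIoo s p, (W σ)⁻¹ ^ (1 / 2 : ℝ) * (W σ ^ (1 / 2 : ℝ) * ‖f' σ‖ₑ)) ^ 2 := by
        rw [← hfactor]
        gcongr
        exact enorm_sub_le_lintegral_uIoo hf hf'
    _ ≤ _ := lintegral_mul_sq_le (hW.inv.pow_const _)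
        ((hW.pow_const _).mul hf'.enorm.measurable.aemeasurable)
    _ = _ := by simp only [mul_pow, rpow_half_sq, resistance]

theorem setLIntegral_Ioo_mul_enorm_sq_ne_top {C : ℝ≥0∞} (hC : C ≠ ⊤)
    (hWC : ∀ σ ∈ Ioo c d, W σ ≤ C) {g : ℝ → ℝ} (hg : Continuous g) :
    ∫⁻ σ in Ioo c d, W σ * ‖g σ‖ₑ ^ 2 ≠ ⊤ := by
  obtain ⟨K, hK⟩ := (isCompact_Icc (a := c) (b := d)).exists_bound_of_continuousOn hg.continuousOn
  refine ne_top_of_le_ne_top (b := C * ENNReal.ofReal K ^ 2 * volume (Ioo c d)) ?_ ?_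
  · simp [ENNReal.mul_eq_top, hC]
  · rw [← setLIntegral_const]
    refine setLIntegral_mono' measurableSet_Ioo fun s hs => ?_
    rw [← ofReal_norm]
    gcongr
    · exact hWC s hs
    · exact hK s (Ioo_subset_Icc_self hs)

theorem enorm_intervalAverage_le (hcd : c < d) (f : ℝ → ℝ) :
    ‖⨍ s in c..d, f s‖ₑ ≤ (ENNReal.ofReal (d - c))⁻¹ * ∫⁻ s in Ioo c d, ‖f s‖ₑ := by
  have hdc : 0 < d - c := sub_pos.2 hcd
  rw [interval_average_eq, enorm_smul, enorm_inv hdc.ne', Real.enorm_eq_ofReal hdc.le,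
    intervalIntegral.integral_of_le hcd.le, integral_Ioc_eq_integral_Ioo]
  gcongr
  exact enorm_integral_le_lintegral_enorm _

theorem intervalAverage_sub_const (hcd : c < d) (hf : IntervalIntegrable f volume c d) (r : ℝ) :
    ⨍ s in c..d, (f s - r) = (⨍ s in c..d, f s) - r := by
  have hdc : d - c ≠ 0 := (sub_pos.2 hcd).ne'
  simp only [interval_average_eq, intervalIntegral.integral_sub hf intervalIntegrable_const,
    intervalIntegral.integral_const, smul_eq_mul]
  field_simp

theorem enorm_intervalAverage_sub_le (hf : ∀ s, HasDerivAt f (f' s) s) (hf' : Continuous f')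
    (hcd : c < d) (hp : p ∈ Icc c d) (hW : AEMeasurable W (volume.restrict (Ioo c d)))
    (hW0 : ∀ σ ∈ Ioo c d, W σ ≠ 0) {C : ℝ≥0∞} (hC : C ≠ ⊤) (hWC : ∀ σ ∈ Ioo c d, W σ ≤ C) :
    ‖(⨍ s in c..d, f s) - f p‖ₑ ≤
      (ENNReal.ofReal (d - c))⁻¹ * (∫⁻ s in Ioo c d, resistance W p s ^ (1 / 2 : ℝ)) *
        (∫⁻ σ in Ioo c d, W σ * ‖f' σ‖ₑ ^ 2) ^ (1 / 2 : ℝ) := by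
  have hcont : Continuous f := continuous_iff_continuousAt.2 fun s => (hf s).continuousAt
  have hD := setLIntegral_Ioo_mul_enorm_sq_ne_top hC hWC hf'
  rw [← intervalAverage_sub_const hcd (hcont.intervalIntegrable _ _), mul_assoc,
    ← lintegral_mul_const' _ _ (by simp [hD])]
  refine (enorm_intervalAverage_le hcd _).trans (mul_le_mul' le_rfl ?_)
  refine setLIntegral_mono' measurableSet_Ioo fun s hs => ?_
  have hsub : uIoo s p ⊆ Ioo c d := uIoo_subset_Ioo (Ioo_subset_Icc_self hs) hp
  calc ‖f s - f p‖ₑ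
      ≤ resistance W p s ^ (1 / 2 : ℝ) *
          (∫⁻ σ in uIoo s p, W σ * ‖f' σ‖ₑ ^ 2) ^ (1 / 2 : ℝ) :=
        enorm_sub_le_resistance hf hf' (hW.mono_measure (Measure.restrict_mono_set _ hsub))
          (fun σ hσ => hW0 σ (hsub hσ))
          fun σ hσ => ne_top_of_le_ne_top hC (hWC σ (hsub hσ))
    _ ≤ _ := by gcongr

end Interval

/-- The average of `f (y, ·)` over the layer `(c, d)`. -/
def layerAvg {Y : Type*} (c d : ℝ) (f : Y × ℝ → ℝ) (y : Y) : ℝ := ⨍ s in c..d, f (y, s)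

section layerAvg

variable {Y : Type*} {f g : Y × ℝ → ℝ} {c d : ℝ}

theorem layerAvg_eq_integral_Ioo (hcd : c ≤ d) (y : Y) :
    layerAvg c d f y = (d - c)⁻¹ * ∫ s in Ioo c d, f (y, s) := by
  rw [layerAvg, interval_average_eq, smul_eq_mul, intervalIntegral.integral_of_le hcd,
    integral_Ioc_eq_integral_Ioo]

variable [MeasurableSpace Y] {μ : Measure Y}

theorem aestronglyMeasurable_layerAvg (hcd : c ≤ d)
    (hf : AEStronglyMeasurable f (μ.prod (volume.restrict (Ioo c d)))) :
    AEStronglyMeasurable (layerAvg c d f) μ := by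
  rw [funext (layerAvg_eq_integral_Ioo (f := f) hcd)]
  exact hf.integral_prod_right'.const_mul _

theorem eLpNorm_layerAvg_le (hcd : c < d)
    (hf : AEStronglyMeasurable f (μ.prod (volume.restrict (Ioo c d)))) :
    eLpNorm (layerAvg c d f) 2 μ ≤
      (ENNReal.ofReal (d - c))⁻¹ ^ (1 / 2 : ℝ) *
        eLpNorm f 2 (μ.prod (volume.restrict (Ioo c d))) := by
  have h0 : ENNReal.ofReal (d - c) ≠ 0 := by simpa using hcd
  apply eLpNorm_two_le_of_lintegral_le
  rw [mul_pow, eLpNorm_two_sq, rpow_half_sq, lintegral_prod _ (hf.enorm.pow_const 2),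
    ← lintegral_const_mul'' _ (hf.enorm.pow_const 2).lintegral_prod_right']
  refine lintegral_mono_ae ?_
  filter_upwards [hf.prodMk_left] with y hy
  calc ‖layerAvg c d f y‖ₑ ^ 2
      ≤ ((ENNReal.ofReal (d - c))⁻¹ * ∫⁻ s in Ioo c d, ‖f (y, s)‖ₑ) ^ 2 := by
        gcongr
        exact enorm_intervalAverage_le hcd _
    _ ≤ (ENNReal.ofReal (d - c))⁻¹ ^ 2 *
          (ENNReal.ofReal (d - c) * ∫⁻ s in Ioo c d, ‖f (y, s)‖ₑ ^ 2) := by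
        rw [mul_pow]
        gcongr
        simpa using lintegral_sq_le_measure_univ_mul hy.enorm
    _ = (ENNReal.ofReal (d - c))⁻¹ * ∫⁻ s in Ioo c d, ‖f (y, s)‖ₑ ^ 2 := by
        rw [sq, mul_assoc, ← mul_assoc (ENNReal.ofReal _)⁻¹ (ENNReal.ofReal _),
          ENNReal.inv_mul_cancel h0 ENNReal.ofReal_ne_top, one_mul]

theorem layerAvg_sub_ae [SFinite μ] (hcd : c ≤ d)
    (hf : Integrable f (μ.prod (volume.restrict (Ioo c d))))
    (hg : Integrable g (μ.prod (volume.restrict (Ioo c d)))) :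
    layerAvg c d (fun x => f x - g x) =ᵐ[μ] fun y => layerAvg c d f y - layerAvg c d g y := by
  filter_upwards [hf.prod_right_ae, hg.prod_right_ae] with y hfy hgy
  simp only [layerAvg_eq_integral_Ioo hcd]
  rw [integral_sub hfy hgy, mul_sub]

end layerAvg

/-- Lebesgue measure on the slab `𝕋ⁿ × (c, d)`. -/
def slab (n : ℕ) (c d : ℝ) : Measure (Cyl n) :=
  (volume : Measure (UnitAddTorus (Fin n))).prod (volume.restrict (Ioo c d))

/-- The measure `W(s) dx' ds` on the slab `𝕋ⁿ × (c, d)`. -/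
def weightedSlab (n : ℕ) (c d : ℝ) (W : ℝ → ℝ≥0∞) : Measure (Cyl n) :=
  (slab n c d).withDensity fun x => W x.2

section slab

variable {n : ℕ} {c d c' d' : ℝ}

theorem weightedSlab_one (n : ℕ) (c d : ℝ) : weightedSlab n c d 1 = slab n c d :=
  withDensity_one

theorem slab_mono (hc : c' ≤ c) (hd : d ≤ d') : slab n c d ≤ slab n c' d' :=
  Measure.prod_mono le_rfl (Measure.restrict_mono_set _ (Ioo_subset_Ioo hc hd))

theorem weightedSlab_mono (hc : c' ≤ c) (hd : d ≤ d') (W : ℝ → ℝ≥0∞) :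
    weightedSlab n c d W ≤ weightedSlab n c' d' W :=
  Measure.le_intro fun t ht _ => by
    rw [weightedSlab, weightedSlab, withDensity_apply _ ht, withDensity_apply _ ht]
    exact lintegral_mono' (Measure.restrict_mono le_rfl (slab_mono hc hd)) le_rfl

theorem slab_le_volOmega (hc : 0 ≤ c) (hd : d ≤ 1) : slab n c d ≤ volOmega n :=
  slab_mono hc hd

theorem lintegral_weightedSlab {W : ℝ → ℝ≥0∞} (hW : AEMeasurable W (volume.restrict (Ioo c d)))
    {F : Cyl n → ℝ≥0∞} (hF : AEMeasurable F (slab n c d)) :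
    ∫⁻ x, F x ∂weightedSlab n c d W = ∫⁻ y, ∫⁻ s in Ioo c d, W s * F (y, s) := by
  have hW' : AEMeasurable (fun x : Cyl n => W x.2) (slab n c d) := hW.comp_snd
  rw [weightedSlab, lintegral_withDensity_eq_lintegral_mul₀ hW' hF, slab,
    lintegral_prod _ (hW'.mul hF)]
  rfl

theorem eLpNorm_layerAvg_sub_le {ψ : Cyl n → ℝ} (hψ : ContDiff ℝ 1 (ψ ∘ cover n)) {p : ℝ}
    (hcd : c < d) (hp : p ∈ Icc c d) {W : ℝ → ℝ≥0∞}
    (hW : AEMeasurable W (volume.restrict (Ioo c d))) (hW0 : ∀ σ ∈ Ioo c d, W σ ≠ 0)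
    {C : ℝ≥0∞} (hC : C ≠ ⊤) (hWC : ∀ σ ∈ Ioo c d, W σ ≤ C) :
    eLpNorm (fun y => layerAvg c d ψ y - ψ (y, p)) 2 volume ≤
      (ENNReal.ofReal (d - c))⁻¹ * (∫⁻ s in Ioo c d, resistance W p s ^ (1 / 2 : ℝ)) *
        eLpNorm (pderiv (Fin.last n) ψ) 2 (weightedSlab n c d W) := by
  have hpd := continuous_pderiv hψ (Fin.last n)
  have hm : Measurable fun x => ‖pderiv (Fin.last n) ψ x‖ₑ ^ 2 := hpd.enorm.measurable.pow_const 2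
  have hWm : AEMeasurable (fun x : Cyl n => W x.2 * ‖pderiv (Fin.last n) ψ x‖ₑ ^ 2)
      (slab n c d) := hW.comp_snd.mul hm.aemeasurable
  apply eLpNorm_two_le_of_lintegral_le
  rw [mul_pow _ (eLpNorm _ _ _), eLpNorm_two_sq, lintegral_weightedSlab hW hm.aemeasurable,
    ← lintegral_const_mul'' _ hWm.lintegral_prod_right']
  refine lintegral_mono fun y => ?_
  have h := enorm_intervalAverage_sub_le (hasDerivAt_snd hψ y)
    (hpd.comp (Continuous.prodMk_right y)) hcd hp hW hW0 hC hWC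
  refine (pow_le_pow_left' h 2).trans_eq ?_
  rw [mul_pow _ (_ ^ (1 / 2 : ℝ)), rpow_half_sq]

theorem eLpNorm_layerAvg_sub_le_slab {ψ : Cyl n → ℝ} (hψ : ContDiff ℝ 1 (ψ ∘ cover n)) {p : ℝ}
    (hcd : c < d) (hp : p ∈ Icc c d) :
    eLpNorm (fun y => layerAvg c d ψ y - ψ (y, p)) 2 volume ≤
      ENNReal.ofReal (d - c) ^ (1 / 2 : ℝ) * eLpNorm (pderiv (Fin.last n) ψ) 2 (slab n c d) := by
  have h := eLpNorm_layerAvg_sub_le hψ hcd hp (W := 1) aemeasurable_const (by simp)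
    ENNReal.one_ne_top (by simp)
  rw [weightedSlab_one] at h
  refine h.trans ?_
  gcongr
  have h0 : ENNReal.ofReal (d - c) ≠ 0 := by simpa using hcd
  rw [ENNReal.inv_mul_le_iff h0 ENNReal.ofReal_ne_top, mul_comm, ← Real.volume_Ioo,
    ← setLIntegral_const, Real.volume_Ioo]
  refine setLIntegral_mono' measurableSet_Ioo fun s hs => ?_
  rw [resistance_one]
  gcongr
  exact abs_sub_le_iff.2 ⟨sub_le_sub hp.2 hs.1.le, sub_le_sub hs.2.le hp.1⟩

end slab

/-- The reflection `(x', s) ↦ (x', 1 - s)`, which exchanges the two boundary components. -/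
def reflect {n : ℕ} (x : Cyl n) : Cyl n := (x.1, 1 - x.2)

section reflect

variable {n : ℕ} {ψ : Cyl n → ℝ}

theorem bdryDist_reflect (x : Cyl n) : bdryDist (reflect x) = bdryDist x := by
  simp [reflect, bdryDist, min_comm]

theorem measurePreserving_reflect (n : ℕ) :
    MeasurePreserving (reflect (n := n)) (volOmega n) (volOmega n) := by
  have h := (Measure.measurePreserving_sub_left (volume : Measure ℝ) 1).restrict_preimage
    (measurableSet_Ioo (a := (0 : ℝ)) (b := 1))
  rw [show (fun s : ℝ => 1 - s) ⁻¹' Ioo 0 1 = Ioo 0 1 by ext; simp] at h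
  exact (MeasurePreserving.id _).prod h

theorem contDiff_reflect (hψ : ContDiff ℝ 1 (ψ ∘ cover n)) :
    ContDiff ℝ 1 ((ψ ∘ reflect) ∘ cover n) := by
  have : (ψ ∘ reflect) ∘ cover n = (ψ ∘ cover n) ∘ fun y =>
      y + (1 - 2 * y (Fin.last n)) • EuclideanSpace.single (Fin.last n) (1 : ℝ) := by
    funext y
    refine congrArg ψ (Prod.ext (funext fun i => ?_) ?_)
    · simp [cover, reflect, Fin.castSucc_ne_last]
    · simp [cover, reflect]
      ring
  rw [this]
  exact hψ.comp (by fun_prop)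

theorem pderiv_last_reflect (hψ : ContDiff ℝ 1 (ψ ∘ cover n)) (x : Cyl n) :
    pderiv (Fin.last n) (ψ ∘ reflect) x = -pderiv (Fin.last n) ψ (reflect x) := by
  have h := (hasDerivAt_snd hψ x.1 (1 - x.2)).scomp x.2 ((hasDerivAt_id x.2).const_sub 1)
  simpa [reflect] using (hasDerivAt_snd (contDiff_reflect hψ) x.1 x.2).unique h

end reflect

section convolution

variable {n : ℕ} {f ρ : Cyl n → ℝ} {r : ℝ}

instance : (volume : Measure (Cyl n)).Regular :=
  have regular (μ : Measure (Cyl n)) [IsFiniteMeasureOnCompacts μ] : μ.Regular := inferInstance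
  regular volume

theorem hasCompactSupport_of_support_subset_ball (hr : Function.support ρ ⊆ Metric.ball 0 r) :
    HasCompactSupport ρ :=
  .of_support_subset_isCompact (isCompact_closedBall 0 r) (hr.trans Metric.ball_subset_closedBall)

theorem hasFDerivAt_convolution (hf : Integrable f) (hρ : ContDiff ℝ 1 (ρ ∘ cover n))
    (hs : HasCompactSupport ρ) (y : EuclideanSpace ℝ (Fin (n + 1))) :
    HasFDerivAt ((f ⋆ ρ) ∘ cover n) ((f ⋆ cylDeriv ρ) (cover n y)) y := by
  have hc := continuous_cylDeriv hρ
  have hcs := hasCompactSupport_cylDeriv hs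
  obtain ⟨C, hC⟩ := hc.bounded_above_of_compact_support hcs
  have hi := hs.convolutionExists_right (.lsmul ℝ ℝ) hf.locallyIntegrable
    (continuous_of_contDiff hρ)
  have hi' := hcs.convolutionExists_right (.lsmul ℝ ℝ) hf.locallyIntegrable hc
  refine hasFDerivAt_integral_of_dominated_of_fderiv_le (s := univ) (bound := fun z => ‖f z‖ * C)
    (F := fun y z => f z * ρ (cover n y - z)) (F' := fun y z => f z • cylDeriv ρ (cover n y - z))
    univ_mem (.of_forall fun y => (hi (cover n y)).aestronglyMeasurable) (hi (cover n y))
    (hi' (cover n y)).aestronglyMeasurable (.of_forall fun z y _ => ?_) (hf.norm.mul_const C)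
    (.of_forall fun z y _ => ?_)
  · rw [norm_smul]
    gcongr
    exact hC _
  · simpa only [neg_add_eq_sub] using (hasFDerivAt_add_cover hρ (-z) y).const_mul (f z)

theorem contDiff_convolution (hf : Integrable f) (hρ : ContDiff ℝ 1 (ρ ∘ cover n))
    (hs : HasCompactSupport ρ) : ContDiff ℝ 1 ((f ⋆ ρ) ∘ cover n) := by
  rw [contDiff_one_iff_fderiv]
  refine ⟨fun y => (hasFDerivAt_convolution hf hρ hs y).differentiableAt, ?_⟩
  rw [funext fun y => (hasFDerivAt_convolution hf hρ hs y).fderiv]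
  exact ((hasCompactSupport_cylDeriv hs).continuous_convolution_right _ hf.locallyIntegrable
    (continuous_cylDeriv hρ)).comp (continuous_cover n)

theorem pderiv_convolution (hf : Integrable f) (hρ : ContDiff ℝ 1 (ρ ∘ cover n))
    (hs : HasCompactSupport ρ) (i : Fin (n + 1)) : pderiv i (f ⋆ ρ) = f ⋆ pderiv i ρ := by
  funext x
  obtain ⟨y, rfl⟩ := surjective_cover n x
  have hi : Integrable fun z => f z • cylDeriv ρ (cover n y - z) :=
    (hasCompactSupport_cylDeriv hs).convolutionExists_right (.lsmul ℝ ℝ) hf.locallyIntegrable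
      (continuous_cylDeriv hρ) (cover n y)
  rw [pderiv_eq_cylDeriv (contDiff_convolution hf hρ hs), cylDeriv_cover,
    (hasFDerivAt_convolution hf hρ hs y).fderiv]
  refine (ContinuousLinearMap.integral_apply hi _).trans ?_
  simp only [convolution_def, pderiv_eq_cylDeriv hρ, ContinuousLinearMap.lsmul_apply,
    smul_apply]

theorem pderiv_sub_left (ρ : Cyl n → ℝ) (i : Fin (n + 1)) (x z : Cyl n) :
    pderiv i (fun z => ρ (x - z)) z = -pderiv i ρ (x - z) := by
  have hneg : ∀ t : ℝ, x - (z + cover n (EuclideanSpace.single i t)) =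
      x - z + cover n (EuclideanSpace.single i (-t)) := fun t => by
    have : EuclideanSpace.single i (-t) = -EuclideanSpace.single i t := by
      ext j
      by_cases hj : j = i <;> simp [hj]
    rw [this, cover_neg]
    abel
  have h := deriv_comp_neg (f := fun t : ℝ => ρ (x - z + cover n (EuclideanSpace.single i t))) 0
  rw [neg_zero] at h
  simp only [pderiv, hneg, h]

theorem isTest_sub_left (hρ : ContDiff ℝ ∞ (ρ ∘ cover n))
    (hr : Function.support ρ ⊆ Metric.ball 0 r) {x : Cyl n} (hx : r < bdryDist x) :
    IsTest fun z => ρ (x - z) := by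
  have hsub : tsupport (fun z => ρ (x - z)) ⊆ univ ×ˢ Icc (x.2 - r) (x.2 + r) := by
    refine closure_minimal (fun z hz => ?_) (isClosed_univ.prod isClosed_Icc)
    have hz' := abs_le.1 ((norm_snd_le (x - z)).trans (mem_ball_zero_iff.1 (hr hz)).le)
    simp only [Prod.snd_sub] at hz'
    exact ⟨mem_univ _, by linarith, by linarith⟩
  rw [bdryDist, lt_min_iff] at hx
  refine ⟨?_, ?_, ?_⟩
  · obtain ⟨y, rfl⟩ := surjective_cover n x
    have : (fun z => ρ (cover n y - z)) ∘ cover n = (ρ ∘ cover n) ∘ fun ζ => y - ζ := by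
      funext ζ
      simp only [Function.comp_apply, sub_eq_add_neg, cover_add, cover_neg]
    rw [this]
    exact hρ.comp (by fun_prop)
  · exact (isCompact_univ.prod isCompact_Icc).of_isClosed_subset (isClosed_tsupport _) hsub
  · exact hsub.trans (prod_mono_right fun s hs => ⟨by linarith [hs.1], by linarith [hs.2]⟩)

theorem mem_innerDomain_of_lt_bdryDist {δ : ℝ} (hδ : 0 ≤ δ) {x z : Cyl n}
    (hx : r + δ < bdryDist x) (hz : x - z ∈ Metric.ball 0 r) : z ∈ innerDomain n δ := by
  have hxz := abs_le.1 ((norm_snd_le (x - z)).trans (mem_ball_zero_iff.1 hz).le)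
  simp only [Prod.snd_sub] at hxz
  rw [bdryDist, lt_min_iff] at hx
  exact ⟨⟨mem_univ _, by linarith, by linarith⟩, le_min (by linarith) (by linarith)⟩

theorem pderiv_convolution_indicator {u : Cyl n → ℝ}
    {G : Cyl n → EuclideanSpace ℝ (Fin (n + 1))} (hG : IsWeakGrad u G)
    (hu : Integrable u (volOmega n)) (hρ : ContDiff ℝ ∞ (ρ ∘ cover n))
    (hr : Function.support ρ ⊆ Metric.ball 0 r) {δ : ℝ} (hδ : 0 ≤ δ) {x : Cyl n}
    (hx : r + δ < bdryDist x) (i : Fin (n + 1)) :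
    pderiv i ((Omega n).indicator u ⋆ ρ) x =
      ((innerDomain n δ).indicator (fun z => G z i) ⋆ ρ) x := by
  have hΩ := (isOpen_Omega n).measurableSet
  have hweak := hG.2 i _ (isTest_sub_left hρ hr (by linarith : r < bdryDist x))
  simp only [pderiv_sub_left, mul_neg, integral_neg, neg_inj] at hweak
  rw [volOmega_eq_restrict] at hu hweak
  rw [pderiv_convolution ((integrable_indicator_iff hΩ).2 hu) (hρ.of_le (by simp))
    (hasCompactSupport_of_support_subset_ball hr), convolution_def, convolution_def]
  calc ∫ z, (Omega n).indicator u z * pderiv i ρ (x - z)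
      = ∫ z in Omega n, u z * pderiv i ρ (x - z) := by
        rw [← integral_indicator hΩ]
        simp only [indicator_mul_left]
    _ = ∫ z in Omega n, G z i * ρ (x - z) := hweak
    _ = ∫ z, (innerDomain n δ).indicator (fun z => G z i) z * ρ (x - z) := by
        rw [← integral_indicator hΩ]
        refine integral_congr_ae (.of_forall fun z => ?_)
        by_cases h0 : ρ (x - z) = 0
        · simp [indicator, h0]
        · have hz := mem_innerDomain_of_lt_bdryDist hδ hx (hr h0)
          simp only [indicator_of_mem hz, indicator_of_mem hz.1]

end convolution

/-! ### Mollifiers -/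

/-- The function `cos (2π t)` on the circle `ℝ / ℤ`. -/
def circleCos (y : UnitAddCircle) : ℝ := (fourier 1 y : ℂ).re

theorem circleCos_coe (t : ℝ) : circleCos (t : UnitAddCircle) = Real.cos (2 * Real.pi * t) := by
  rw [circleCos, fourier_coe_apply, ← Complex.exp_ofReal_mul_I_re]
  congr 2
  push_cast
  ring

theorem continuous_circleCos : Continuous circleCos :=
  Complex.continuous_re.comp (map_continuous (fourier 1))

theorem circleCos_le_one (y : UnitAddCircle) : circleCos y ≤ 1 := by
  induction y using QuotientAddGroup.induction_on with
  | H t => exact (circleCos_coe t).trans_le (Real.cos_le_one _)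

theorem circleCos_eq_one_iff {y : UnitAddCircle} : circleCos y = 1 ↔ y = 0 := by
  induction y using QuotientAddGroup.induction_on with
  | H t =>
    refine (circleCos_coe t).congr_left.trans ((Real.cos_eq_one_iff _).trans
      (Iff.trans ?_ (AddCircle.coe_eq_zero_iff (1 : ℝ)).symm))
    refine exists_congr fun k => ?_
    rw [zsmul_one, mul_comm (k : ℝ), mul_right_inj' Real.two_pi_pos.ne']

/-- A smooth function on the cylinder, positive away from its zero at the origin; it replaces the
square of the norm, which is not smooth on the torus. -/
def well {n : ℕ} (x : Cyl n) : ℝ := ∑ i, (1 - circleCos (x.1 i)) + x.2 ^ 2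

section well

variable {n : ℕ}

theorem continuous_well : Continuous (well (n := n)) := by
  have := continuous_circleCos
  unfold well
  fun_prop

theorem contDiff_well : ContDiff ℝ ∞ (well ∘ cover n) := by
  have : well ∘ cover n = fun y => ∑ i : Fin n, (1 - Real.cos (2 * Real.pi * y i.castSucc)) +
      y (Fin.last n) ^ 2 := by
    funext y
    simp [well, cover, circleCos_coe]
  rw [this]
  fun_prop

theorem well_zero : well (0 : Cyl n) = 0 := by simp [well, circleCos_eq_one_iff.2]

theorem sum_one_sub_circleCos_nonneg (y : UnitAddTorus (Fin n)) :
    0 ≤ ∑ i, (1 - circleCos (y i)) :=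
  Finset.sum_nonneg fun _ _ => sub_nonneg.2 (circleCos_le_one _)

theorem sq_snd_le_well (x : Cyl n) : x.2 ^ 2 ≤ well x :=
  le_add_of_nonneg_left (sum_one_sub_circleCos_nonneg x.1)

theorem well_pos {x : Cyl n} (hx : x ≠ 0) : 0 < well x := by
  contrapose! hx
  have hsum := sum_one_sub_circleCos_nonneg x.1
  have hsq := sq_nonneg x.2
  unfold well at hx
  have hcos := (Finset.sum_eq_zero_iff_of_nonneg fun _ _ => sub_nonneg.2 (circleCos_le_one _)).1
    (le_antisymm (by linarith) hsum)
  exact Prod.ext (funext fun i => circleCos_eq_one_iff.1 (sub_eq_zero.1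
    (hcos i (Finset.mem_univ i))).symm) (sq_eq_zero_iff.1 (by linarith))

theorem exists_forall_well_lt_norm_lt {δ : ℝ} (hδ : 0 < δ) :
    ∃ η > 0, ∀ x : Cyl n, well x < η → ‖x‖ < δ := by
  let K : Set (Cyl n) := (univ ×ˢ Icc (-1) 1) ∩ {x | δ ≤ ‖x‖}
  have hK : IsCompact K := (isCompact_univ.prod isCompact_Icc).inter_right
    (isClosed_le continuous_const continuous_norm)
  have hmem : ∀ x : Cyl n, well x < 1 → δ ≤ ‖x‖ → x ∈ K := fun x h1 h2 =>
    ⟨⟨mem_univ _, abs_le.1 ((sq_le_one_iff_abs_le_one _).1 ((sq_snd_le_well x).trans h1.le))⟩, h2⟩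
  rcases K.eq_empty_or_nonempty with hempty | hne
  · refine ⟨1, one_pos, fun x hx => ?_⟩
    by_contra! h
    exact notMem_empty x (hempty ▸ hmem x hx h)
  · obtain ⟨x₀, hx₀, hmin⟩ := hK.exists_isMinOn hne continuous_well.continuousOn
    have hpos : 0 < well x₀ := well_pos (norm_pos_iff.1 (hδ.trans_le hx₀.2))
    refine ⟨min 1 (well x₀), lt_min one_pos hpos, fun x hx => ?_⟩
    by_contra! h
    exact (hx.trans_le (min_le_right _ _)).not_ge
      (hmin (hmem x (hx.trans_le (min_le_left _ _)) h))

end well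

/-- A mollifier: a smooth probability density supported in the ball of radius `r` about the
origin of the cylinder. -/
structure IsKernel {n : ℕ} (ρ : Cyl n → ℝ) (r : ℝ) : Prop where
  contDiff : ContDiff ℝ ∞ (ρ ∘ cover n)
  nonneg : ∀ x, 0 ≤ ρ x
  integral_eq_one : ∫ x, ρ x = 1
  support_subset : Function.support ρ ⊆ Metric.ball 0 r

theorem exists_isKernel (n : ℕ) {r : ℝ} (hr : 0 < r) : ∃ ρ : Cyl n → ℝ, IsKernel ρ r := by
  obtain ⟨η, hη, hwell⟩ := exists_forall_well_lt_norm_lt (n := n) hr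
  let bump : Cyl n → ℝ := fun x => Real.smoothTransition (η - well x)
  have hsmooth : ContDiff ℝ ∞ (bump ∘ cover n) :=
    Real.smoothTransition.contDiff.comp (contDiff_const.sub contDiff_well)
  have hsupp : Function.support bump ⊆ Metric.ball 0 r := fun x hx => by
    refine mem_ball_zero_iff.2 (hwell x ?_)
    by_contra! hc
    exact hx (Real.smoothTransition.zero_of_nonpos (sub_nonpos.2 hc))
  have hnonneg : ∀ x, 0 ≤ bump x := fun x => Real.smoothTransition.nonneg _
  have hzero : bump 0 ≠ 0 := (Real.smoothTransition.pos_of_pos (by simpa [well_zero])).ne'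
  have hpos : 0 < ∫ x, bump x :=
    (continuous_of_comp_cover hsmooth.continuous).integral_pos_of_hasCompactSupport_nonneg_nonzero
      (hasCompactSupport_of_support_subset_ball hsupp) hnonneg hzero
  exact ⟨fun x => (∫ x, bump x)⁻¹ * bump x, {
    contDiff := contDiff_const.mul hsmooth
    nonneg := fun x => mul_nonneg (inv_nonneg.2 hpos.le) (hnonneg x)
    integral_eq_one := by rw [integral_const_mul, inv_mul_cancel₀ hpos.ne']
    support_subset := (Function.support_mul_subset_right _ _).trans hsupp }⟩

/-- The affine map of `Ω` into `{x : t ≤ d(x)}`. Composing a mollified function with it gives an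
approximation defined up to the boundary. -/
def squeeze {n : ℕ} (t : ℝ) (x : Cyl n) : Cyl n := (x.1, t + (1 - 2 * t) * x.2)

section squeeze

variable {n : ℕ} {t : ℝ}

theorem continuous_squeeze (t : ℝ) : Continuous (squeeze (n := n) t) := by
  unfold squeeze; fun_prop

theorem dist_squeeze_le {x : Cyl n} (hx : x ∈ Omega n) : dist (squeeze t x) x ≤ |t| := by
  simp only [squeeze, Prod.dist_eq, dist_self, Real.dist_eq]
  refine max_le (abs_nonneg _) ?_
  rw [show t + (1 - 2 * t) * x.2 - x.2 = t * (1 - 2 * x.2) by ring, abs_mul]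
  exact mul_le_of_le_one_right (abs_nonneg _)
    (abs_le.2 ⟨by linarith [hx.2.2], by linarith [hx.2.1]⟩)

theorem lintegral_squeeze_le (ht : t ≤ 1 / 4) {g : Cyl n → ℝ≥0∞} (hg : Measurable g) :
    ∫⁻ x, g (squeeze t x) ∂(volOmega n) ≤ 2 * ∫⁻ x, g x := by
  have h0 : 1 - 2 * t ≠ 0 := by linarith
  have hinv : ENNReal.ofReal |(1 - 2 * t)⁻¹| ≤ 2 := by
    rw [← ENNReal.ofReal_ofNat, abs_of_pos (inv_pos.2 (by linarith))]
    refine ENNReal.ofReal_le_ofReal ((inv_le_comm₀ (by linarith) two_pos).2 (by linarith))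
  have hgt : Measurable fun x => g (squeeze t x) := hg.comp (continuous_squeeze t).measurable
  rw [volOmega, lintegral_prod _ hgt.aemeasurable,
    Measure.volume_eq_prod, lintegral_prod _ hg.aemeasurable,
    ← lintegral_const_mul _ hg.lintegral_prod_right']
  refine lintegral_mono fun y => (setLIntegral_le_lintegral _ _).trans ?_
  calc ∫⁻ s, g (y, t + (1 - 2 * t) * s)
      = ENNReal.ofReal |(1 - 2 * t)⁻¹| * ∫⁻ s, g (y, s) := by
        have hm : Measurable fun s => g (y, t + s) := hg.comp (by fun_prop)
        rw [← lintegral_map hm (measurable_const_mul (1 - 2 * t)), Real.map_volume_mul_left h0,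
          lintegral_smul_measure, lintegral_add_left_eq_self (fun s => g (y, s)) t, smul_eq_mul]
    _ ≤ 2 * ∫⁻ s, g (y, s) := by gcongr

end squeeze

section IsKernel

variable {n : ℕ} {ρ f g : Cyl n → ℝ} {r t : ℝ}

theorem IsKernel.contDiff_one (h : IsKernel ρ r) : ContDiff ℝ 1 (ρ ∘ cover n) :=
  h.contDiff.of_le (by simp)

theorem IsKernel.continuous (h : IsKernel ρ r) : Continuous ρ :=
  continuous_of_contDiff h.contDiff_one

theorem IsKernel.hasCompactSupport (h : IsKernel ρ r) : HasCompactSupport ρ :=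
  hasCompactSupport_of_support_subset_ball h.support_subset

theorem IsKernel.contDiff_convolution (h : IsKernel ρ r) (hf : Integrable f) :
    ContDiff ℝ 1 ((f ⋆ ρ) ∘ cover n) :=
  ThinLayer.contDiff_convolution hf h.contDiff_one h.hasCompactSupport

theorem IsKernel.continuous_convolution_squeeze (h : IsKernel ρ r) (hf : Integrable f) :
    Continuous fun x => (f ⋆ ρ) (squeeze t x) :=
  (continuous_of_contDiff (h.contDiff_convolution hf)).comp (continuous_squeeze t)

theorem IsKernel.lintegral_eq_one (h : IsKernel ρ r) : ∫⁻ z, ENNReal.ofReal (ρ z) = 1 := by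
  rw [← ofReal_integral_eq_lintegral_ofReal
    (h.continuous.integrable_of_hasCompactSupport h.hasCompactSupport) (.of_forall h.nonneg),
    h.integral_eq_one, ENNReal.ofReal_one]

theorem IsKernel.enorm_convolution_sq_le (h : IsKernel ρ r) (hf : AEStronglyMeasurable f)
    (x : Cyl n) : ‖(f ⋆ ρ) x‖ₑ ^ 2 ≤ ∫⁻ z, ‖f z‖ₑ ^ 2 * ENNReal.ofReal (ρ (x - z)) := by
  have hm : Measurable fun z => ENNReal.ofReal (ρ (x - z)) :=
    (h.continuous.comp (continuous_const.sub continuous_id)).measurable.ennreal_ofReal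
  have hmass : ∫⁻ z, ENNReal.ofReal (ρ (x - z)) = 1 := by
    rw [lintegral_sub_left_eq_self (fun z => ENNReal.ofReal (ρ z)), h.lintegral_eq_one]
  calc ‖(f ⋆ ρ) x‖ₑ ^ 2
      ≤ (∫⁻ z, ‖f z‖ₑ * ENNReal.ofReal (ρ (x - z))) ^ 2 := by
        gcongr
        refine (enorm_integral_le_lintegral_enorm _).trans_eq (lintegral_congr fun z => ?_)
        rw [ContinuousLinearMap.lsmul_apply, enorm_smul, Real.enorm_eq_ofReal (h.nonneg _)]
    _ = (∫⁻ z, ‖f z‖ₑ * ENNReal.ofReal (ρ (x - z)) ^ (1 / 2 : ℝ) *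
          ENNReal.ofReal (ρ (x - z)) ^ (1 / 2 : ℝ)) ^ 2 := by
        simp only [mul_assoc, ← sq, rpow_half_sq]
    _ ≤ (∫⁻ z, (‖f z‖ₑ * ENNReal.ofReal (ρ (x - z)) ^ (1 / 2 : ℝ)) ^ 2) *
          ∫⁻ z, (ENNReal.ofReal (ρ (x - z)) ^ (1 / 2 : ℝ)) ^ 2 :=
        lintegral_mul_sq_le (hf.enorm.mul (hm.pow_const _).aemeasurable)
          (hm.pow_const _).aemeasurable
    _ = ∫⁻ z, ‖f z‖ₑ ^ 2 * ENNReal.ofReal (ρ (x - z)) := by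
        simp only [mul_pow, rpow_half_sq, hmass, mul_one]

theorem IsKernel.eLpNorm_convolution_squeeze_le (h : IsKernel ρ r) (ht : t ≤ 1 / 4)
    (hf : AEStronglyMeasurable f) :
    eLpNorm (fun x => (f ⋆ ρ) (squeeze t x)) 2 (volOmega n) ≤ 2 * eLpNorm f 2 volume := by
  have hm : AEMeasurable (Function.uncurry fun x z : Cyl n =>
      ‖f z‖ₑ ^ 2 * ENNReal.ofReal (ρ (squeeze t x - z))) ((volOmega n).prod volume) := by
    have hc : Continuous fun p : Cyl n × Cyl n => ρ (squeeze t p.1 - p.2) :=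
      h.continuous.comp (((continuous_squeeze t).comp continuous_fst).sub continuous_snd)
    exact (hf.comp_snd.enorm.pow_const 2).mul hc.measurable.ennreal_ofReal.aemeasurable
  have hmass : ∀ z, ∫⁻ x, ENNReal.ofReal (ρ (squeeze t x - z)) ∂volOmega n ≤ 2 := fun z => by
    have hmz : Measurable fun x => ENNReal.ofReal (ρ (x - z)) :=
      (h.continuous.comp (continuous_id.sub continuous_const)).measurable.ennreal_ofReal
    refine (lintegral_squeeze_le ht hmz).trans_eq ?_
    rw [lintegral_sub_right_eq_self (fun x => ENNReal.ofReal (ρ x)), h.lintegral_eq_one, mul_one]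
  apply eLpNorm_two_le_of_lintegral_le
  calc ∫⁻ x, ‖(f ⋆ ρ) (squeeze t x)‖ₑ ^ 2 ∂volOmega n
      ≤ ∫⁻ x, ∫⁻ z, ‖f z‖ₑ ^ 2 * ENNReal.ofReal (ρ (squeeze t x - z)) ∂volume ∂volOmega n :=
        lintegral_mono fun x => h.enorm_convolution_sq_le hf _
    _ = ∫⁻ z, ∫⁻ x, ‖f z‖ₑ ^ 2 * ENNReal.ofReal (ρ (squeeze t x - z)) ∂volOmega n :=
        lintegral_lintegral_swap hm
    _ ≤ ∫⁻ z, ‖f z‖ₑ ^ 2 * 2 := by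
        refine lintegral_mono fun z => ?_
        rw [lintegral_const_mul' _ _ (by simp)]
        gcongr
        exact hmass z
    _ ≤ (2 * eLpNorm f 2 volume) ^ 2 := by
        rw [lintegral_mul_const' _ _ (by simp), ← eLpNorm_two_sq, mul_pow, mul_comm]
        gcongr
        norm_num

theorem IsKernel.dist_convolution_squeeze_le (h : IsKernel ρ r) (hg : Continuous g) {δ η : ℝ}
    (hη : 0 ≤ η) (hgδ : ∀ x y, dist x y < δ → dist (g x) (g y) ≤ η) (hδ : r + |t| < δ)
    {x : Cyl n} (hx : x ∈ Omega n) : dist ((g ⋆ ρ) (squeeze t x)) (g x) ≤ η := by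
  have hswap : (g ⋆ ρ) (squeeze t x) = (ρ ⋆ g) (squeeze t x) := by
    rw [convolution_lsmul_swap, convolution_def]
    simp only [ContinuousLinearMap.lsmul_apply, smul_eq_mul, mul_comm]
  rw [hswap]
  refine dist_convolution_le hη h.support_subset h.nonneg h.integral_eq_one
    hg.aestronglyMeasurable fun z hz => hgδ z x ?_
  calc dist z x ≤ dist z (squeeze t x) + dist (squeeze t x) x := dist_triangle _ _ _
    _ < δ := by linarith [Metric.mem_ball.1 hz, dist_squeeze_le (t := t) hx]

theorem IsKernel.eLpNorm_convolution_squeeze_sub_le (h : IsKernel ρ r) (ht : t ≤ 1 / 4)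
    (hf : Integrable f) (hg : Integrable g) :
    eLpNorm (fun x => (f ⋆ ρ) (squeeze t x) - f x) 2 (volOmega n) ≤
      3 * eLpNorm (f - g) 2 volume +
        eLpNorm (fun x => (g ⋆ ρ) (squeeze t x) - g x) 2 (volOmega n) := by
  have hexists : ∀ {f : Cyl n → ℝ}, Integrable f → ConvolutionExists f ρ (.lsmul ℝ ℝ) :=
    fun hf => h.hasCompactSupport.convolutionExists_right _ hf.locallyIntegrable h.continuous
  have hac : volOmega n ≪ volume := (volOmega_le_volume n).absolutelyContinuous
  have hsplit : (fun x => (f ⋆ ρ) (squeeze t x) - f x) =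
      (fun x => ((f - g) ⋆ ρ) (squeeze t x)) +
        ((fun x => (g ⋆ ρ) (squeeze t x) - g x) + (g - f)) := by
    funext x
    have hadd := (hexists (hf.sub hg)).add_distrib (hexists hg)
    rw [sub_add_cancel] at hadd
    simp only [hadd, Pi.add_apply, Pi.sub_apply]
    ring
  have hfgm : AEStronglyMeasurable (fun x => ((f - g) ⋆ ρ) (squeeze t x)) (volOmega n) :=
    (h.continuous_convolution_squeeze (hf.sub hg)).aestronglyMeasurable
  have hgf : AEStronglyMeasurable (g - f) (volOmega n) := (hg.1.sub hf.1).mono_ac hac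
  have hgm : AEStronglyMeasurable (fun x => (g ⋆ ρ) (squeeze t x) - g x) (volOmega n) :=
    (h.continuous_convolution_squeeze hg).aestronglyMeasurable.sub (hg.1.mono_ac hac)
  rw [hsplit]
  calc _ ≤ eLpNorm (fun x => ((f - g) ⋆ ρ) (squeeze t x)) 2 (volOmega n) +
        (eLpNorm (fun x => (g ⋆ ρ) (squeeze t x) - g x) 2 (volOmega n) +
          eLpNorm (g - f) 2 (volOmega n)) :=
        (eLpNorm_add_le hfgm (hgm.add hgf) one_le_two).trans
          (add_le_add_right (eLpNorm_add_le hgm hgf one_le_two) _)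
    _ ≤ 2 * eLpNorm (f - g) 2 volume +
        (eLpNorm (fun x => (g ⋆ ρ) (squeeze t x) - g x) 2 (volOmega n) +
          eLpNorm (f - g) 2 volume) := by
        rw [eLpNorm_sub_comm g f]
        gcongr
        · exact h.eLpNorm_convolution_squeeze_le ht (hf.sub hg).1
        · exact volOmega_le_volume n
    _ = _ := by ring

theorem tendsto_convolution_squeeze {ρ : ℕ → Cyl n → ℝ} {r t : ℕ → ℝ}
    (h : ∀ k, IsKernel (ρ k) (r k)) (hr : Tendsto r atTop (𝓝 0)) (ht : Tendsto t atTop (𝓝 0))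
    (ht4 : ∀ k, t k ≤ 1 / 4) (hf : MemLp f 2) (hfi : Integrable f) :
    Tendsto (fun k => eLpNorm (fun x => (f ⋆ ρ k) (squeeze (t k) x) - f x) 2 (volOmega n))
      atTop (𝓝 0) := by
  refine ENNReal.tendsto_nhds_zero.2 fun ε hε => ?_
  rcases eq_or_ne ε ⊤ with rfl | hεt
  · simp
  obtain ⟨η, hη, hηε⟩ : ∃ η : ℝ, 0 < η ∧ 4 * ENNReal.ofReal η = ε := by
    refine ⟨(ε / 4).toReal, ENNReal.toReal_pos (by simpa using hε.ne')
      (ENNReal.div_ne_top hεt (by simp)), ?_⟩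
    rw [ENNReal.ofReal_toReal (ENNReal.div_ne_top hεt (by simp)),
      ENNReal.mul_div_cancel (by simp) (by simp)]
  obtain ⟨g, hgs, hfg, hg, -⟩ := hf.exists_hasCompactSupport_eLpNorm_sub_le (by simp)
    (ENNReal.ofReal_pos.2 hη).ne'
  obtain ⟨δ, hδ, hgδ⟩ := Metric.uniformContinuous_iff.1
    (hgs.uniformContinuous_of_continuous hg) η hη
  have hsmall : ∀ᶠ k in atTop, r k + |t k| < δ := by
    have : Tendsto (fun k => r k + |t k|) atTop (𝓝 0) := by simpa using hr.add ht.abs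
    exact this.eventually_lt_const hδ
  filter_upwards [hsmall] with k hk
  have hclose : eLpNorm (fun x => (g ⋆ ρ k) (squeeze (t k) x) - g x) 2 (volOmega n) ≤
      ENNReal.ofReal η := by
    refine (eLpNorm_le_of_ae_bound (C := η) ?_).trans_eq (by simp)
    filter_upwards [ae_mem_Omega n] with x hx
    exact (h k).dist_convolution_squeeze_le hg hη.le (fun x y hxy => (hgδ hxy).le) hk hx
  calc eLpNorm (fun x => (f ⋆ ρ k) (squeeze (t k) x) - f x) 2 (volOmega n)
      ≤ 3 * eLpNorm (f - g) 2 volume + _ := (h k).eLpNorm_convolution_squeeze_sub_le (ht4 k) hfi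
        (hg.integrable_of_hasCompactSupport hgs)
    _ ≤ 3 * ENNReal.ofReal η + ENNReal.ofReal η := by gcongr
    _ = ε := by rw [← hηε]; ring

end IsKernel

/-! ### Approximation by functions of class `C¹` -/

theorem eLpNorm_euclidean_sq {α ι : Type*} [MeasurableSpace α] [Fintype ι] {μ : Measure α}
    {F : α → EuclideanSpace ℝ ι} (hF : AEStronglyMeasurable F μ) :
    eLpNorm F 2 μ ^ 2 = ∑ i, eLpNorm (fun x => F x i) 2 μ ^ 2 := by
  have hi : ∀ i, AEMeasurable (fun x => ‖F x i‖ₑ ^ 2) μ := fun i =>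
    ((EuclideanSpace.proj i : EuclideanSpace ℝ ι →L[ℝ] ℝ).continuous.comp_aestronglyMeasurable
      hF).enorm.pow_const 2
  simp only [eLpNorm_two_sq]
  rw [← lintegral_finsetSum' _ fun i _ => hi i]
  refine lintegral_congr fun x => ?_
  simp only [← ofReal_norm, ← ENNReal.ofReal_pow (norm_nonneg _)]
  rw [EuclideanSpace.norm_sq_eq, ENNReal.ofReal_sum_of_nonneg fun i _ => by positivity]

theorem memLp_coord {α ι : Type*} [MeasurableSpace α] [Fintype ι] {μ : Measure α} {p : ℝ≥0∞}
    {F : α → EuclideanSpace ℝ ι} (hF : MemLp F p μ) (i : ι) : MemLp (fun x => F x i) p μ :=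
  (EuclideanSpace.proj i : EuclideanSpace ℝ ι →L[ℝ] ℝ).comp_memLp' hF

theorem tendsto_zero_of_sq {ι : Type*} {l : Filter ι} {f : ι → ℝ≥0∞}
    (h : Tendsto (fun k => f k ^ 2) l (𝓝 0)) : Tendsto f l (𝓝 0) := by
  have hsqrt := (ENNReal.continuous_rpow_const (y := 1 / 2)).tendsto 0 |>.comp h
  rw [ENNReal.zero_rpow_of_pos (by norm_num)] at hsqrt
  refine hsqrt.congr fun k => ?_
  rw [Function.comp_apply, ← ENNReal.rpow_natCast_mul]
  norm_num

section Approximation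

variable {n : ℕ}

theorem mem_innerDomain_of_lt {δ : ℝ} (hδ : 0 ≤ δ) {x : Cyl n} (h : δ < bdryDist x) :
    x ∈ innerDomain n δ :=
  mem_innerDomain_of_lt_bdryDist (r := (bdryDist x - δ) / 2) (x := x) hδ (by linarith)
    (by simpa using h)

theorem innerDomain_zero (n : ℕ) : innerDomain n 0 = Omega n :=
  Subset.antisymm (fun _ hx => hx.1) fun _ hx =>
    ⟨hx, le_min hx.2.1.le (sub_nonneg.2 hx.2.2.le)⟩

theorem volOmega_restrict_innerDomain (n : ℕ) (δ : ℝ) :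
    (volOmega n).restrict (innerDomain n δ) = volume.restrict (innerDomain n δ) := by
  rw [volOmega_eq_restrict, Measure.restrict_restrict (measurableSet_innerDomain n δ),
    inter_eq_left.2 fun x hx => hx.1]

theorem memLp_indicator_innerDomain {p : ℝ≥0∞} {δ : ℝ} {f : Cyl n → ℝ}
    (hf : MemLp f p ((volOmega n).restrict (innerDomain n δ))) :
    MemLp ((innerDomain n δ).indicator f) p volume := by
  rw [volOmega_restrict_innerDomain] at hf
  exact (memLp_indicator_iff_restrict (measurableSet_innerDomain n δ)).2 hf

theorem memLp_indicator_Omega {p : ℝ≥0∞} {f : Cyl n → ℝ} (hf : MemLp f p (volOmega n)) :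
    MemLp ((Omega n).indicator f) p volume := by
  rw [← innerDomain_zero]
  exact memLp_indicator_innerDomain (hf.mono_measure Measure.restrict_le_self)

theorem integrable_indicator_innerDomain {δ : ℝ} {f : Cyl n → ℝ}
    (hf : MemLp f 2 ((volOmega n).restrict (innerDomain n δ))) :
    Integrable ((innerDomain n δ).indicator f) :=
  memLp_one_iff_integrable.1 (memLp_indicator_innerDomain (hf.mono_exponent one_le_two))

theorem integrable_indicator_Omega {f : Cyl n → ℝ} (hf : MemLp f 2 (volOmega n)) :
    Integrable ((Omega n).indicator f) :=
  memLp_one_iff_integrable.1 (memLp_indicator_Omega (hf.mono_exponent one_le_two))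

theorem exists_seq_isKernel (n : ℕ) : ∃ (ρ : ℕ → Cyl n → ℝ) (r : ℕ → ℝ),
    (∀ k, IsKernel (ρ k) (r k)) ∧ (∀ k, r k ∈ Ioo 0 (1 / 8)) ∧ Tendsto r atTop (𝓝 0) := by
  obtain ⟨r, -, hr, hr0⟩ := exists_seq_strictAnti_tendsto' (show (0 : ℝ) < 1 / 8 by norm_num)
  choose ρ hρ using fun k => exists_isKernel n (hr k).1
  exact ⟨ρ, r, hρ, hr, hr0⟩

/-- `u` is the limit in `L²(Ω)` of functions of class `C¹` whose normal derivatives converge to `g`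
in `L²_loc(Ω)`. Only the normal derivative matters for the comparison of averages over layers. -/
def NormalApprox (u g : Cyl n → ℝ) : Prop :=
  ∃ ψ : ℕ → Cyl n → ℝ, (∀ k, ContDiff ℝ 1 (ψ k ∘ cover n)) ∧
    Tendsto (fun k => eLpNorm (fun x => ψ k x - u x) 2 (volOmega n)) atTop (𝓝 0) ∧
    ∀ δ : ℝ, 0 < δ → Tendsto (fun k => eLpNorm (fun x => pderiv (Fin.last n) (ψ k) x - g x) 2
      ((volOmega n).restrict (innerDomain n δ))) atTop (𝓝 0)

theorem tendsto_convolution_sub {ρ : ℕ → Cyl n → ℝ} {r : ℕ → ℝ}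
    (h : ∀ k, IsKernel (ρ k) (r k)) (hr : Tendsto r atTop (𝓝 0)) {f : Cyl n → ℝ}
    (hf : MemLp f 2) (hfi : Integrable f) :
    Tendsto (fun k => eLpNorm (fun x => (f ⋆ ρ k) x - f x) 2 (volOmega n)) atTop (𝓝 0) := by
  have hlim := tendsto_convolution_squeeze h hr (t := fun _ => 0) tendsto_const_nhds (by simp)
    hf hfi
  simpa only [squeeze, mul_zero, sub_zero, one_mul, zero_add] using hlim

theorem IsWeakGrad.normalApprox {u : Cyl n → ℝ} {G : Cyl n → EuclideanSpace ℝ (Fin (n + 1))}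
    (hG : IsWeakGrad u G) (hu : MemLp u 2 (volOmega n))
    (hG2 : ∀ δ : ℝ, 0 < δ → MemLp G 2 ((volOmega n).restrict (innerDomain n δ))) :
    NormalApprox u fun x => G x (Fin.last n) := by
  obtain ⟨ρ, r, hρ, -, hr⟩ := exists_seq_isKernel n
  have hui := integrable_indicator_Omega hu
  refine ⟨fun k => (Omega n).indicator u ⋆ ρ k, fun k => (hρ k).contDiff_convolution hui, ?_,
    fun δ hδ => ?_⟩
  · refine (tendsto_convolution_sub hρ hr (memLp_indicator_Omega hu) hui).congr fun k =>
      eLpNorm_congr_ae ?_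
    filter_upwards [ae_mem_Omega n] with x hx
    rw [indicator_of_mem hx]
  · have hg := memLp_coord (hG2 (δ / 2) (half_pos hδ)) (Fin.last n)
    refine tendsto_of_tendsto_of_tendsto_of_le_of_le' tendsto_const_nhds
      (tendsto_convolution_sub hρ hr (memLp_indicator_innerDomain hg)
        (integrable_indicator_innerDomain hg)) (.of_forall fun _ => zero_le) ?_
    filter_upwards [hr.eventually_lt_const (half_pos hδ)] with k hk
    refine (eLpNorm_congr_ae ?_).trans_le (eLpNorm_mono_measure _ Measure.restrict_le_self)
    filter_upwards [ae_restrict_mem (measurableSet_innerDomain n δ)] with x hx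
    have hδx : δ ≤ bdryDist x := hx.2
    rw [pderiv_convolution_indicator hG (hu.integrable one_le_two) (hρ k).contDiff
      (hρ k).support_subset (δ := δ / 2) (by linarith) (by linarith),
      indicator_of_mem (mem_innerDomain_of_lt (by linarith) (by linarith))]

theorem reflect_preimage_innerDomain (n : ℕ) (δ : ℝ) :
    reflect ⁻¹' innerDomain n δ = innerDomain n δ := by
  ext x
  simp only [innerDomain, mem_preimage, mem_ofPred_eq, bdryDist_reflect, Omega]
  simp [reflect, and_comm]

theorem NormalApprox.reflect {u g : Cyl n → ℝ} (h : NormalApprox u g)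
    (hu : AEStronglyMeasurable u (volOmega n))
    (hg : ∀ δ : ℝ, 0 < δ → AEStronglyMeasurable g ((volOmega n).restrict (innerDomain n δ))) :
    NormalApprox (u ∘ reflect) fun x => -g (reflect x) := by
  obtain ⟨ψ, hψ, hψu, hψg⟩ := h
  refine ⟨fun k => ψ k ∘ ThinLayer.reflect, fun k => contDiff_reflect (hψ k), ?_,
    fun δ hδ => ?_⟩
  · exact hψu.congr fun k => (eLpNorm_comp_measurePreserving
      ((continuous_of_contDiff (hψ k)).aestronglyMeasurable.sub hu)
      (measurePreserving_reflect n)).symm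
  · have hp : MeasurePreserving ThinLayer.reflect ((volOmega n).restrict (innerDomain n δ))
        ((volOmega n).restrict (innerDomain n δ)) := by
      simpa only [reflect_preimage_innerDomain] using
        (measurePreserving_reflect n).restrict_preimage (measurableSet_innerDomain n δ)
    refine (hψg δ hδ).congr fun k => ?_
    refine (eLpNorm_comp_measurePreserving
      ((continuous_pderiv (hψ k) _).aestronglyMeasurable.sub (hg δ hδ)) hp).symm.trans ?_
    rw [← eLpNorm_neg]
    congr 1
    funext x
    simp only [Pi.neg_apply, Pi.sub_apply, Function.comp_apply, pderiv_last_reflect (hψ k)]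
    ring

theorem squeeze_cover (t : ℝ) (y : EuclideanSpace ℝ (Fin (n + 1))) :
    squeeze t (cover n y) = cover n
      (y + (t - 2 * t * y (Fin.last n)) • EuclideanSpace.single (Fin.last n) (1 : ℝ)) := by
  refine Prod.ext (funext fun j => ?_) ?_
  · simp [squeeze, cover]
  · simp only [squeeze, cover, PiLp.add_apply, PiLp.smul_apply, PiLp.single_apply, if_true,
      smul_eq_mul]
    ring

theorem contDiff_squeeze {ψ : Cyl n → ℝ} (hψ : ContDiff ℝ 1 (ψ ∘ cover n)) (t : ℝ) :
    ContDiff ℝ 1 ((fun x => ψ (squeeze t x)) ∘ cover n) := by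
  have hsq : (fun x => ψ (squeeze t x)) ∘ cover n = (ψ ∘ cover n) ∘ fun y =>
      y + (t - 2 * t * y (Fin.last n)) • EuclideanSpace.single (Fin.last n) (1 : ℝ) :=
    funext fun y => congrArg ψ (squeeze_cover t y)
  rw [hsq]
  exact hψ.comp (by fun_prop)

/-- The factor by which `squeeze t` contracts the `i`-th direction: `1 - 2 t` across the cylinder,
`1` along the torus. -/
def squeezeFactor (t : ℝ) (i : Fin (n + 1)) : ℝ := if i = Fin.last n then 1 - 2 * t else 1

theorem pderiv_squeeze (ψ : Cyl n → ℝ) (t : ℝ) (i : Fin (n + 1)) (x : Cyl n) :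
    pderiv i (fun x => ψ (squeeze t x)) x = squeezeFactor t i * pderiv i ψ (squeeze t x) := by
  have hline : ∀ s, squeeze t (x + cover n (EuclideanSpace.single i s)) =
      squeeze t x + cover n (EuclideanSpace.single i (squeezeFactor t i * s)) := fun s => by
    unfold squeezeFactor
    split_ifs with hi
    · subst hi
      rw [cover_single_last, cover_single_last]
      refine Prod.ext (by simp [squeeze]) ?_
      simp only [squeeze, Prod.snd_add]
      ring
    · refine Prod.ext (by simp [squeeze]) ?_
      simp [squeeze, cover, Ne.symm hi]
  have hchain := deriv_comp_mul_left (squeezeFactor t i)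
    (fun s => ψ (squeeze t x + cover n (EuclideanSpace.single i s))) 0
  rw [mul_zero, smul_eq_mul] at hchain
  simp only [pderiv, hline, hchain]

theorem abs_squeezeFactor_le_one {t : ℝ} (h0 : 0 ≤ t) (h1 : t ≤ 1) (i : Fin (n + 1)) :
    |squeezeFactor t i| ≤ 1 := by
  unfold squeezeFactor
  split_ifs
  · exact abs_le.2 ⟨by linarith, by linarith⟩
  · simp

theorem abs_squeezeFactor_sub_one_le {t : ℝ} (h0 : 0 ≤ t) (i : Fin (n + 1)) :
    |squeezeFactor t i - 1| ≤ 2 * t := by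
  unfold squeezeFactor
  split_ifs
  · exact abs_le.2 ⟨by linarith, by linarith⟩
  · simpa using h0

section

variable {u ρ : Cyl n → ℝ} {G : Cyl n → EuclideanSpace ℝ (Fin (n + 1))} {r : ℝ}

-- For `x ∈ Ω` the point `squeeze (2 r) x` is farther than `r` from `∂Ω`, so the mollification there
-- only sees `u` inside `Ω`.
theorem pderiv_convolution_squeeze (hG : IsWeakGrad u G) (hu : Integrable u (volOmega n))
    (hρ : IsKernel ρ r) (hr : 0 < r) (hr8 : r ≤ 1 / 8) {x : Cyl n} (hx : x ∈ Omega n)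
    (i : Fin (n + 1)) :
    pderiv i (fun x => ((Omega n).indicator u ⋆ ρ) (squeeze (2 * r) x)) x =
      squeezeFactor (2 * r) i *
        ((Omega n).indicator (fun z => G z i) ⋆ ρ) (squeeze (2 * r) x) := by
  have hdist : r + 0 < bdryDist (squeeze (2 * r) x) := by
    have hx0 : 0 < x.2 := hx.2.1
    have hx1 : x.2 < 1 := hx.2.2
    rw [bdryDist, lt_min_iff]
    simp only [squeeze]
    constructor <;> nlinarith
  rw [pderiv_squeeze, pderiv_convolution_indicator hG hu hρ.contDiff hρ.support_subset le_rfl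
    hdist, innerDomain_zero]

theorem eLpNorm_pderiv_convolution_squeeze_sub_le (hG : IsWeakGrad u G)
    (hu : Integrable u (volOmega n)) {i : Fin (n + 1)}
    (hGi : MemLp (fun x => G x i) 2 (volOmega n)) (hρ : IsKernel ρ r) (hr : 0 < r)
    (hr8 : r ≤ 1 / 8) :
    eLpNorm (fun x =>
        pderiv i (fun x => ((Omega n).indicator u ⋆ ρ) (squeeze (2 * r) x)) x - G x i) 2
        (volOmega n) ≤
      eLpNorm (fun x => ((Omega n).indicator (fun z => G z i) ⋆ ρ) (squeeze (2 * r) x) -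
        (Omega n).indicator (fun z => G z i) x) 2 (volOmega n) +
      ENNReal.ofReal (2 * (2 * r)) * eLpNorm (fun x => G x i) 2 (volOmega n) := by
  set g : Cyl n → ℝ := (Omega n).indicator fun z => G z i with hg
  have hgi : Integrable g := integrable_indicator_Omega hGi
  have hgm : AEStronglyMeasurable g (volOmega n) :=
    hgi.1.mono_ac (volOmega_le_volume n).absolutelyContinuous
  have hm : AEStronglyMeasurable (fun x => (g ⋆ ρ) (squeeze (2 * r) x) - g x) (volOmega n) :=
    (hρ.continuous_convolution_squeeze hgi).aestronglyMeasurable.sub hgm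
  calc _ = eLpNorm ((fun x => squeezeFactor (2 * r) i * ((g ⋆ ρ) (squeeze (2 * r) x) - g x)) +
        fun x => (squeezeFactor (2 * r) i - 1) * G x i) 2 (volOmega n) := by
        refine eLpNorm_congr_ae ?_
        filter_upwards [ae_mem_Omega n] with x hx
        rw [pderiv_convolution_squeeze hG hu hρ hr hr8 hx]
        simp only [Pi.add_apply, hg, indicator_of_mem hx]
        ring
    _ ≤ _ := eLpNorm_add_le (hm.const_mul _) (hGi.1.const_mul _) one_le_two
    _ ≤ _ := by
        refine add_le_add (eLpNorm_mono fun x => ?_)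
          (eLpNorm_le_mul_eLpNorm_of_ae_le_mul (.of_forall fun x => ?_) 2)
        · rw [norm_mul]
          exact mul_le_of_le_one_left (norm_nonneg _)
            (abs_squeezeFactor_le_one (by linarith) (by linarith) i)
        · rw [norm_mul]
          exact mul_le_mul_of_nonneg_right (abs_squeezeFactor_sub_one_le (by linarith) i)
            (norm_nonneg _)

end

theorem exists_contDiff_approx {u : Cyl n → ℝ} {G : Cyl n → EuclideanSpace ℝ (Fin (n + 1))}
    (hu : MemLp u 2 (volOmega n)) (hG : IsWeakGrad u G) (hG2 : MemLp G 2 (volOmega n)) :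
    ∃ ψ : ℕ → Cyl n → ℝ, (∀ k, ContDiff ℝ 1 (ψ k ∘ cover n)) ∧
      Tendsto (fun k => eLpNorm (fun x => ψ k x - u x) 2 (volOmega n)) atTop (𝓝 0) ∧
      Tendsto (fun k => eLpNorm (fun x => grad (ψ k) x - G x) 2 (volOmega n)) atTop (𝓝 0) := by
  obtain ⟨ρ, r, hρ, hr, hr0⟩ := exists_seq_isKernel n
  have ht : Tendsto (fun k => 2 * r k) atTop (𝓝 0) := by simpa using hr0.const_mul 2
  have ht4 : ∀ k, 2 * r k ≤ 1 / 4 := fun k => by linarith [(hr k).2]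
  have hui := integrable_indicator_Omega hu
  have hC := fun k => contDiff_squeeze ((hρ k).contDiff_convolution hui) (2 * r k)
  refine ⟨_, hC, ?_, tendsto_zero_of_sq ?_⟩
  · refine (tendsto_convolution_squeeze hρ hr0 ht ht4 (memLp_indicator_Omega hu) hui).congr
      fun k => eLpNorm_congr_ae ?_
    filter_upwards [ae_mem_Omega n] with x hx
    rw [indicator_of_mem hx]
  · refine Tendsto.congr (fun k => (eLpNorm_euclidean_sq
      ((continuous_grad (hC k)).aestronglyMeasurable.sub hG2.1)).symm) ?_
    rw [show (0 : ℝ≥0∞) = ∑ i : Fin (n + 1), 0 ^ 2 by simp]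
    refine tendsto_finsetSum _ fun i _ => ENNReal.Tendsto.pow ?_
    have hGi := memLp_coord hG2 i
    have hmoll := tendsto_convolution_squeeze hρ hr0 ht ht4 (memLp_indicator_Omega hGi)
      (integrable_indicator_Omega hGi)
    have hfactor : Tendsto (fun k => ENNReal.ofReal (2 * (2 * r k)) *
        eLpNorm (fun x => G x i) 2 (volOmega n)) atTop (𝓝 0) := by
      simpa using ENNReal.Tendsto.mul_const (ENNReal.tendsto_ofReal (ht.const_mul 2))
        (Or.inr hGi.2.ne)
    refine tendsto_of_tendsto_of_tendsto_of_le_of_le tendsto_const_nhds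
      (add_zero (0 : ℝ≥0∞) ▸ hmoll.add hfactor) (fun _ => zero_le) fun k => ?_
    exact eLpNorm_pderiv_convolution_squeeze_sub_le hG (hu.integrable one_le_two) hGi (hρ k)
      (hr k).1 (hr k).2.le

end Approximation

section L2

variable {α ι F : Type*} [MeasurableSpace α] [NormedAddCommGroup F] {μ : Measure α} {l : Filter ι}
  {f g : ι → α → F} {f₀ g₀ : α → F}

theorem eLpNorm_sub_triangle {f g h : α → F} (hf : AEStronglyMeasurable f μ)
    (hg : AEStronglyMeasurable g μ) (hh : AEStronglyMeasurable h μ) :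
    eLpNorm (fun x => f x - h x) 2 μ ≤
      eLpNorm (fun x => f x - g x) 2 μ + eLpNorm (fun x => g x - h x) 2 μ := by
  simpa only [sub_add_sub_cancel, Pi.add_def, Pi.sub_def] using
    eLpNorm_add_le (hf.sub hg) (hg.sub hh) one_le_two

theorem tendsto_eLpNorm_of_tendsto_sub (hf : ∀ᶠ i in l, AEStronglyMeasurable (f i) μ)
    (hf₀ : AEStronglyMeasurable f₀ μ)
    (h : Tendsto (fun i => eLpNorm (fun x => f i x - f₀ x) 2 μ) l (𝓝 0)) :
    Tendsto (fun i => eLpNorm (f i) 2 μ) l (𝓝 (eLpNorm f₀ 2 μ)) := by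
  have hlower := ENNReal.Tendsto.sub (tendsto_const_nhds (x := eLpNorm f₀ 2 μ) (f := l)) h
    (.inr ENNReal.zero_ne_top)
  have hupper := h.add_const (eLpNorm f₀ 2 μ)
  rw [tsub_zero] at hlower
  rw [zero_add] at hupper
  refine tendsto_of_tendsto_of_tendsto_of_le_of_le' hlower hupper ?_ ?_
  · filter_upwards [hf] with i hi
    rw [tsub_le_iff_right]
    simpa only [Pi.add_def, Pi.sub_def, sub_sub_cancel] using
      (eLpNorm_sub_le hi (hi.sub hf₀) one_le_two)
  · filter_upwards [hf] with i hi
    simpa only [Pi.add_def, Pi.sub_def, sub_add_cancel] using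
      (eLpNorm_add_le (hi.sub hf₀) hf₀ one_le_two)

theorem tendsto_eLpNorm_sub (hf : ∀ᶠ i in l, AEStronglyMeasurable (f i) μ)
    (hf₀ : AEStronglyMeasurable f₀ μ) (hg : ∀ᶠ i in l, AEStronglyMeasurable (g i) μ)
    (hg₀ : AEStronglyMeasurable g₀ μ)
    (hff : Tendsto (fun i => eLpNorm (fun x => f i x - f₀ x) 2 μ) l (𝓝 0))
    (hgg : Tendsto (fun i => eLpNorm (fun x => g i x - g₀ x) 2 μ) l (𝓝 0)) :
    Tendsto (fun i => eLpNorm (fun x => f i x - g i x) 2 μ) l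
      (𝓝 (eLpNorm (fun x => f₀ x - g₀ x) 2 μ)) := by
  refine tendsto_eLpNorm_of_tendsto_sub (f := fun i x => f i x - g i x) ?_ (hf₀.sub hg₀) ?_
  · filter_upwards [hf, hg] with i hi hi' using hi.sub hi'
  · have hadd := hff.add hgg
    rw [add_zero] at hadd
    refine tendsto_of_tendsto_of_tendsto_of_le_of_le' tendsto_const_nhds hadd
      (.of_forall fun _ => zero_le) ?_
    filter_upwards [hf, hg] with i hi hi'
    simpa only [Pi.sub_def, sub_sub_sub_comm] using
      (eLpNorm_sub_le (hi.sub hf₀) (hi'.sub hg₀) one_le_two)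

theorem tendsto_eLpNorm_of_le_smul {ν : Measure α} {K : ℝ≥0∞} (hK : K ≠ ⊤) (hν : ν ≤ K • μ)
    (hf : ∀ᶠ i in l, AEStronglyMeasurable (f i) μ) (hf₀ : AEStronglyMeasurable f₀ μ)
    (h : Tendsto (fun i => eLpNorm (fun x => f i x - f₀ x) 2 μ) l (𝓝 0)) :
    Tendsto (fun i => eLpNorm (f i) 2 ν) l (𝓝 (eLpNorm f₀ 2 ν)) := by
  have hac : ν ≪ μ :=
    (Measure.absolutelyContinuous_of_le hν).trans Measure.smul_absolutelyContinuous
  refine tendsto_eLpNorm_of_tendsto_sub (hf.mono fun i hi => hi.mono_ac hac) (hf₀.mono_ac hac) ?_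
  have hlim := ENNReal.Tendsto.const_mul (a := K ^ (1 / (2 : ℝ≥0∞)).toReal) h
    (.inr (ENNReal.rpow_ne_top_of_nonneg ENNReal.toReal_nonneg hK))
  rw [mul_zero] at hlim
  exact tendsto_of_tendsto_of_tendsto_of_le_of_le tendsto_const_nhds hlim (fun _ => zero_le)
    fun i => eLpNorm_le_of_measure_le_smul hν

end L2

section Averages

variable {n : ℕ} {c d δ : ℝ} {f g u : Cyl n → ℝ}

theorem aestronglyMeasurable_layerAvg_of_memLp (hu : MemLp u 2 (volOmega n)) (hc : 0 ≤ c)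
    (hcd : c ≤ d) (hd : d ≤ 1) : AEStronglyMeasurable (layerAvg c d u) volume :=
  aestronglyMeasurable_layerAvg hcd (hu.mono_measure (slab_le_volOmega hc hd)).1

theorem eLpNorm_layerAvg_le_volOmega (hu : AEStronglyMeasurable u (volOmega n)) (hc : 0 ≤ c)
    (hcd : c < d) (hd : d ≤ 1) :
    eLpNorm (layerAvg c d u) 2 volume ≤
      ENNReal.ofReal (√(d - c))⁻¹ * eLpNorm u 2 (volOmega n) := by
  have hle : slab n c d ≤ volOmega n := slab_le_volOmega hc hd
  refine (eLpNorm_layerAvg_le hcd (hu.mono_measure hle)).trans (mul_le_mul' (le_of_eq ?_)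
    (eLpNorm_mono_measure u hle))
  rw [← ENNReal.ofReal_inv_of_pos (sub_pos.2 hcd), ENNReal.ofReal_rpow_of_nonneg
    (inv_nonneg.2 (sub_pos.2 hcd).le) one_half_pos.le, ← Real.sqrt_eq_rpow, Real.sqrt_inv]

theorem eLpNorm_layerAvg_sub_layerAvg_le (hf : MemLp f 2 (volOmega n))
    (hg : MemLp g 2 (volOmega n)) (hc : 0 ≤ c) (hcd : c < d) (hd : d ≤ 1) :
    eLpNorm (fun y => layerAvg c d f y - layerAvg c d g y) 2 volume ≤
      ENNReal.ofReal (√(d - c))⁻¹ * eLpNorm (fun x => f x - g x) 2 (volOmega n) := by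
  have hle : slab n c d ≤ volOmega n := slab_le_volOmega hc hd
  have hint : ∀ {h : Cyl n → ℝ}, MemLp h 2 (volOmega n) → Integrable h (slab n c d) := fun hh =>
    (hh.integrable one_le_two).mono_measure hle
  rw [← eLpNorm_congr_ae (layerAvg_sub_ae hcd.le (hint hf) (hint hg))]
  exact eLpNorm_layerAvg_le_volOmega (hf.1.sub hg.1) hc hcd hd

theorem tendsto_layerAvg {ι : Type*} {l : Filter ι} {U : ι → Cyl n → ℝ}
    (hU : ∀ i, MemLp (U i) 2 (volOmega n)) (hu : MemLp u 2 (volOmega n))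
    (hUu : Tendsto (fun i => eLpNorm (fun x => U i x - u x) 2 (volOmega n)) l (𝓝 0))
    (hc : 0 ≤ c) (hcd : c < d) (hd : d ≤ 1) :
    Tendsto (fun i => eLpNorm (fun y => layerAvg c d (U i) y - layerAvg c d u y) 2 volume) l
      (𝓝 0) := by
  have hlim := ENNReal.Tendsto.const_mul (a := ENNReal.ofReal (√(d - c))⁻¹) hUu
    (.inr ENNReal.ofReal_ne_top)
  rw [mul_zero] at hlim
  exact tendsto_of_tendsto_of_tendsto_of_le_of_le tendsto_const_nhds hlim (fun _ => zero_le)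
    fun i => eLpNorm_layerAvg_sub_layerAvg_le (hU i) hu hc hcd hd

theorem layerAvg_sub_layerAvg_zero_ae (hu : MemLp u 2 (volOmega n)) {r : ℝ} (hr : 0 < r)
    (hrd : r < d) (hd : d ≤ 1) :
    (fun y => layerAvg r d u y - layerAvg 0 d u y) =ᵐ[volume]
      (r / (d - r)) • fun y => layerAvg 0 d u y - layerAvg 0 r u y := by
  have hint : Integrable u (slab n 0 d) :=
    (hu.integrable one_le_two).mono_measure (slab_le_volOmega le_rfl hd)
  filter_upwards [hint.prod_right_ae] with y hy
  have hii : ∀ a b, 0 ≤ a → a ≤ b → b ≤ d → IntervalIntegrable (fun s => u (y, s)) volume a b :=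
    fun a b ha hab hb => (intervalIntegrable_iff_integrableOn_Ioo_of_le hab).2
      (IntegrableOn.mono_set hy (Ioo_subset_Ioo ha hb))
  have hsplit := intervalIntegral.integral_add_adjacent_intervals
    (hii 0 r le_rfl hr.le hrd.le) (hii r d hr.le hrd.le le_rfl)
  have hdr : d - r ≠ 0 := (sub_pos.2 hrd).ne'
  have hd0 : d ≠ 0 := (hr.trans hrd).ne'
  simp only [layerAvg, interval_average_eq, ← hsplit, Pi.smul_apply, smul_eq_mul, sub_zero]
  field_simp
  ring

theorem eLpNorm_layerAvg_sub_layerAvg_zero_le (hu : MemLp u 2 (volOmega n)) {r : ℝ} (hr : 0 < r)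
    (hrd : r < d) (hd : d ≤ 1) :
    eLpNorm (fun y => layerAvg r d u y - layerAvg 0 d u y) 2 volume ≤
      ENNReal.ofReal ((r / √d + √r) / (d - r)) * eLpNorm u 2 (volOmega n) := by
  have hq : 0 ≤ r / (d - r) := div_nonneg hr.le (sub_pos.2 hrd).le
  have hd0 := hr.trans hrd
  have hcoeff : (r / √d + √r) / (d - r) = r / (d - r) * ((√d)⁻¹ + (√r)⁻¹) := by
    linear_combination (-(1 / (d - r))) * Real.div_sqrt (x := r)
  have hsub := eLpNorm_sub_le (aestronglyMeasurable_layerAvg_of_memLp hu le_rfl hd0.le hd)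
    (aestronglyMeasurable_layerAvg_of_memLp hu le_rfl hr.le (hrd.le.trans hd)) one_le_two
  rw [eLpNorm_congr_ae (layerAvg_sub_layerAvg_zero_ae hu hr hrd hd), eLpNorm_const_smul,
    Real.enorm_eq_ofReal hq, hcoeff, ENNReal.ofReal_mul hq, mul_assoc,
    ENNReal.ofReal_add (by positivity) (by positivity), add_mul]
  refine mul_le_mul' le_rfl (hsub.trans (add_le_add ?_ ?_))
  · simpa only [sub_zero] using eLpNorm_layerAvg_le_volOmega hu.1 le_rfl hd0 hd
  · simpa only [sub_zero] using eLpNorm_layerAvg_le_volOmega hu.1 le_rfl hr (hrd.le.trans hd)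

theorem tendsto_layerAvg_nhdsGT_zero (hu : MemLp u 2 (volOmega n)) (hd0 : 0 < d) (hd : d ≤ 1) :
    Tendsto (fun r => eLpNorm (fun y => layerAvg r d u y - layerAvg 0 d u y) 2 volume)
      (𝓝[>] 0) (𝓝 0) := by
  have hcoeff : Tendsto (fun r => (r / √d + √r) / (d - r)) (𝓝[>] 0) (𝓝 0) := by
    have hc : ContinuousAt (fun r => (r / √d + √r) / (d - r)) 0 := by
      have : d - 0 ≠ 0 := by simpa using hd0.ne'
      fun_prop (disch := assumption)
    simpa using hc.tendsto.mono_left (nhdsWithin_le_nhds (s := Ioi 0))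
  have hlim := ENNReal.Tendsto.mul_const (ENNReal.tendsto_ofReal hcoeff) (.inr hu.2.ne)
  rw [ENNReal.ofReal_zero, zero_mul] at hlim
  refine tendsto_of_tendsto_of_tendsto_of_le_of_le' tendsto_const_nhds hlim
    (.of_forall fun _ => zero_le) ?_
  filter_upwards [Ioo_mem_nhdsGT hd0] with r hr
  exact eLpNorm_layerAvg_sub_layerAvg_zero_le hu hr.1 hr.2 hd

theorem tendsto_layerAvg_of_tendsto_left {ι : Type*} {l : Filter ι} {e : ι → ℝ}
    (he : Tendsto e l (𝓝[>] 0)) {U : ι → Cyl n → ℝ} (hU : ∀ i, MemLp (U i) 2 (volOmega n))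
    (hu : MemLp u 2 (volOmega n))
    (hUu : Tendsto (fun i => eLpNorm (fun x => U i x - u x) 2 (volOmega n)) l (𝓝 0))
    (hd0 : 0 < d) (hd : d ≤ 1) :
    Tendsto (fun i => eLpNorm (fun y => layerAvg (e i) d (U i) y - layerAvg 0 d u y) 2 volume) l
      (𝓝 0) := by
  have he0 := he.mono_right nhdsWithin_le_nhds
  have hcoeff : Tendsto (fun i => ENNReal.ofReal (√(d - e i))⁻¹) l
      (𝓝 (ENNReal.ofReal (√(d - 0))⁻¹)) :=
    ENNReal.tendsto_ofReal ((tendsto_const_nhds.sub he0).sqrt.inv₀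
      (by simpa using (Real.sqrt_pos.2 hd0).ne'))
  have hlim := (ENNReal.Tendsto.mul hcoeff (.inr ENNReal.zero_ne_top) hUu
    (.inr ENNReal.ofReal_ne_top)).add ((tendsto_layerAvg_nhdsGT_zero hu hd0 hd).comp he)
  rw [mul_zero, add_zero] at hlim
  refine tendsto_of_tendsto_of_tendsto_of_le_of_le' tendsto_const_nhds hlim
    (.of_forall fun _ => zero_le) ?_
  filter_upwards [he.eventually (Ioo_mem_nhdsGT hd0)] with i hi
  have hm : ∀ {f : Cyl n → ℝ}, MemLp f 2 (volOmega n) →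
      AEStronglyMeasurable (layerAvg (e i) d f) volume := fun hf =>
    aestronglyMeasurable_layerAvg_of_memLp hf hi.1.le hi.2.le hd
  exact (eLpNorm_sub_triangle (hm (hU i)) (hm hu)
    (aestronglyMeasurable_layerAvg_of_memLp hu le_rfl hd0.le hd)).trans
    (add_le_add (eLpNorm_layerAvg_sub_layerAvg_le (hU i) hu hi.1.le hi.2 hd) le_rfl)

theorem slab_le_restrict_innerDomain (hδ : 0 ≤ δ) (hc : δ ≤ c) (hd : d ≤ 1 / 2) :
    slab n c d ≤ (volOmega n).restrict (innerDomain n δ) := by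
  rw [slab, volOmega_restrict_innerDomain, Measure.volume_eq_prod,
    ← Measure.restrict_univ (μ := (volume : Measure (UnitAddTorus (Fin n)))),
    Measure.prod_restrict, Measure.restrict_univ]
  refine Measure.restrict_mono ?_ le_rfl
  rintro x ⟨-, hcx, hxd⟩
  exact ⟨⟨mem_univ _, by linarith, by linarith⟩, le_min (by linarith) (by linarith)⟩

theorem weightedSlab_le_smul {W : ℝ → ℝ≥0∞} {C : ℝ≥0∞} (hWC : ∀ σ ∈ Ioo c d, W σ ≤ C) :
    weightedSlab n c d W ≤ C • slab n c d := by
  rw [weightedSlab, ← withDensity_const]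
  refine withDensity_mono ?_
  filter_upwards [Measure.quasiMeasurePreserving_snd.ae (ae_restrict_mem measurableSet_Ioo)]
    with x hx using hWC _ hx

theorem memLp_of_continuous {F : Type*} [NormedAddCommGroup F]
    [SecondCountableTopologyEither (Cyl n) F] {f : Cyl n → F} (hf : Continuous f) :
    MemLp f 2 (volOmega n) := by
  obtain ⟨C, hC⟩ := ((isCompact_univ (X := UnitAddTorus (Fin n))).prod
    (isCompact_Icc (a := (0 : ℝ)) (b := 1))).exists_bound_of_continuousOn hf.continuousOn
  refine MemLp.of_bound hf.aestronglyMeasurable C ?_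
  filter_upwards [ae_mem_Omega n] with x hx
  exact hC x ⟨mem_univ _, Ioo_subset_Icc_self hx.2⟩

theorem aestronglyMeasurable_slice {ψ : Cyl n → ℝ} (hψ : ContDiff ℝ 1 (ψ ∘ cover n)) (s : ℝ) :
    AEStronglyMeasurable (fun y => ψ (y, s)) volume :=
  ((continuous_of_contDiff hψ).comp (Continuous.prodMk_left s)).aestronglyMeasurable

theorem eLpNorm_layerAvg_sub_layerAvg_le_of_contDiff {ψ : Cyl n → ℝ}
    (hψ : ContDiff ℝ 1 (ψ ∘ cover n)) {r ε : ℝ} (hr : 0 ≤ r) (hrε : r < ε) (hεδ : ε < δ)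
    (hδ : δ ≤ 1) {W : ℝ → ℝ≥0∞} (hW : AEMeasurable W (volume.restrict (Ioo r ε)))
    (hW0 : ∀ σ ∈ Ioo r ε, W σ ≠ 0) {C : ℝ≥0∞} (hC : C ≠ ⊤) (hWC : ∀ σ ∈ Ioo r ε, W σ ≤ C) :
    eLpNorm (fun y => layerAvg r ε ψ y - layerAvg ε δ ψ y) 2 volume ≤
      (ENNReal.ofReal (ε - r))⁻¹ * (∫⁻ s in Ioo r ε, resistance W ε s ^ (1 / 2 : ℝ)) *
        eLpNorm (pderiv (Fin.last n) ψ) 2 (weightedSlab n r ε W) +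
      ENNReal.ofReal (δ - ε) ^ (1 / 2 : ℝ) * eLpNorm (pderiv (Fin.last n) ψ) 2 (slab n ε δ) := by
  have hψ2 := memLp_of_continuous (continuous_of_contDiff hψ)
  refine (eLpNorm_sub_triangle
    (aestronglyMeasurable_layerAvg_of_memLp hψ2 hr hrε.le (hεδ.le.trans hδ))
    (aestronglyMeasurable_slice hψ ε)
    (aestronglyMeasurable_layerAvg_of_memLp hψ2 (hr.trans hrε.le) hεδ.le hδ)).trans (add_le_add
      (eLpNorm_layerAvg_sub_le hψ hrε ⟨hrε.le, le_rfl⟩ hW hW0 hC hWC) ?_)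
  exact (eLpNorm_sub_comm _ _ _ _).trans_le
    (eLpNorm_layerAvg_sub_le_slab hψ hεδ ⟨le_rfl, hεδ.le⟩)

section NormalApprox

variable {r ε : ℝ} {W : ℝ → ℝ≥0∞} {C : ℝ≥0∞}

theorem NormalApprox.eLpNorm_layerAvg_sub_layerAvg_le (h : NormalApprox u g)
    (hu : MemLp u 2 (volOmega n)) (hr : 0 < r) (hrε : r < ε) (hεδ : ε < δ) (hδ : δ ≤ 1 / 2)
    (hg : AEStronglyMeasurable g ((volOmega n).restrict (innerDomain n r)))
    (hW : AEMeasurable W (volume.restrict (Ioo r ε)))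
    (hW0 : ∀ σ ∈ Ioo r ε, W σ ≠ 0) (hC : C ≠ ⊤) (hWC : ∀ σ ∈ Ioo r ε, W σ ≤ C)
    (hI : ∫⁻ s in Ioo r ε, resistance W ε s ^ (1 / 2 : ℝ) ≠ ⊤) :
    eLpNorm (fun y => layerAvg r ε u y - layerAvg ε δ u y) 2 volume ≤
      (ENNReal.ofReal (ε - r))⁻¹ * (∫⁻ s in Ioo r ε, resistance W ε s ^ (1 / 2 : ℝ)) *
        eLpNorm g 2 (weightedSlab n r ε W) +
      ENNReal.ofReal (δ - ε) ^ (1 / 2 : ℝ) * eLpNorm g 2 (slab n ε δ) := by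
  obtain ⟨ψ, hψ, hψu, hψg⟩ := h
  have hψ2 : ∀ k, MemLp (ψ k) 2 (volOmega n) := fun k =>
    memLp_of_continuous (continuous_of_contDiff (hψ k))
  have hε : 0 < ε := hr.trans hrε
  have havg : ∀ {f : Cyl n → ℝ}, MemLp f 2 (volOmega n) →
      AEStronglyMeasurable (layerAvg r ε f) volume ∧
        AEStronglyMeasurable (layerAvg ε δ f) volume := fun hf =>
    ⟨aestronglyMeasurable_layerAvg_of_memLp hf hr.le hrε.le (by linarith),
      aestronglyMeasurable_layerAvg_of_memLp hf hε.le hεδ.le (by linarith)⟩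
  have hderiv : ∀ {μ : Measure (Cyl n)} {K : ℝ≥0∞}, K ≠ ⊤ →
      μ ≤ K • (volOmega n).restrict (innerDomain n r) →
      Tendsto (fun k => eLpNorm (pderiv (Fin.last n) (ψ k)) 2 μ) atTop (𝓝 (eLpNorm g 2 μ)) :=
    fun hK hμ => tendsto_eLpNorm_of_le_smul hK hμ
      (.of_forall fun k => (continuous_pderiv (hψ k) _).aestronglyMeasurable) hg (hψg r hr)
  have hslab : weightedSlab n r ε W ≤ C • (volOmega n).restrict (innerDomain n r) :=
    (weightedSlab_le_smul hWC).trans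
      (by gcongr; exact slab_le_restrict_innerDomain hr.le le_rfl (by linarith))
  have hslab' : slab n ε δ ≤ (1 : ℝ≥0∞) • (volOmega n).restrict (innerDomain n r) := by
    rw [one_smul]
    exact slab_le_restrict_innerDomain hr.le hrε.le hδ
  have hleft := tendsto_eLpNorm_sub (.of_forall fun k => (havg (hψ2 k)).1) (havg hu).1
    (.of_forall fun k => (havg (hψ2 k)).2) (havg hu).2
    (tendsto_layerAvg hψ2 hu hψu hr.le hrε (by linarith))
    (tendsto_layerAvg hψ2 hu hψu hε.le hεδ (by linarith))
  have hright := (ENNReal.Tendsto.const_mul (hderiv hC hslab) (.inr (ENNReal.mul_ne_top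
      (ENNReal.inv_ne_top.2 (by simpa using hrε : ENNReal.ofReal (ε - r) ≠ 0)) hI))).add
    (ENNReal.Tendsto.const_mul (hderiv ENNReal.one_ne_top hslab') (.inr
      (ENNReal.rpow_ne_top_of_nonneg one_half_pos.le (ENNReal.ofReal_ne_top (r := δ - ε)))))
  exact le_of_tendsto_of_tendsto' hleft hright fun k =>
    eLpNorm_layerAvg_sub_layerAvg_le_of_contDiff (hψ k) hr.le hrε hεδ (by linarith) hW hW0 hC hWC

theorem NormalApprox.eLpNorm_layerAvg_zero_sub_layerAvg_le (h : NormalApprox u g)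
    (hu : MemLp u 2 (volOmega n)) (hε : 0 < ε) (hεδ : ε < δ) (hδ : δ ≤ 1 / 2)
    (hg : ∀ r, 0 < r → AEStronglyMeasurable g ((volOmega n).restrict (innerDomain n r)))
    (hW : AEMeasurable W (volume.restrict (Ioo 0 ε)))
    (hW0 : ∀ σ ∈ Ioo 0 ε, W σ ≠ 0) (hC : C ≠ ⊤) (hWC : ∀ σ ∈ Ioo 0 ε, W σ ≤ C)
    (hI : ∫⁻ s in Ioo 0 ε, resistance W ε s ^ (1 / 2 : ℝ) ≠ ⊤) :
    eLpNorm (fun y => layerAvg 0 ε u y - layerAvg ε δ u y) 2 volume ≤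
      (ENNReal.ofReal ε)⁻¹ * (∫⁻ s in Ioo 0 ε, resistance W ε s ^ (1 / 2 : ℝ)) *
        eLpNorm g 2 (weightedSlab n 0 ε W) +
      ENNReal.ofReal (δ - ε) ^ (1 / 2 : ℝ) * eLpNorm g 2 (slab n ε δ) := by
  have havg : ∀ r ∈ Icc 0 ε, AEStronglyMeasurable (layerAvg r ε u) volume := fun r hr =>
    aestronglyMeasurable_layerAvg_of_memLp hu hr.1 hr.2 (by linarith)
  have hleft := tendsto_eLpNorm_sub (l := 𝓝[>] (0 : ℝ)) (f := fun r => layerAvg r ε u)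
    (g := fun _ => layerAvg ε δ u) (g₀ := layerAvg ε δ u)
    (by filter_upwards [Ioo_mem_nhdsGT hε] with r hr using havg r (Ioo_subset_Icc_self hr))
    (havg 0 ⟨le_rfl, hε.le⟩)
    (.of_forall fun _ => aestronglyMeasurable_layerAvg_of_memLp hu hε.le hεδ.le (by linarith))
    (aestronglyMeasurable_layerAvg_of_memLp hu hε.le hεδ.le (by linarith))
    (tendsto_layerAvg_nhdsGT_zero hu hε (by linarith)) (by simp)
  have hinv : Tendsto (fun r => (ENNReal.ofReal (ε - r))⁻¹) (𝓝[>] 0)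
      (𝓝 (ENNReal.ofReal (ε - 0))⁻¹) :=
    tendsto_inv_iff.2 (ENNReal.tendsto_ofReal
      (tendsto_const_nhds.sub (tendsto_id.mono_left nhdsWithin_le_nhds)))
  rw [sub_zero] at hinv
  simp only [mul_assoc]
  refine le_of_tendsto_of_tendsto hleft ((ENNReal.Tendsto.mul_const hinv
    (.inl (ENNReal.inv_ne_zero.2 ENNReal.ofReal_ne_top))).add_const _) ?_
  filter_upwards [Ioo_mem_nhdsGT hε] with r hr
  have hsub : Ioo r ε ⊆ Ioo 0 ε := Ioo_subset_Ioo_left hr.1.le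
  have hIr := lintegral_mono_set (μ := volume) (f := fun s => resistance W ε s ^ (1 / 2 : ℝ)) hsub
  have hle := h.eLpNorm_layerAvg_sub_layerAvg_le hu hr.1 hr.2 hεδ hδ (hg r hr.1)
    (hW.mono_set hsub) (fun σ hσ => hW0 σ (hsub hσ)) hC (fun σ hσ => hWC σ (hsub hσ))
    (ne_top_of_le_ne_top hI hIr)
  rw [mul_assoc] at hle
  refine hle.trans (add_le_add (mul_le_mul' le_rfl (mul_le_mul' hIr ?_)) le_rfl)
  exact eLpNorm_mono_measure _ (weightedSlab_mono hr.1.le le_rfl W)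

end NormalApprox

theorem eLpNorm_layerAvg_sub_le_of_tendsto {ι : Type*} {l : Filter ι} [l.NeBot] {e : ι → ℝ}
    (he : Tendsto e l (𝓝[>] 0)) {U : ι → Cyl n → ℝ} {v : UnitAddTorus (Fin n) → ℝ}
    (hv : AEStronglyMeasurable v volume) (hU : ∀ i, MemLp (U i) 2 (volOmega n))
    (hu : MemLp u 2 (volOmega n))
    (hUu : Tendsto (fun i => eLpNorm (fun x => U i x - u x) 2 (volOmega n)) l (𝓝 0))
    (hUv : Tendsto (fun i => eLpNorm (fun y => layerAvg 0 (e i) (U i) y - v y) 2 volume) l (𝓝 0))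
    {B : ι → ℝ≥0∞} (hB : Tendsto B l (𝓝 0)) {M : ℝ≥0∞} (hM : M ≠ ⊤) (hδ0 : 0 < δ) (hδ : δ ≤ 1)
    (h : ∀ᶠ i in l, eLpNorm (fun y => layerAvg 0 (e i) (U i) y - layerAvg (e i) δ (U i) y) 2
      volume ≤ B i * M + ENNReal.ofReal (δ - e i) ^ (1 / 2 : ℝ) * M) :
    eLpNorm (fun y => layerAvg 0 δ u y - v y) 2 volume ≤ ENNReal.ofReal δ ^ (1 / 2 : ℝ) * M := by
  have hmem := he.eventually (Ioo_mem_nhdsGT hδ0)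
  have hleft := tendsto_eLpNorm_sub
    (by filter_upwards [hmem] with i hi using
      aestronglyMeasurable_layerAvg_of_memLp (hU i) le_rfl hi.1.le (hi.2.le.trans hδ)) hv
    (by filter_upwards [hmem] with i hi using
      aestronglyMeasurable_layerAvg_of_memLp (hU i) hi.1.le hi.2.le hδ)
    (aestronglyMeasurable_layerAvg_of_memLp hu le_rfl hδ0.le hδ) hUv
    (tendsto_layerAvg_of_tendsto_left he hU hu hUu hδ0 hδ)
  have hright := (ENNReal.Tendsto.mul_const hB (.inr hM)).add_const
    (ENNReal.ofReal δ ^ (1 / 2 : ℝ) * M)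
  rw [zero_mul, zero_add] at hright
  refine (eLpNorm_sub_comm _ _ _ _).trans_le (le_of_tendsto_of_tendsto hleft hright ?_)
  filter_upwards [hmem, h] with i hi hle
  refine hle.trans ?_
  gcongr
  linarith [hi.1]

theorem tendsto_ofReal_rpow_half_mul {M : ℝ≥0∞} (hM : M ≠ ⊤) :
    Tendsto (fun δ : ℝ => ENNReal.ofReal δ ^ (1 / 2 : ℝ) * M) (𝓝[>] 0) (𝓝 0) := by
  have hsqrt : Continuous fun δ : ℝ => ENNReal.ofReal δ ^ (1 / 2 : ℝ) :=
    ENNReal.continuous_rpow_const.comp ENNReal.continuous_ofReal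
  simpa using ENNReal.Tendsto.mul_const ((hsqrt.tendsto 0).mono_left nhdsWithin_le_nhds) (.inr hM)

theorem eLpNorm_layerAvg_zero_sub_slice_le {ψ : Cyl n → ℝ} (hψ : ContDiff ℝ 1 (ψ ∘ cover n))
    (hδ0 : 0 < δ) (hδ : δ ≤ 1) :
    eLpNorm (fun y => layerAvg 0 δ ψ y - ψ (y, 0)) 2 volume ≤
      ENNReal.ofReal δ ^ (1 / 2 : ℝ) * eLpNorm (pderiv (Fin.last n) ψ) 2 (volOmega n) := by
  have hle := eLpNorm_layerAvg_sub_le_slab hψ hδ0 (p := 0) ⟨le_rfl, hδ0.le⟩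
  rw [sub_zero] at hle
  exact hle.trans (mul_le_mul' le_rfl (eLpNorm_mono_measure _ (slab_le_volOmega le_rfl hδ)))

theorem tendsto_slice_zero {ψ : ℕ → Cyl n → ℝ} (hψ : ∀ k, ContDiff ℝ 1 (ψ k ∘ cover n))
    (hu : MemLp u 2 (volOmega n))
    (hψu : Tendsto (fun k => eLpNorm (fun x => ψ k x - u x) 2 (volOmega n)) atTop (𝓝 0))
    {M : ℝ≥0∞} (hM : M ≠ ⊤)
    (hψM : ∀ᶠ k in atTop, eLpNorm (pderiv (Fin.last n) (ψ k)) 2 (volOmega n) ≤ M)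
    {v : UnitAddTorus (Fin n) → ℝ} (hv : AEStronglyMeasurable v volume)
    (h : ∀ δ, 0 < δ → δ ≤ 1 / 2 → eLpNorm (fun y => layerAvg 0 δ u y - v y) 2 volume ≤
      ENNReal.ofReal δ ^ (1 / 2 : ℝ) * M) :
    Tendsto (fun k => eLpNorm (fun y => ψ k (y, 0) - v y) 2 volume) atTop (𝓝 0) := by
  rw [ENNReal.tendsto_nhds_zero]
  intro η hη
  have hsmall := (tendsto_ofReal_rpow_half_mul hM).add (tendsto_ofReal_rpow_half_mul hM)
  rw [add_zero] at hsmall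
  obtain ⟨δ, hδη, hδ0, hδ⟩ := ((hsmall.eventually_lt_const hη).and
    (Ioo_mem_nhdsGT one_half_pos)).exists
  have hδ1 : δ ≤ 1 := by linarith
  have hψ2 : ∀ k, MemLp (ψ k) 2 (volOmega n) := fun k =>
    memLp_of_continuous (continuous_of_contDiff (hψ k))
  have havg : ∀ {f : Cyl n → ℝ}, MemLp f 2 (volOmega n) →
      AEStronglyMeasurable (layerAvg 0 δ f) volume := fun hf =>
    aestronglyMeasurable_layerAvg_of_memLp hf le_rfl hδ0.le hδ1
  have havgv := tendsto_eLpNorm_sub (.of_forall fun k => havg (hψ2 k)) (havg hu)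
    (.of_forall fun _ => hv) hv (tendsto_layerAvg hψ2 hu hψu le_rfl hδ0 hδ1) (by simp)
  have hlim := havgv.const_add (ENNReal.ofReal δ ^ (1 / 2 : ℝ) * M)
  have hlt := (add_le_add le_rfl (h δ hδ0 hδ.le)).trans_lt hδη
  filter_upwards [hlim.eventually_lt_const hlt, hψM] with k hk hkM
  refine ((eLpNorm_sub_triangle (aestronglyMeasurable_slice (hψ k) 0) (havg (hψ2 k)) hv).trans
    (add_le_add ?_ le_rfl)).trans hk.le
  exact (eLpNorm_sub_comm _ _ _ _).trans_le
    ((eLpNorm_layerAvg_zero_sub_slice_le (hψ k) hδ0 hδ1).trans (mul_le_mul' le_rfl hkM))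

theorem eLpNorm_layerAvg_zero_sub_le {ψ : ℕ → Cyl n → ℝ}
    (hψ : ∀ k, ContDiff ℝ 1 (ψ k ∘ cover n)) (hu : MemLp u 2 (volOmega n))
    (hψu : Tendsto (fun k => eLpNorm (fun x => ψ k x - u x) 2 (volOmega n)) atTop (𝓝 0))
    {M : ℝ≥0∞} (hψM : ∀ᶠ k in atTop, eLpNorm (pderiv (Fin.last n) (ψ k)) 2 (volOmega n) ≤ M)
    {v : UnitAddTorus (Fin n) → ℝ} (hv : AEStronglyMeasurable v volume)
    (hψv : Tendsto (fun k => eLpNorm (fun y => ψ k (y, 0) - v y) 2 volume) atTop (𝓝 0))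
    (hδ0 : 0 < δ) (hδ : δ ≤ 1) :
    eLpNorm (fun y => layerAvg 0 δ u y - v y) 2 volume ≤ ENNReal.ofReal δ ^ (1 / 2 : ℝ) * M := by
  have hψ2 : ∀ k, MemLp (ψ k) 2 (volOmega n) := fun k =>
    memLp_of_continuous (continuous_of_contDiff (hψ k))
  have havg : ∀ {f : Cyl n → ℝ}, MemLp f 2 (volOmega n) →
      AEStronglyMeasurable (layerAvg 0 δ f) volume := fun hf =>
    aestronglyMeasurable_layerAvg_of_memLp hf le_rfl hδ0.le hδ
  refine le_of_tendsto (tendsto_eLpNorm_sub (.of_forall fun k => havg (hψ2 k)) (havg hu)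
    (.of_forall fun k => aestronglyMeasurable_slice (hψ k) 0) hv
    (tendsto_layerAvg hψ2 hu hψu le_rfl hδ0 hδ) hψv) (hψM.mono fun k hk => ?_)
  exact (eLpNorm_layerAvg_zero_sub_slice_le (hψ k) hδ0 hδ).trans (mul_le_mul' le_rfl hk)

end Averages

/-! ### Weak limits of gradients -/

section WeakLimit

variable {ι : Type*}

theorem exists_tendsto_inner {H : Type*} [NormedAddCommGroup H] [InnerProductSpace ℝ H]
    [CompleteSpace H] (U : Ultrafilter ι) {h : ι → H} {M : ℝ} (hM : ∀ᶠ i in U, ‖h i‖ ≤ M) :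
    ∃ h₀ : H, ‖h₀‖ ≤ M ∧ ∀ x, Tendsto (fun i => inner ℝ (h i) x) U (𝓝 (inner ℝ h₀ x)) := by
  let f : ι → WeakDual ℝ H := fun i => StrongDual.toWeakDual (InnerProductSpace.toDual ℝ H (h i))
  have hf : ((U.map f : Ultrafilter _) : Filter _) ≤
      𝓟 (WeakDual.toStrongDual ⁻¹' Metric.closedBall (0 : StrongDual ℝ H) M) := by
    rw [le_principal_iff, Ultrafilter.coe_map, mem_map]
    filter_upwards [hM] with i hi
    simpa [f] using hi
  obtain ⟨f₀, hf₀, hlim⟩ :=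
    (WeakDual.isCompact_closedBall (𝕜 := ℝ) (E := H) 0 M).ultrafilter_le_nhds (U.map f) hf
  refine ⟨(InnerProductSpace.toDual ℝ H).symm (WeakDual.toStrongDual f₀), by simpa using hf₀,
    fun x => ?_⟩
  have hx := ((WeakDual.eval_continuous x).tendsto f₀).comp (show Tendsto f U (𝓝 f₀) from hlim)
  simpa [f, Function.comp_def] using hx

variable {α E : Type*} [MeasurableSpace α] {μ : Measure α}

theorem exists_tendsto_integral_inner [NormedAddCommGroup E] [InnerProductSpace ℝ E]
    [CompleteSpace E] (U : Ultrafilter ι) {F : ι → α → E} (hF : ∀ᶠ i in U, MemLp (F i) 2 μ)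
    {M : ℝ≥0∞} (hM : M ≠ ⊤) (hFM : ∀ᶠ i in U, eLpNorm (F i) 2 μ ≤ M) :
    ∃ H : α → E, MemLp H 2 μ ∧ eLpNorm H 2 μ ≤ M ∧ ∀ g, MemLp g 2 μ →
      Tendsto (fun i => ∫ x, inner ℝ (F i x) (g x) ∂μ) U (𝓝 (∫ x, inner ℝ (H x) (g x) ∂μ)) := by
  classical
  let f : ι → Lp E 2 μ := fun i => if h : MemLp (F i) 2 μ then h.toLp (F i) else 0
  have hfF : ∀ᶠ i in U, f i =ᵐ[μ] F i := by
    filter_upwards [hF] with i hi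
    simpa only [f, dif_pos hi] using hi.coeFn_toLp
  have hfM : ∀ᶠ i in U, ‖f i‖ ≤ M.toReal := by
    filter_upwards [hfF, hFM] with i hi hiM
    rw [Lp.norm_def, eLpNorm_congr_ae hi]
    exact ENNReal.toReal_mono hM hiM
  obtain ⟨H, hHM, hH⟩ := exists_tendsto_inner U hfM
  refine ⟨H, Lp.memLp H, (ENNReal.toReal_le_toReal (Lp.eLpNorm_ne_top H) hM).1 hHM,
    fun g hg => ?_⟩
  have hinner : ∀ {h : Lp E 2 μ} {F : α → E}, h =ᵐ[μ] F →
      inner ℝ h (hg.toLp g) = ∫ x, inner ℝ (F x) (g x) ∂μ := fun hF => by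
    rw [L2.inner_def]
    refine integral_congr_ae ?_
    filter_upwards [hF, hg.coeFn_toLp] with x hx hgx
    rw [hx, hgx]
  rw [← hinner .rfl]
  exact (hH _).congr' (hfF.mono fun i hi => hinner hi)

theorem tendsto_integral_mul {l : Filter ι} {U : ι → α → ℝ} {u g : α → ℝ}
    (hU : ∀ i, MemLp (U i) 2 μ) (hu : MemLp u 2 μ)
    (hUu : Tendsto (fun i => eLpNorm (fun x => U i x - u x) 2 μ) l (𝓝 0)) (hg : MemLp g 2 μ) :
    Tendsto (fun i => ∫ x, U i x * g x ∂μ) l (𝓝 (∫ x, u x * g x ∂μ)) := by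
  refine tendsto_integral_of_L1 (fun x => u x * g x) (hu.integrable_mul hg).1
    (.of_forall fun i => (hU i).integrable_mul hg) ?_
  have hlim := ENNReal.Tendsto.mul_const (b := eLpNorm g 2 μ) hUu (.inr hg.2.ne)
  rw [zero_mul] at hlim
  refine tendsto_of_tendsto_of_tendsto_of_le_of_le tendsto_const_nhds hlim (fun _ => zero_le)
    fun i => (ENNReal.pow_le_pow_left_iff two_ne_zero).1 ?_
  simp only [← sub_mul, enorm_mul, mul_pow, eLpNorm_two_sq]
  exact lintegral_mul_sq_le ((hU i).1.sub hu.1).enorm hg.1.enorm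

end WeakLimit

section Test

variable {φ : Cyl n → ℝ}

theorem IsTest.contDiff_one (h : IsTest φ) : ContDiff ℝ 1 (φ ∘ cover n) :=
  h.1.of_le (by simp)

theorem IsTest.continuous (h : IsTest φ) : Continuous φ :=
  continuous_of_contDiff h.contDiff_one

theorem continuous_bdryDist : Continuous (bdryDist (n := n)) := by
  unfold bdryDist
  fun_prop

theorem bdryDist_pos {x : Cyl n} (hx : x ∈ Omega n) : 0 < bdryDist x :=
  lt_min hx.2.1 (sub_pos.2 hx.2.2)

theorem bdryDist_le (x : Cyl n) : bdryDist x ≤ 1 / 2 := by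
  have h₀ : bdryDist x ≤ x.2 := min_le_left _ _
  have h₁ : bdryDist x ≤ 1 - x.2 := min_le_right _ _
  linarith

theorem IsTest.exists_support_subset (h : IsTest φ) :
    ∃ δ > 0, Function.support φ ⊆ innerDomain n δ := by
  obtain ⟨δ, hδ, hle⟩ := IsCompact.exists_forall_le' h.2.1.isCompact
    continuous_bdryDist.continuousOn fun x hx => bdryDist_pos (h.2.2 hx)
  exact ⟨δ, hδ, fun x hx => ⟨h.2.2 (subset_tsupport φ hx), hle x (subset_tsupport φ hx)⟩⟩

end Test

theorem IsWeakGrad.aestronglyMeasurable {u : Cyl n → ℝ}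
    {G : Cyl n → EuclideanSpace ℝ (Fin (n + 1))} (h : IsWeakGrad u G) :
    AEStronglyMeasurable G (volOmega n) := by
  have hunion : AEStronglyMeasurable G
      ((volOmega n).restrict (⋃ k : ℕ, innerDomain n (1 / ((k : ℝ) + 1)))) :=
    aestronglyMeasurable_iUnion_iff.2 fun k => (h.1 _ (by positivity)).1
  rwa [Measure.restrict_eq_self_of_ae_mem] at hunion
  filter_upwards [ae_mem_Omega n] with x hx
  obtain ⟨k, hk⟩ := exists_nat_one_div_lt (bdryDist_pos hx)
  exact mem_iUnion.2 ⟨k, hx, hk.le⟩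

section Weight

theorem enorm_sqrt_sq (w : ℝ) : ‖√w‖ₑ ^ 2 = ENNReal.ofReal w := by
  rw [Real.enorm_eq_ofReal (Real.sqrt_nonneg _), ← ENNReal.ofReal_pow (Real.sqrt_nonneg _),
    Real.sq_sqrt', ENNReal.ofReal_max, ENNReal.ofReal_zero, max_eq_left zero_le]

theorem abs_one_sub_sqrt_le {w : ℝ} (hw : 0 ≤ w) : |1 - √w| ≤ |1 - w| := by
  have hfactor : 1 - w = (1 - √w) * (1 + √w) := by
    linear_combination Real.sq_sqrt hw
  have hsqrt := Real.sqrt_nonneg w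
  rw [hfactor, abs_mul]
  refine le_mul_of_one_le_right (abs_nonneg _) ?_
  rw [abs_of_nonneg (by positivity)]
  linarith

variable {α : Type*} [MeasurableSpace α] {μ : Measure α}

theorem enorm_integral_sqrt_mul_sub_le {w g φ : α → ℝ} {m : ℝ≥0∞} {C : ℝ} (hg : Integrable g μ)
    (hwg : Integrable (fun x => √(w x) * g x) μ) (hφ : AEStronglyMeasurable φ μ)
    (hC : ∀ x, ‖φ x‖ ≤ C) (hw : ∀ᵐ x ∂μ, 0 ≤ w x) (hm : ∀ᵐ x ∂μ, ‖1 - w x‖ₑ ≤ m) :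
    ‖∫ x, √(w x) * g x * φ x ∂μ - ∫ x, g x * φ x ∂μ‖ₑ ≤
      m * ENNReal.ofReal C * ∫⁻ x, ‖g x‖ₑ ∂μ := by
  rw [← integral_sub (hwg.mul_bdd hφ (.of_forall hC)) (hg.mul_bdd hφ (.of_forall hC)),
    ← lintegral_const_mul'' _ hg.1.enorm]
  refine (enorm_integral_le_lintegral_enorm _).trans (lintegral_mono_ae ?_)
  filter_upwards [hw, hm] with x hwx hmx
  have hsub : √(w x) * g x * φ x - g x * φ x = (√(w x) - 1) * φ x * g x := by ring
  rw [hsub, enorm_mul, enorm_mul, enorm_sub_rev]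
  gcongr
  · refine (enorm_le_iff_norm_le.2 ?_).trans hmx
    exact abs_one_sub_sqrt_le hwx
  · exact (ofReal_norm (φ x)).symm.trans_le (ENNReal.ofReal_le_ofReal (hC x))

variable {F : Type*} [NormedAddCommGroup F]

theorem setLIntegral_enorm_sq_le_div {s : Set α} (hs : MeasurableSet s) {w : α → ℝ} {G : α → F}
    {c : ℝ} (hc : 0 < c) (hw : ∀ x ∈ s, c ≤ w x) :
    ∫⁻ x in s, ‖G x‖ₑ ^ 2 ∂μ ≤
      (∫⁻ x, ENNReal.ofReal (w x) * ‖G x‖ₑ ^ 2 ∂μ) / ENNReal.ofReal c := by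
  rw [ENNReal.le_div_iff_mul_le (.inl (ENNReal.ofReal_pos.2 hc).ne') (.inl ENNReal.ofReal_ne_top),
    mul_comm, ← lintegral_const_mul' _ _ ENNReal.ofReal_ne_top]
  refine (setLIntegral_mono' hs fun x hx => ?_).trans (setLIntegral_le_lintegral s _)
  gcongr
  exact hw x hx

theorem eLpNorm_two_sqrt_smul_sq [NormedSpace ℝ F] (w : α → ℝ) (G : α → F) :
    eLpNorm (fun x => √(w x) • G x) 2 μ ^ 2 = ∫⁻ x, ENNReal.ofReal (w x) * ‖G x‖ₑ ^ 2 ∂μ := by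
  simp only [eLpNorm_two_sq, enorm_smul, mul_pow, enorm_sqrt_sq]

end Weight

/-! ### Consequences of admissibility -/

section Admissible

variable {p : ℝ} {a : ℝ → ℝ → ℝ} {ε : ℝ}

theorem Admissible.pos (h : Admissible p a) (hε : ε ∈ Ioo (0 : ℝ) (1 / 2)) {d : ℝ}
    (hd : d ∈ Ioc (0 : ℝ) (1 / 2)) : 0 < a ε d := by
  obtain ⟨c, hc, hlow⟩ := h.lower
  have hmid : 0 < a ε (1 / 2) := hc.trans_le (hlow ε hε _ ⟨hε.2.le, le_rfl⟩)
  by_contra! hneg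
  obtain ⟨t, ht, ht0⟩ := intermediate_value_Icc hd.2
    ((h.continuousOn ε hε).mono (Icc_subset_Icc_left hd.1.le)) ⟨hneg, hmid.le⟩
  exact h.ne_zero ε hε t ⟨hd.1.trans_le ht.1, ht.2⟩ ht0

theorem Admissible.aestronglyMeasurable (h : Admissible p a) (hε : ε ∈ Ioo (0 : ℝ) (1 / 2)) :
    AEStronglyMeasurable (fun x : Cyl n => a ε (bdryDist x)) (volOmega n) := by
  rw [volOmega_eq_restrict]
  exact ((h.continuousOn ε hε).comp continuous_bdryDist.continuousOn
    fun _ hx => ⟨(bdryDist_pos hx).le, bdryDist_le _⟩).aestronglyMeasurable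
      (isOpen_Omega n).measurableSet

theorem Admissible.tendsto_iSup_enorm_one_sub (h : Admissible p a) {δ : ℝ} (hδ : 0 < δ) :
    Tendsto (fun ε => ⨆ d ∈ Icc δ (1 / 2), ‖1 - a ε d‖ₑ) (𝓝[>] 0) (𝓝 0) := by
  have hunif := (tendstoLocallyUniformlyOn_iff_tendstoUniformlyOn_of_compact
    (isCompact_Icc (a := δ) (b := 1 / 2))).1
    (h.tendsto_one.mono fun x hx => ⟨hδ.trans_le hx.1, hx.2⟩)
  refine ENNReal.tendsto_nhds_zero.2 fun η hη => ?_
  filter_upwards [EMetric.tendstoUniformlyOn_iff.1 hunif η hη] with ε hε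
  exact iSup₂_le fun d hd => by simpa only [edist_eq_enorm_sub] using (hε d hd).le

theorem Admissible.memLp_innerDomain (h : Admissible p a) (hε : ε ∈ Ioo (0 : ℝ) (1 / 2))
    {G : Cyl n → EuclideanSpace ℝ (Fin (n + 1))} (hG : AEStronglyMeasurable G (volOmega n))
    (hGt : ∫⁻ x, ENNReal.ofReal (a ε (bdryDist x)) * ‖G x‖ₑ ^ 2 ∂(volOmega n) ≠ ⊤) {δ : ℝ}
    (hδ : 0 < δ) : MemLp G 2 ((volOmega n).restrict (innerDomain n δ)) := by
  obtain ⟨c, hc, hlow⟩ := isCompact_Icc.exists_forall_le'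
    ((h.continuousOn ε hε).mono (Icc_subset_Icc_left hδ.le))
    fun d hd => h.pos hε ⟨hδ.trans_le hd.1, hd.2⟩
  have hle := setLIntegral_enorm_sq_le_div (μ := volOmega n) (G := G)
    (measurableSet_innerDomain n δ) hc fun x hx => hlow (bdryDist x) ⟨hx.2, bdryDist_le x⟩
  rw [← eLpNorm_two_sq] at hle
  refine ⟨hG.restrict, lt_top_iff_ne_top.2 fun htop => ?_⟩
  rw [htop, ENNReal.top_pow two_ne_zero, top_le_iff] at hle
  exact ENNReal.div_ne_top hGt (ENNReal.ofReal_pos.2 hc).ne' hle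

theorem setLIntegral_innerDomain_enorm_le {δ c : ℝ} {w : Cyl n → ℝ}
    {G : Cyl n → EuclideanSpace ℝ (Fin (n + 1))} {K : ℝ≥0∞}
    (hG : AEStronglyMeasurable G (volOmega n)) (hc : 0 < c) (hw : ∀ x ∈ innerDomain n δ, c ≤ w x)
    (hK : ∫⁻ x, ENNReal.ofReal (w x) * ‖G x‖ₑ ^ 2 ∂(volOmega n) ≤ K) :
    ∫⁻ x in innerDomain n δ, ‖G x‖ₑ ∂(volOmega n) ≤ (K / ENNReal.ofReal c) ^ (1 / 2 : ℝ) := by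
  refine (ENNReal.pow_le_pow_left_iff two_ne_zero).1 ?_
  rw [rpow_half_sq]
  calc _ ≤ _ := lintegral_sq_le_measure_univ_mul hG.restrict.enorm
    _ ≤ 1 * ∫⁻ x in innerDomain n δ, ‖G x‖ₑ ^ 2 ∂(volOmega n) := by
      gcongr
      exact (Measure.restrict_apply_univ _).trans_le prob_le_one
    _ ≤ _ := by
      rw [one_mul]
      refine (setLIntegral_enorm_sq_le_div (measurableSet_innerDomain n δ) hc hw).trans ?_
      gcongr

theorem Admissible.tendsto_integral_sqrt_mul_sub (h : Admissible p a) {l : Filter Param}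
    (hl : l ≤ toZero) {u : Param → Cyl n → ℝ}
    {G : Param → Cyl n → EuclideanSpace ℝ (Fin (n + 1))}
    (hG : ∀ᶠ ε in l, IsWeakGrad (u ε) (G ε))
    (hF : ∀ᶠ ε : Param in l, MemLp (fun x => √(a ε (bdryDist x)) • G ε x) 2 (volOmega n))
    {K : ℝ≥0∞} (hKt : K ≠ ⊤) (hK : ∀ᶠ ε : Param in l,
      ∫⁻ x, ENNReal.ofReal (a ε (bdryDist x)) * ‖G ε x‖ₑ ^ 2 ∂(volOmega n) ≤ K)
    {φ : Cyl n → ℝ} (hφ : IsTest φ) (i : Fin (n + 1)) :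
    Tendsto (fun ε : Param => ∫ x, √(a ε (bdryDist x)) * G ε x i * φ x ∂(volOmega n) -
      ∫ x, G ε x i * φ x ∂(volOmega n)) l (𝓝 0) := by
  have hzero : Tendsto (Subtype.val : Param → ℝ) l (𝓝[>] 0) := tendsto_comap.mono_left hl
  obtain ⟨c, hc, hlow⟩ := h.lower
  obtain ⟨δ, hδ, hsupp⟩ := hφ.exists_support_subset
  obtain ⟨C, hC⟩ := hφ.2.1.exists_bound_of_continuous hφ.continuous
  have hlim := ENNReal.Tendsto.mul_const (b := ENNReal.ofReal C *
    (K / ENNReal.ofReal c) ^ (1 / 2 : ℝ)) ((h.tendsto_iSup_enorm_one_sub hδ).comp hzero)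
    (.inr (by finiteness))
  rw [zero_mul] at hlim
  refine tendsto_zero_iff_enorm_tendsto_zero.2 (tendsto_of_tendsto_of_tendsto_of_le_of_le'
    tendsto_const_nhds hlim (.of_forall fun _ => zero_le) ?_)
  filter_upwards [hG, hF, hK, hzero.eventually (Ioo_mem_nhdsGT hδ)] with ε hGε hFε hKε hεδ
  have hmem : ∀ᵐ x ∂(volOmega n).restrict (innerDomain n δ), x ∈ innerDomain n δ :=
    ae_restrict_mem (measurableSet_innerDomain n δ)
  have hrestrict (f : Cyl n → ℝ) :
      ∫ x, f x * φ x ∂(volOmega n) = ∫ x in innerDomain n δ, f x * φ x ∂(volOmega n) :=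
    (setIntegral_eq_integral_of_forall_compl_eq_zero fun x hx => by
      rw [Function.notMem_support.1 fun hs => hx (hsupp hs), mul_zero]).symm
  have hlow' : ∀ x ∈ innerDomain n δ, c ≤ a ε (bdryDist x) := fun x hx =>
    hlow ε ε.2 _ ⟨hεδ.2.le.trans hx.2, bdryDist_le x⟩
  have hsup : ∀ x ∈ innerDomain n δ,
      ‖1 - a ε (bdryDist x)‖ₑ ≤ ⨆ d ∈ Icc δ (1 / 2), ‖1 - a ε d‖ₑ := fun x hx =>
    le_iSup₂ (f := fun d (_ : d ∈ Icc δ (1 / 2)) => ‖1 - a ε d‖ₑ) _ ⟨hx.2, bdryDist_le x⟩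
  rw [hrestrict fun x => √(a ε (bdryDist x)) * G ε x i, hrestrict fun x => G ε x i]
  refine (enorm_integral_sqrt_mul_sub_le ((hGε.1 δ hδ).eval_piLp i)
    (((memLp_coord hFε i).integrable one_le_two).restrict) hφ.continuous.aestronglyMeasurable hC
    (hmem.mono fun x hx => hc.le.trans (hlow' x hx))
    (hmem.mono hsup)).trans ?_
  rw [mul_assoc]
  exact mul_le_mul' le_rfl (mul_le_mul' le_rfl <|
    (lintegral_mono fun x => enorm_le_iff_norm_le.2 (PiLp.norm_apply_le _ _)).trans
      (setLIntegral_innerDomain_enorm_le hGε.aestronglyMeasurable hc hlow' hKε))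

theorem Admissible.exists_weakGrad_limit (h : Admissible p a) (U : Ultrafilter Param)
    (hU : (U : Filter Param) ≤ toZero) {u : Param → Cyl n → ℝ} {u₀ : Cyl n → ℝ}
    (hu : ∀ ε, MemLp (u ε) 2 (volOmega n)) (hu₀ : MemLp u₀ 2 (volOmega n))
    (hlim : Tendsto (fun ε => eLpNorm (fun x => u ε x - u₀ x) 2 (volOmega n)) U (𝓝 0))
    {G : Param → Cyl n → EuclideanSpace ℝ (Fin (n + 1))}
    (hG : ∀ᶠ ε in U, IsWeakGrad (u ε) (G ε)) {K : ℝ≥0∞} (hKt : K ≠ ⊤)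
    (hK : ∀ᶠ ε : Param in U,
      ∫⁻ x, ENNReal.ofReal (a ε (bdryDist x)) * ‖G ε x‖ₑ ^ 2 ∂(volOmega n) ≤ K) :
    ∃ H : Cyl n → EuclideanSpace ℝ (Fin (n + 1)), MemLp H 2 (volOmega n) ∧ IsWeakGrad u₀ H ∧
      ∫⁻ x, ‖H x‖ₑ ^ 2 ∂(volOmega n) ≤ K := by
  have hFK : ∀ᶠ ε : Param in U,
      eLpNorm (fun x => √(a ε (bdryDist x)) • G ε x) 2 (volOmega n) ≤ K ^ (1 / 2 : ℝ) :=
    hK.mono fun ε hε => (ENNReal.pow_le_pow_left_iff two_ne_zero).1 <| by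
      rwa [rpow_half_sq, eLpNorm_two_sqrt_smul_sq]
  have hKr : K ^ (1 / 2 : ℝ) ≠ ⊤ := by finiteness
  have hF : ∀ᶠ ε : Param in U, MemLp (fun x => √(a ε (bdryDist x)) • G ε x) 2 (volOmega n) := by
    filter_upwards [hG, hFK] with ε hGε hε
    exact ⟨(Real.continuous_sqrt.comp_aestronglyMeasurable
      (h.aestronglyMeasurable ε.2)).smul hGε.aestronglyMeasurable, hε.trans_lt hKr.lt_top⟩
  obtain ⟨H, hH, hHK, hFH⟩ := exists_tendsto_integral_inner U hF hKr hFK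
  refine ⟨H, hH, ⟨fun δ _ => (hH.restrict _).integrable one_le_two, fun i φ hφ => ?_⟩, ?_⟩
  · have hleft := tendsto_integral_mul hu hu₀ hlim
      (memLp_of_continuous (continuous_pderiv hφ.contDiff_one i))
    have hφ2 : MemLp (fun x => EuclideanSpace.single i (φ x)) 2 (volOmega n) :=
      memLp_of_continuous ((PiLp.continuous_toLp 2 _).comp
        ((continuous_single i).comp hφ.continuous))
    have hright := (hFH _ hφ2).sub (h.tendsto_integral_sqrt_mul_sub hU hG hF hKt hK hφ i)
    simp only [EuclideanSpace.inner_single_right, conj_trivial, PiLp.smul_apply, smul_eq_mul,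
      mul_comm (φ _), sub_sub_cancel, sub_zero] at hright
    refine tendsto_nhds_unique hleft (hright.neg.congr' ?_)
    filter_upwards [hG] with ε hε
    exact (hε.2 i φ hφ).symm
  · rw [← eLpNorm_two_sq, ← rpow_half_sq K]
    gcongr

end Admissible

section Surface

variable {n : ℕ}

theorem surf_eq_map (n : ℕ) : surf n =
    (volume : Measure (UnitAddTorus (Fin n))).map (fun y => (y, (0 : ℝ))) +
    (volume : Measure (UnitAddTorus (Fin n))).map (fun y => (y, (1 : ℝ))) := by
  rw [surf, Measure.prod_add, Measure.prod_dirac, Measure.prod_dirac]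

theorem eLpNorm_surf_sq {F : Type*} [NormedAddCommGroup F] (f : Cyl n → F) :
    eLpNorm f 2 (surf n) ^ 2 =
      eLpNorm (fun y => f (y, 0)) 2 volume ^ 2 + eLpNorm (fun y => f (y, 1)) 2 volume ^ 2 := by
  simp only [eLpNorm_two_sq]
  rw [surf_eq_map, lintegral_add_measure, (measurableEmbedding_prod_mk_right 0).lintegral_map,
    (measurableEmbedding_prod_mk_right 1).lintegral_map]

theorem tendsto_eLpNorm_surf_iff {ι F : Type*} [NormedAddCommGroup F] {l : Filter ι}
    {f : ι → Cyl n → F} :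
    Tendsto (fun i => eLpNorm (f i) 2 (surf n)) l (𝓝 0) ↔
      Tendsto (fun i => eLpNorm (fun y => f i (y, 0)) 2 volume) l (𝓝 0) ∧
      Tendsto (fun i => eLpNorm (fun y => f i (y, 1)) 2 volume) l (𝓝 0) := by
  refine ⟨fun h => ?_, fun ⟨h₀, h₁⟩ => tendsto_zero_of_sq ?_⟩
  · have hle : ∀ (i) {A : ℝ≥0∞}, A ^ 2 ≤ eLpNorm (f i) 2 (surf n) ^ 2 →
        A ≤ eLpNorm (f i) 2 (surf n) := fun _ _ => (ENNReal.pow_le_pow_left_iff two_ne_zero).1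
    simp only [eLpNorm_surf_sq] at hle
    exact ⟨tendsto_of_tendsto_of_tendsto_of_le_of_le tendsto_const_nhds h (fun _ => zero_le)
        fun i => hle i le_self_add,
      tendsto_of_tendsto_of_tendsto_of_le_of_le tendsto_const_nhds h (fun _ => zero_le)
        fun i => hle i le_add_self⟩
  · simp only [eLpNorm_surf_sq]
    simpa using (ENNReal.Tendsto.pow (n := 2) h₀).add (ENNReal.Tendsto.pow (n := 2) h₁)

theorem aestronglyMeasurable_surf_iff {F : Type*} [TopologicalSpace F]
    [TopologicalSpace.PseudoMetrizableSpace F] {v : Cyl n → F} :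
    AEStronglyMeasurable v (surf n) ↔
      AEStronglyMeasurable (fun y => v (y, 0)) volume ∧
      AEStronglyMeasurable (fun y => v (y, 1)) volume := by
  rw [surf_eq_map, aestronglyMeasurable_add_measure_iff,
    (measurableEmbedding_prod_mk_right 0).aestronglyMeasurable_map_iff,
    (measurableEmbedding_prod_mk_right 1).aestronglyMeasurable_map_iff]
  rfl

theorem bdryAvg_zero (ε : ℝ) (u : Cyl n → ℝ) (y : UnitAddTorus (Fin n)) :
    bdryAvg ε u (y, 0) = layerAvg 0 ε u y := by
  simp [bdryAvg, layerAvg, interval_average_eq]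

theorem bdryAvg_one (ε : ℝ) (u : Cyl n → ℝ) (y : UnitAddTorus (Fin n)) :
    bdryAvg ε u (y, 1) = layerAvg 0 ε (u ∘ reflect) y := by
  simp [bdryAvg, layerAvg, interval_average_eq, reflect,
    intervalIntegral.integral_comp_sub_left fun s => u (y, s)]

theorem measurableEmbedding_reflect (n : ℕ) : MeasurableEmbedding (reflect (n := n)) :=
  (MeasurableEquiv.ofInvolutive reflect (fun x => by simp [reflect])
    (measurePreserving_reflect n).measurable).measurableEmbedding

theorem lintegral_reflect (f : Cyl n → ℝ≥0∞) :
    ∫⁻ x, f (reflect x) ∂(volOmega n) = ∫⁻ x, f x ∂(volOmega n) :=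
  (measurePreserving_reflect n).lintegral_comp_emb (measurableEmbedding_reflect n) f

theorem eLpNorm_comp_reflect {F : Type*} [NormedAddCommGroup F] (f : Cyl n → F) (p : ℝ≥0∞) :
    eLpNorm (f ∘ reflect) p (volOmega n) = eLpNorm f p (volOmega n) := by
  rw [← (measurableEmbedding_reflect n).eLpNorm_map_measure, (measurePreserving_reflect n).map_eq]

theorem memLp_comp_reflect {F : Type*} [NormedAddCommGroup F] {f : Cyl n → F} {p : ℝ≥0∞}
    (hf : MemLp f p (volOmega n)) : MemLp (f ∘ reflect) p (volOmega n) :=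
  hf.comp_measurePreserving (measurePreserving_reflect n)

theorem eLpNorm_pderiv_last_comp_reflect {ψ : Cyl n → ℝ} (hψ : ContDiff ℝ 1 (ψ ∘ cover n))
    (p : ℝ≥0∞) : eLpNorm (pderiv (Fin.last n) (ψ ∘ reflect)) p (volOmega n) =
      eLpNorm (pderiv (Fin.last n) ψ) p (volOmega n) := by
  rw [show pderiv (Fin.last n) (ψ ∘ reflect) = -(pderiv (Fin.last n) ψ ∘ reflect) from
    funext (pderiv_last_reflect hψ), eLpNorm_neg, eLpNorm_comp_reflect]

end Surface

/-! ### The boundary values of a limit of bounded energy -/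

section Trace

variable {n : ℕ} {p ε δ : ℝ} {a : ℝ → ℝ → ℝ} {K : ℝ≥0∞}

theorem Admissible.lintegral_inv_eq_resistance (h : Admissible p a)
    (hε : ε ∈ Ioo (0 : ℝ) (1 / 2)) {s : ℝ} (hs : s ∈ Ioo 0 ε) :
    ∫⁻ σ in Ioo s ε, ENNReal.ofReal (1 / a ε σ) =
      resistance (fun σ => ENNReal.ofReal (a ε σ)) ε s := by
  rw [resistance, uIoo_of_le hs.2.le]
  refine setLIntegral_congr_fun measurableSet_Ioo fun σ hσ => ?_
  rw [one_div, ENNReal.ofReal_inv_of_pos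
    (h.pos hε ⟨hs.1.trans hσ.1, hσ.2.le.trans hε.2.le⟩)]

theorem Admissible.tendsto_lintegral_resistance (h : Admissible p a) (hp : 1 / 2 ≤ p) :
    Tendsto (fun ε : ℝ => (ENNReal.ofReal ε)⁻¹ * ∫⁻ s in Ioo 0 ε,
      resistance (fun σ => ENNReal.ofReal (a ε σ)) ε s ^ (1 / 2 : ℝ)) (𝓝[>] 0) (𝓝 0) := by
  have hpow := h.nondegenerate.ennrpow_const (1 / (2 * p))
  rw [ENNReal.zero_rpow_of_pos (one_div_pos.2 (by linarith))] at hpow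
  refine tendsto_of_tendsto_of_tendsto_of_le_of_le' tendsto_const_nhds hpow
    (.of_forall fun _ => zero_le) ?_
  filter_upwards [Ioo_mem_nhdsGT (one_half_pos (α := ℝ))] with ε hε
  have hanti : Antitone fun s => ∫⁻ σ in Ioo s ε, ENNReal.ofReal (1 / a ε σ) :=
    fun s t hst => lintegral_mono_set (Ioo_subset_Ioo_left hst)
  -- By Jensen's inequality, nondegeneracy is the stronger the larger `p` is.
  let μ : Measure ℝ := (ENNReal.ofReal ε)⁻¹ • volume.restrict (Ioo 0 ε)
  have hμ : IsProbabilityMeasure μ := ⟨by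
    simpa [μ] using ENNReal.inv_mul_cancel (by simpa using hε.1) ENNReal.ofReal_ne_top⟩
  have hjensen := eLpNorm'_le_eLpNorm'_of_exponent_le one_half_pos hp μ
    hanti.measurable.aestronglyMeasurable
  simp only [eLpNorm', enorm_eq_self, μ, lintegral_smul_measure, smul_eq_mul] at hjensen
  have hsqrt := ENNReal.rpow_le_rpow hjensen (one_half_pos (α := ℝ)).le
  rw [← ENNReal.rpow_mul, ← ENNReal.rpow_mul, show (1 / (1 / 2) * (1 / 2) : ℝ) = 1 by norm_num,
    ENNReal.rpow_one, show 1 / p * (1 / 2) = 1 / (2 * p) by ring] at hsqrt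
  refine (mul_le_mul' le_rfl (setLIntegral_congr_fun measurableSet_Ioo fun s hs => ?_).le).trans
    hsqrt
  rw [h.lintegral_inv_eq_resistance hε hs]

theorem eLpNorm_weightedSlab_le {F : Type*} [NormedAddCommGroup F] {w : ℝ → ℝ} {g : Cyl n → F}
    (hε : ε ≤ 1 / 2) (hw : AEMeasurable w (volume.restrict (Ioo 0 ε)))
    (hg : AEStronglyMeasurable g (volOmega n))
    (hK : ∫⁻ x, ENNReal.ofReal (w (bdryDist x)) * ‖g x‖ₑ ^ 2 ∂(volOmega n) ≤ K) :
    eLpNorm g 2 (weightedSlab n 0 ε fun s => ENNReal.ofReal (w s)) ≤ K ^ (1 / 2 : ℝ) := by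
  have hslab : slab n 0 ε ≤ volOmega n := slab_le_volOmega le_rfl (by linarith)
  have hwx : AEMeasurable (fun x : Cyl n => ENNReal.ofReal (w x.2)) (slab n 0 ε) :=
    hw.ennreal_ofReal.comp_snd
  refine eLpNorm_two_le_of_lintegral_le ?_
  rw [rpow_half_sq, weightedSlab, lintegral_withDensity_eq_lintegral_mul₀ hwx
    ((hg.mono_measure hslab).enorm.pow_const 2)]
  refine (lintegral_mono_ae ?_).trans ((lintegral_mono' hslab le_rfl).trans hK)
  filter_upwards [Measure.quasiMeasurePreserving_snd.ae (ae_restrict_mem measurableSet_Ioo)]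
    with x hx
  have hdist : bdryDist x = x.2 := min_eq_left (by linarith [hx.2])
  rw [Pi.mul_apply, hdist]

/-- `u` has a normal derivative `g` in `Ω` with `∫_Ω w(d(x)) |g|² dx ≤ K`. The normal part of the
energy suffices for the boundary values, and, unlike the gradient, it is reflected componentwise. -/
def NormalEnergyLE (w : ℝ → ℝ) (u : Cyl n → ℝ) (K : ℝ≥0∞) : Prop :=
  ∃ g, AEStronglyMeasurable g (volOmega n) ∧ NormalApprox u g ∧
    ∫⁻ x, ENNReal.ofReal (w (bdryDist x)) * ‖g x‖ₑ ^ 2 ∂(volOmega n) ≤ K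

theorem NormalEnergyLE.comp_reflect {w : ℝ → ℝ} {u : Cyl n → ℝ} (h : NormalEnergyLE w u K)
    (hu : AEStronglyMeasurable u (volOmega n)) : NormalEnergyLE w (u ∘ reflect) K := by
  obtain ⟨g, hg, hug, hK⟩ := h
  refine ⟨_, (hg.comp_measurePreserving (measurePreserving_reflect n)).neg,
    hug.reflect hu fun _ _ => hg.restrict, ?_⟩
  rw [← lintegral_reflect] at hK
  simpa only [bdryDist_reflect, Function.comp_apply, Pi.neg_apply, enorm_neg] using hK

theorem Admissible.normalEnergyLE (h : Admissible p a) (hε : ε ∈ Ioo (0 : ℝ) (1 / 2))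
    {u : Cyl n → ℝ} {G : Cyl n → EuclideanSpace ℝ (Fin (n + 1))} (hu : MemLp u 2 (volOmega n))
    (hG : IsWeakGrad u G) (hKt : K ≠ ⊤)
    (hK : ∫⁻ x, ENNReal.ofReal (a ε (bdryDist x)) * ‖G x‖ₑ ^ 2 ∂(volOmega n) ≤ K) :
    NormalEnergyLE (a ε) u K := by
  have hGm := hG.aestronglyMeasurable
  refine ⟨_, (EuclideanSpace.proj (Fin.last n) :
      EuclideanSpace ℝ (Fin (n + 1)) →L[ℝ] ℝ).continuous.comp_aestronglyMeasurable hGm,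
    hG.normalApprox hu fun δ hδ => h.memLp_innerDomain hε hGm (ne_top_of_le_ne_top hKt hK) hδ,
    (lintegral_mono fun x => ?_).trans hK⟩
  gcongr
  exact enorm_le_iff_norm_le.2 (PiLp.norm_apply_le (G x) _)

theorem Admissible.eLpNorm_layerAvg_zero_sub_layerAvg_le (h : Admissible p a)
    (hε : ε ∈ Ioo (0 : ℝ) (1 / 2)) {u : Cyl n → ℝ} (hu : MemLp u 2 (volOmega n))
    (huK : NormalEnergyLE (a ε) u K) {c : ℝ} (hc : 0 < c) (hac : ∀ d ∈ Icc ε (1 / 2), c ≤ a ε d)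
    (hεδ : ε < δ) (hδ : δ ≤ 1 / 2)
    (hI : ∫⁻ s in Ioo 0 ε, resistance (fun σ => ENNReal.ofReal (a ε σ)) ε s ^ (1 / 2 : ℝ) ≠ ⊤) :
    eLpNorm (fun y => layerAvg 0 ε u y - layerAvg ε δ u y) 2 volume ≤
      (ENNReal.ofReal ε)⁻¹ * (∫⁻ s in Ioo 0 ε,
        resistance (fun σ => ENNReal.ofReal (a ε σ)) ε s ^ (1 / 2 : ℝ)) * K ^ (1 / 2 : ℝ) +
      ENNReal.ofReal (δ - ε) ^ (1 / 2 : ℝ) * (K / ENNReal.ofReal c) ^ (1 / 2 : ℝ) := by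
  obtain ⟨g, hg, hug, hK⟩ := huK
  obtain ⟨C, hC⟩ := h.upper
  have hsub : Ioo 0 ε ⊆ Icc 0 (1 / 2) := fun s hs => ⟨hs.1.le, hs.2.le.trans hε.2.le⟩
  have ha : AEMeasurable (a ε) (volume.restrict (Ioo 0 ε)) :=
    ((h.continuousOn ε hε).mono hsub).aemeasurable measurableSet_Ioo
  have hinner : eLpNorm g 2 (slab n ε δ) ≤ (K / ENNReal.ofReal c) ^ (1 / 2 : ℝ) := by
    refine eLpNorm_two_le_of_lintegral_le ?_
    rw [rpow_half_sq]
    calc _ ≤ ∫⁻ x in innerDomain n ε, ‖g x‖ₑ ^ 2 ∂(volOmega n) :=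
          lintegral_mono' (slab_le_restrict_innerDomain hε.1.le le_rfl hδ) le_rfl
      _ ≤ _ := setLIntegral_enorm_sq_le_div (measurableSet_innerDomain n ε) hc
          fun x hx => hac (bdryDist x) ⟨hx.2, bdryDist_le x⟩
      _ ≤ _ := by gcongr
  refine (hug.eLpNorm_layerAvg_zero_sub_layerAvg_le hu hε.1 hεδ hδ (fun _ _ => hg.restrict)
    ha.ennreal_ofReal (fun σ hσ => ?_) (ENNReal.ofReal_ne_top (r := C))
    (fun σ hσ => ENNReal.ofReal_le_ofReal (hC ε hε σ (hsub hσ))) hI).trans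
    (add_le_add (mul_le_mul' le_rfl (eLpNorm_weightedSlab_le hε.2.le ha hg hK))
      (mul_le_mul' le_rfl hinner))
  simpa using h.pos hε ⟨hσ.1, hσ.2.le.trans hε.2.le⟩

variable {l : Filter Param} [l.NeBot] {u : Param → Cyl n → ℝ} {u₀ : Cyl n → ℝ}

theorem Admissible.exists_eLpNorm_layerAvg_sub_le (h : Admissible p a) (hp : 1 / 2 ≤ p)
    (hl : l ≤ toZero) (hu : ∀ ε, MemLp (u ε) 2 (volOmega n)) (hu₀ : MemLp u₀ 2 (volOmega n))
    (hlim : Tendsto (fun ε => eLpNorm (fun x => u ε x - u₀ x) 2 (volOmega n)) l (𝓝 0))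
    {v : UnitAddTorus (Fin n) → ℝ} (hv : AEStronglyMeasurable v volume)
    (hlv : Tendsto (fun ε : Param => eLpNorm (fun y => layerAvg 0 ε (u ε) y - v y) 2 volume)
      l (𝓝 0))
    (hKt : K ≠ ⊤) (huK : ∀ᶠ ε : Param in l, NormalEnergyLE (a ε) (u ε) K) :
    ∃ M ≠ ⊤, ∀ δ : ℝ, 0 < δ → δ ≤ 1 / 2 →
      eLpNorm (fun y => layerAvg 0 δ u₀ y - v y) 2 volume ≤
        ENNReal.ofReal δ ^ (1 / 2 : ℝ) * M := by
  obtain ⟨c, hc, hac⟩ := h.lower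
  have hzero : Tendsto (Subtype.val : Param → ℝ) l (𝓝[>] 0) := tendsto_comap.mono_left hl
  have hB := (h.tendsto_lintegral_resistance hp).comp hzero
  have hdiv : K / ENNReal.ofReal c ≠ ⊤ := ENNReal.div_ne_top hKt (ENNReal.ofReal_pos.2 hc).ne'
  have hM : K ^ (1 / 2 : ℝ) + (K / ENNReal.ofReal c) ^ (1 / 2 : ℝ) ≠ ⊤ := by finiteness
  refine ⟨_, hM, fun δ hδ0 hδ => eLpNorm_layerAvg_sub_le_of_tendsto hzero hv hu hu₀ hlim hlv hB hM
    hδ0 (by linarith) ?_⟩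
  filter_upwards [huK, hB.eventually_lt_const ENNReal.zero_lt_top,
    hzero.eventually (Ioo_mem_nhdsGT hδ0)] with ε hε hfin hεδ
  have hI := (ENNReal.lt_top_of_mul_ne_top_right hfin.ne
    (ENNReal.inv_ne_zero.2 ENNReal.ofReal_ne_top)).ne
  exact (h.eLpNorm_layerAvg_zero_sub_layerAvg_le ε.2 (hu ε) hε hc (hac ε ε.2) hεδ.2 hδ hI).trans
    (add_le_add (mul_le_mul' le_rfl le_self_add) (mul_le_mul' le_rfl le_add_self))

theorem Admissible.tendsto_slice_zero (h : Admissible p a) (hp : 1 / 2 ≤ p)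
    (hl : l ≤ toZero) (hu : ∀ ε, MemLp (u ε) 2 (volOmega n)) (hu₀ : MemLp u₀ 2 (volOmega n))
    (hlim : Tendsto (fun ε => eLpNorm (fun x => u ε x - u₀ x) 2 (volOmega n)) l (𝓝 0))
    {v : UnitAddTorus (Fin n) → ℝ} (hv : AEStronglyMeasurable v volume)
    (hlv : Tendsto (fun ε : Param => eLpNorm (fun y => layerAvg 0 ε (u ε) y - v y) 2 volume)
      l (𝓝 0))
    (hKt : K ≠ ⊤) (huK : ∀ᶠ ε : Param in l, NormalEnergyLE (a ε) (u ε) K)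
    {ψ : ℕ → Cyl n → ℝ} (hψ : ∀ k, ContDiff ℝ 1 (ψ k ∘ cover n))
    (hψu : Tendsto (fun k => eLpNorm (fun x => ψ k x - u₀ x) 2 (volOmega n)) atTop (𝓝 0))
    {L : ℝ≥0∞} (hL : L ≠ ⊤)
    (hψL : ∀ᶠ k in atTop, eLpNorm (pderiv (Fin.last n) (ψ k)) 2 (volOmega n) ≤ L) :
    Tendsto (fun k => eLpNorm (fun y => ψ k (y, 0) - v y) 2 volume) atTop (𝓝 0) := by
  obtain ⟨M, hM, hle⟩ := h.exists_eLpNorm_layerAvg_sub_le hp hl hu hu₀ hlim hv hlv hKt huK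
  exact ThinLayer.tendsto_slice_zero hψ hu₀ hψu (ENNReal.add_ne_top.2 ⟨hM, hL⟩)
    (hψL.mono fun k hk => hk.trans le_add_self) hv
    fun δ hδ0 hδ => (hle δ hδ0 hδ).trans (mul_le_mul' le_rfl le_self_add)

theorem exists_eLpNorm_pderiv_le {ψ : ℕ → Cyl n → ℝ}
    {G : Cyl n → EuclideanSpace ℝ (Fin (n + 1))} (hψ : ∀ k, ContDiff ℝ 1 (ψ k ∘ cover n))
    (hG : MemLp G 2 (volOmega n))
    (hψG : Tendsto (fun k => eLpNorm (fun x => grad (ψ k) x - G x) 2 (volOmega n)) atTop (𝓝 0))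
    (i : Fin (n + 1)) :
    ∃ M ≠ ⊤, ∀ᶠ k in atTop, eLpNorm (pderiv i (ψ k)) 2 (volOmega n) ≤ M := by
  have hlim := tendsto_eLpNorm_of_tendsto_sub
    (.of_forall fun k => (continuous_grad (hψ k)).aestronglyMeasurable) hG.1 hψG
  obtain ⟨M, hGM, hM⟩ := exists_between hG.2
  refine ⟨M, hM.ne, ?_⟩
  filter_upwards [hlim.eventually_lt_const hGM] with k hk
  exact (eLpNorm_mono fun x => PiLp.norm_apply_le (grad (ψ k) x) i).trans hk.le

theorem Admissible.isTrace_of_tendsto (h : Admissible p a) (hp : 1 / 2 ≤ p) (hl : l ≤ toZero)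
    (hu : ∀ ε, MemLp (u ε) 2 (volOmega n)) (hu₀ : MemLp u₀ 2 (volOmega n))
    (hlim : Tendsto (fun ε => eLpNorm (fun x => u ε x - u₀ x) 2 (volOmega n)) l (𝓝 0))
    {v : Cyl n → ℝ} (hv : AEStronglyMeasurable v (surf n))
    (hlv : Tendsto (fun ε : Param => eLpNorm (fun x => bdryAvg ε (u ε) x - v x) 2 (surf n))
      l (𝓝 0))
    (hKt : K ≠ ⊤) (huK : ∀ᶠ ε : Param in l, NormalEnergyLE (a ε) (u ε) K)
    {H : Cyl n → EuclideanSpace ℝ (Fin (n + 1))} (hH : MemLp H 2 (volOmega n))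
    (hHw : IsWeakGrad u₀ H) : IsTrace u₀ v := by
  obtain ⟨hv₀, hv₁⟩ := aestronglyMeasurable_surf_iff.1 hv
  obtain ⟨hlv₀, hlv₁⟩ := tendsto_eLpNorm_surf_iff.1 hlv
  simp only [bdryAvg_zero] at hlv₀
  simp only [bdryAvg_one] at hlv₁
  obtain ⟨ψ, hψ, hψu, hψH⟩ := exists_contDiff_approx hu₀ hHw hH
  obtain ⟨L, hL, hψL⟩ := exists_eLpNorm_pderiv_le hψ hH hψH (Fin.last n)
  refine ⟨H, ψ, hHw, hψ, hψu, hψH, tendsto_eLpNorm_surf_iff.2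
    ⟨h.tendsto_slice_zero hp hl hu hu₀ hlim hv₀ hlv₀ hKt huK hψ hψu hL hψL, ?_⟩⟩
  have hreflect := h.tendsto_slice_zero hp hl (fun ε => memLp_comp_reflect (hu ε))
    (memLp_comp_reflect hu₀)
    (hlim.congr fun ε => (eLpNorm_comp_reflect (fun x => u ε x - u₀ x) 2).symm) hv₁ hlv₁ hKt
    (huK.mono fun ε hε => hε.comp_reflect (hu ε).1) (fun k => contDiff_reflect (hψ k))
    (hψu.congr fun k => (eLpNorm_comp_reflect (fun x => ψ k x - u₀ x) 2).symm) hL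
    (hψL.mono fun k hk => (eLpNorm_pderiv_last_comp_reflect (hψ k) 2).trans_le hk)
  simpa only [Function.comp_apply, reflect, sub_zero] using hreflect

end Trace

/-! ### The lower limit -/

section LowerLimit

variable {n : ℕ} {p : ℝ} {a : ℝ → ℝ → ℝ}

theorem exists_isWeakGrad_of_energy_lt {ε : ℝ} {u : Cyl n → ℝ} {L : ℝ≥0∞}
    (h : energy a ε u < L) : ∃ G, IsWeakGrad u G ∧
      ∫⁻ x, ENNReal.ofReal (a ε (bdryDist x)) * ‖G x‖ₑ ^ 2 ∂(volOmega n) ≤ 2 * L := by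
  unfold energy at h
  split_ifs at h
  · obtain ⟨G, hG, hlt⟩ : ∃ G, IsWeakGrad u G ∧ _ := by
      simpa only [dirichlet, iInf_lt_iff, exists_prop] using h
    exact ⟨G, hG, (ENNReal.inv_mul_le_iff two_ne_zero ENNReal.ofNat_ne_top).1 hlt.le⟩
  · exact absurd h not_top_lt

theorem energy₀_le_of_isWeakGrad {u v : Cyl n → ℝ} {L : ℝ≥0∞} (hu : MemLp u 2 (volOmega n))
    (hv : IsTrace u v) {H : Cyl n → EuclideanSpace ℝ (Fin (n + 1))} (hH : MemLp H 2 (volOmega n))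
    (hHw : IsWeakGrad u H) (hHL : ∫⁻ x, ‖H x‖ₑ ^ 2 ∂(volOmega n) ≤ 2 * L) :
    energy₀ u v ≤ L := by
  rw [energy₀, if_pos ⟨⟨hu, H, hHw, hH⟩, hv⟩]
  refine (iInf₂_le H hHw).trans ?_
  rw [ENNReal.inv_mul_le_iff two_ne_zero ENNReal.ofNat_ne_top]
  simpa using hHL

theorem Admissible.energy₀_le_liminf (h : Admissible p a) (hp : 1 / 2 ≤ p)
    {u : Param → Cyl n → ℝ} {u₀ v : Cyl n → ℝ} (hu : ∀ ε, MemLp (u ε) 2 (volOmega n))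
    (hu₀ : MemLp u₀ 2 (volOmega n)) (hv : AEStronglyMeasurable v (surf n))
    (hlim : Tendsto (fun ε => eLpNorm (fun x => u ε x - u₀ x) 2 (volOmega n)) toZero (𝓝 0))
    (hlv : Tendsto (fun ε : Param => eLpNorm (fun x => bdryAvg ε (u ε) x - v x) 2 (surf n))
      toZero (𝓝 0)) :
    energy₀ u₀ v ≤ liminf (fun ε : Param => energy a ε (u ε)) toZero := by
  refine le_of_forall_gt_imp_ge_of_dense fun L hL => ?_
  rcases eq_or_ne L ⊤ with rfl | hLt
  · exact le_top
  have hfreq : ∃ᶠ ε : Param in toZero, energy a ε (u ε) < L :=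
    frequently_lt_of_liminf_lt (by isBoundedDefault) hL
  have : (toZero ⊓ 𝓟 {ε : Param | energy a ε (u ε) < L}).NeBot := frequently_mem_iff_neBot.1 hfreq
  obtain ⟨U, hU⟩ := Ultrafilter.exists_le (toZero ⊓ 𝓟 {ε : Param | energy a ε (u ε) < L})
  have hU0 : (U : Filter Param) ≤ toZero := hU.trans inf_le_left
  have hUL : ∀ᶠ ε : Param in U, energy a ε (u ε) < L :=
    (hU.trans inf_le_right) (mem_principal_self _)
  have hKt : 2 * L ≠ ⊤ := by finiteness
  obtain ⟨G, hG⟩ := (hUL.mono fun ε hε => exists_isWeakGrad_of_energy_lt hε).choice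
  have hlimU := hlim.mono_left hU0
  obtain ⟨H, hH, hHw, hHL⟩ := h.exists_weakGrad_limit U hU0 hu hu₀ hlimU (hG.mono fun _ => And.left)
    hKt (hG.mono fun _ => And.right)
  exact energy₀_le_of_isWeakGrad hu₀ (h.isTrace_of_tendsto hp hU0 hu hu₀ hlimU hv
    (hlv.mono_left hU0) hKt (hG.mono fun ε hε => h.normalEnergyLE ε.2 (hu ε) hε.1 hKt hε.2)
    hH hHw) hH hHw hHL

end LowerLimit

/-! ### Recovery sequences of finite energy -/

instance : IsCountablyGenerated toZero := inferInstanceAs (IsCountablyGenerated (comap _ _))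

theorem tendsto_val : Tendsto (Subtype.val : Param → ℝ) toZero (𝓝[>] 0) := tendsto_comap

instance : NeBot toZero := comap_neBot fun _ hs =>
  have ⟨ε, hεs, hε⟩ :=
    Filter.nonempty_of_mem (inter_mem hs (Ioo_mem_nhdsGT (one_half_pos (α := ℝ))))
  ⟨⟨ε, hε⟩, hεs⟩

section Recovery

variable {n : ℕ} {p : ℝ} {a : ℝ → ℝ → ℝ}

theorem Admissible.tendsto_lintegral {F : Type*} [NormedAddCommGroup F] (h : Admissible p a)
    {G : Cyl n → F} (hG : MemLp G 2 (volOmega n)) :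
    Tendsto (fun ε : Param => ∫⁻ x, ENNReal.ofReal (a ε (bdryDist x)) * ‖G x‖ₑ ^ 2 ∂(volOmega n))
      toZero (𝓝 (∫⁻ x, ‖G x‖ₑ ^ 2 ∂(volOmega n))) := by
  obtain ⟨C, hC⟩ := h.upper
  refine tendsto_lintegral_filter_of_dominated_convergence' (fun x => ENNReal.ofReal C * ‖G x‖ₑ ^ 2)
    (.of_forall fun ε => (h.aestronglyMeasurable ε.2).aemeasurable.ennreal_ofReal.mul
      (hG.1.enorm.pow_const 2)) (.of_forall fun ε => ?_) ?_ ?_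
  · filter_upwards [ae_mem_Omega n] with x hx
    gcongr
    exact hC ε ε.2 _ ⟨(bdryDist_pos hx).le, bdryDist_le x⟩
  · rw [lintegral_const_mul' _ _ ENNReal.ofReal_ne_top, ← eLpNorm_two_sq]
    exact ENNReal.mul_ne_top ENNReal.ofReal_ne_top (ENNReal.pow_ne_top hG.2.ne)
  · filter_upwards [ae_mem_Omega n] with x hx
    have ha : Tendsto (fun ε => a ε (bdryDist x)) (𝓝[>] 0) (𝓝 1) :=
      h.tendsto_one.tendsto_at ⟨bdryDist_pos hx, bdryDist_le x⟩
    simpa using ENNReal.Tendsto.mul_const (b := ‖G x‖ₑ ^ 2)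
      (ENNReal.tendsto_ofReal (ha.comp tendsto_val)) (.inl (by simp))

theorem MemH1.memH1loc {u : Cyl n → ℝ} (hu : MemH1 u) : MemH1loc u :=
  have ⟨hu2, G, hG, hG2⟩ := hu
  ⟨fun _ _ => hu2.restrict _, G, hG, fun _ _ => hG2.restrict _⟩

theorem Admissible.limsup_energy_le (h : Admissible p a) {u : Cyl n → ℝ} (hu : MemH1 u) :
    limsup (fun ε : Param => energy a ε u) toZero ≤ dirichlet (fun _ => 1) u := by
  refine le_iInf₂ fun G hG => ?_
  simp only [ENNReal.ofReal_one, one_mul, ← eLpNorm_two_sq]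
  rcases eq_or_ne (eLpNorm G 2 (volOmega n)) ⊤ with htop | htop
  · simp [htop, ENNReal.mul_top]
  have hlim := ENNReal.Tendsto.const_mul (a := 2⁻¹)
    (h.tendsto_lintegral ⟨hG.aestronglyMeasurable, htop.lt_top⟩) (.inr (by norm_num))
  rw [eLpNorm_two_sq, ← hlim.limsup_eq]
  refine limsup_le_limsup (.of_forall fun ε => ?_)
  simp only [energy, if_pos hu.memH1loc]
  exact iInf₂_le G hG

theorem memLp_of_tendsto_eLpNorm_sub {α ι F : Type*} [MeasurableSpace α] {μ : Measure α}
    [NormedAddCommGroup F] {l : Filter ι} [l.NeBot] {q : ℝ≥0∞} {f : ι → α → F} {g : α → F}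
    (hf : ∀ i, MemLp (f i) q μ) (hg : AEStronglyMeasurable g μ)
    (hfg : Tendsto (fun i => eLpNorm (fun x => f i x - g x) q μ) l (𝓝 0)) : MemLp g q μ := by
  obtain ⟨i, hi⟩ := (hfg.eventually_lt_const ENNReal.zero_lt_top).exists
  simpa only [sub_sub_cancel] using (hf i).sub (⟨(hf i).1.sub hg, hi⟩ : MemLp (f i - g) q μ)

theorem IsTrace.tendsto_bdryAvg {u v : Cyl n → ℝ} (hu : MemLp u 2 (volOmega n))
    (hv : AEStronglyMeasurable v (surf n)) (h : IsTrace u v) :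
    Tendsto (fun ε => eLpNorm (fun x => bdryAvg ε u x - v x) 2 (surf n)) (𝓝[>] 0) (𝓝 0) := by
  obtain ⟨G, ψ, hG, hψ, hψu, hψG, hψv⟩ := h
  obtain ⟨hv₀, hv₁⟩ := aestronglyMeasurable_surf_iff.1 hv
  obtain ⟨hψ₀, hψ₁⟩ := tendsto_eLpNorm_surf_iff.1 hψv
  have hG2 : MemLp G 2 (volOmega n) := memLp_of_tendsto_eLpNorm_sub
    (fun k => memLp_of_continuous (continuous_grad (hψ k))) hG.aestronglyMeasurable hψG
  obtain ⟨M, hM, hψM⟩ := exists_eLpNorm_pderiv_le hψ hG2 hψG (Fin.last n)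
  have hsqueeze : ∀ {f : ℝ → ℝ≥0∞}, (∀ δ, 0 < δ → δ ≤ 1 → f δ ≤
      ENNReal.ofReal δ ^ (1 / 2 : ℝ) * M) → Tendsto f (𝓝[>] 0) (𝓝 0) := fun hf =>
    tendsto_of_tendsto_of_tendsto_of_le_of_le' tendsto_const_nhds (tendsto_ofReal_rpow_half_mul hM)
      (.of_forall fun _ => zero_le) (by
        filter_upwards [Ioo_mem_nhdsGT one_pos] with δ hδ using hf δ hδ.1 hδ.2.le)
  refine tendsto_eLpNorm_surf_iff.2 ⟨hsqueeze fun δ hδ0 hδ => ?_, hsqueeze fun δ hδ0 hδ => ?_⟩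
  · simp only [bdryAvg_zero]
    exact eLpNorm_layerAvg_zero_sub_le hψ hu hψu hψM hv₀ hψ₀ hδ0 hδ
  · simp only [bdryAvg_one]
    refine eLpNorm_layerAvg_zero_sub_le (fun k => contDiff_reflect (hψ k)) (memLp_comp_reflect hu)
      (hψu.congr fun k => (eLpNorm_comp_reflect (fun x => ψ k x - u x) 2).symm)
      (hψM.mono fun k hk => (eLpNorm_pderiv_last_comp_reflect (hψ k) 2).trans_le hk) hv₁ ?_ hδ0 hδ
    simpa [reflect] using hψ₁

/-- The extension of a function on `∂Ω` to the cylinder that is constant in the normal direction on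
either side of the middle `x_N = 1/2`. -/
def normalExtension (v : Cyl n → ℝ) : Cyl n → ℝ :=
  {x | x.2 < 1 / 2}.piecewise (fun x => v (x.1, 0)) fun x => v (x.1, 1)

/-- `u₀` with its values in the boundary layer `d < ε` replaced by the normal extension of `v`. -/
def replaceInLayer (ε : ℝ) (u₀ v : Cyl n → ℝ) : Cyl n → ℝ :=
  {x | bdryDist x < ε}.piecewise (normalExtension v) u₀

theorem normalExtension_of_lt {v : Cyl n → ℝ} {x : Cyl n} (hx : x.2 < 1 / 2) :
    normalExtension v x = v (x.1, 0) := if_pos hx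

theorem normalExtension_of_le {v : Cyl n → ℝ} {x : Cyl n} (hx : 1 / 2 ≤ x.2) :
    normalExtension v x = v (x.1, 1) := if_neg hx.not_gt

theorem replaceInLayer_of_lt {ε : ℝ} {u₀ v : Cyl n → ℝ} {x : Cyl n} (hx : bdryDist x < ε) :
    replaceInLayer ε u₀ v x = normalExtension v x := if_pos hx

theorem memLp_surf_iff {v : Cyl n → ℝ} : MemLp v 2 (surf n) ↔
    MemLp (fun y => v (y, 0)) 2 volume ∧ MemLp (fun y => v (y, 1)) 2 volume := by
  have hpow : ∀ {x : ℝ≥0∞}, x ^ 2 < ⊤ ↔ x < ⊤ := by simp [ENNReal.pow_lt_top_iff]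
  rw [MemLp, MemLp, MemLp, aestronglyMeasurable_surf_iff, ← hpow, eLpNorm_surf_sq,
    ENNReal.add_lt_top, hpow, hpow]
  tauto

theorem memLp_normalExtension {v : Cyl n → ℝ} (hv : MemLp v 2 (surf n)) :
    MemLp (normalExtension v) 2 (volOmega n) :=
  have ⟨hv₀, hv₁⟩ := memLp_surf_iff.1 hv
  .piecewise (measurableSet_lt measurable_snd measurable_const)
    ((hv₀.comp_fst _).restrict _) ((hv₁.comp_fst _).restrict _)

theorem measurableSet_bdryDist_lt (ε : ℝ) : MeasurableSet {x : Cyl n | bdryDist x < ε} :=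
  measurableSet_lt continuous_bdryDist.measurable measurable_const

theorem memLp_replaceInLayer (ε : ℝ) {u₀ v : Cyl n → ℝ} (hu₀ : MemLp u₀ 2 (volOmega n))
    (hv : MemLp v 2 (surf n)) : MemLp (replaceInLayer ε u₀ v) 2 (volOmega n) :=
  .piecewise (measurableSet_bdryDist_lt ε) ((memLp_normalExtension hv).restrict _)
    (hu₀.restrict _)

theorem tendsto_volOmega_bdryDist_lt (n : ℕ) :
    Tendsto (fun ε => volOmega n {x | bdryDist x < ε}) (𝓝[>] 0) (𝓝 0) := by
  have hnull : volOmega n (⋂ ε > (0 : ℝ), {x | bdryDist x < ε}) = 0 := by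
    refine measure_mono_null (t := (Omega n)ᶜ) (fun x hx hxΩ => ?_) (ae_mem_Omega n)
    exact lt_irrefl (bdryDist x) (mem_iInter₂.1 hx _ (bdryDist_pos hxΩ))
  rw [← hnull]
  exact tendsto_measure_biInter_gt (fun ε _ => (measurableSet_bdryDist_lt ε).nullMeasurableSet)
    (fun _ _ _ hij x hx => lt_of_lt_of_le hx hij) ⟨1, one_pos, measure_ne_top _ _⟩

theorem tendsto_replaceInLayer {u₀ v : Cyl n → ℝ} (hu₀ : MemLp u₀ 2 (volOmega n))
    (hv : MemLp v 2 (surf n)) :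
    Tendsto (fun ε => eLpNorm (fun x => replaceInLayer ε u₀ v x - u₀ x) 2 (volOmega n))
      (𝓝[>] 0) (𝓝 0) := by
  have hD := ((memLp_normalExtension hv).sub hu₀).2.ne
  have hsub : ∀ ε, (fun x => replaceInLayer ε u₀ v x - u₀ x) =
      {x | bdryDist x < ε}.indicator (normalExtension v - u₀) := fun ε => by
    ext x
    by_cases hx : bdryDist x < ε <;> simp [replaceInLayer, hx]
  refine tendsto_zero_of_sq ?_
  simp only [hsub, eLpNorm_indicator_eq_eLpNorm_restrict (measurableSet_bdryDist_lt _),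
    eLpNorm_two_sq]
  refine tendsto_setLIntegral_zero ?_ (tendsto_volOmega_bdryDist_lt n)
  rw [← eLpNorm_two_sq]
  exact ENNReal.pow_ne_top hD

theorem layerAvg_eq_of_forall {Y : Type*} {f : Y × ℝ → ℝ} {y : Y} {c d r : ℝ} (hcd : c < d)
    (hf : ∀ s ∈ Ioo c d, f (y, s) = r) : layerAvg c d f y = r := by
  rw [layerAvg_eq_integral_Ioo hcd.le, setIntegral_congr_fun measurableSet_Ioo hf]
  simp [hcd.le, (sub_pos.2 hcd).ne']

theorem layerAvg_replaceInLayer {ε : ℝ} (hε : ε ∈ Ioo (0 : ℝ) (1 / 2)) (u₀ v : Cyl n → ℝ)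
    (y : UnitAddTorus (Fin n)) : layerAvg 0 ε (replaceInLayer ε u₀ v) y = v (y, 0) := by
  refine layerAvg_eq_of_forall hε.1 fun s hs => ?_
  have hlayer : bdryDist ((y, s) : Cyl n) < ε := (min_le_left _ _).trans_lt hs.2
  have hhalf : ((y, s) : Cyl n).2 < 1 / 2 := hs.2.trans hε.2
  rw [replaceInLayer_of_lt hlayer, normalExtension_of_lt hhalf]

theorem layerAvg_replaceInLayer_reflect {ε : ℝ} (hε : ε ∈ Ioo (0 : ℝ) (1 / 2))
    (u₀ v : Cyl n → ℝ) (y : UnitAddTorus (Fin n)) :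
    layerAvg 0 ε (replaceInLayer ε u₀ v ∘ reflect) y = v (y, 1) := by
  refine layerAvg_eq_of_forall hε.1 fun s hs => ?_
  have hlayer : bdryDist (reflect (y, s) : Cyl n) < ε := by
    rw [bdryDist_reflect]
    exact (min_le_left _ _).trans_lt hs.2
  have hhalf : 1 / 2 ≤ (reflect (y, s) : Cyl n).2 := by
    simp only [reflect]
    linarith [hs.2, hε.2]
  rw [Function.comp_apply, replaceInLayer_of_lt hlayer, normalExtension_of_le hhalf, reflect]

theorem eLpNorm_bdryAvg_replaceInLayer_sub {ε : ℝ} (hε : ε ∈ Ioo (0 : ℝ) (1 / 2))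
    (u₀ v : Cyl n → ℝ) :
    eLpNorm (fun x => bdryAvg ε (replaceInLayer ε u₀ v) x - v x) 2 (surf n) = 0 := by
  rw [← pow_eq_zero_iff two_ne_zero, eLpNorm_surf_sq]
  simp [bdryAvg_zero, bdryAvg_one, layerAvg_replaceInLayer hε, layerAvg_replaceInLayer_reflect hε]

theorem Admissible.exists_recovery (h : Admissible p a) (hp : 1 / 2 ≤ p) {u₀ v : Cyl n → ℝ}
    (hu₀ : MemLp u₀ 2 (volOmega n)) (hv : MemLp v 2 (surf n)) :
    ∃ u : Param → Cyl n → ℝ, (∀ ε, MemLp (u ε) 2 (volOmega n)) ∧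
      Tendsto (fun ε => eLpNorm (fun x => u ε x - u₀ x) 2 (volOmega n)) toZero (𝓝 0) ∧
      Tendsto (fun ε : Param => eLpNorm (fun x => bdryAvg ε (u ε) x - v x) 2 (surf n))
        toZero (𝓝 0) ∧
      Tendsto (fun ε : Param => energy a ε (u ε)) toZero (𝓝 (energy₀ u₀ v)) := by
  suffices hsuff : ∃ u : Param → Cyl n → ℝ, (∀ ε, MemLp (u ε) 2 (volOmega n)) ∧
      Tendsto (fun ε => eLpNorm (fun x => u ε x - u₀ x) 2 (volOmega n)) toZero (𝓝 0) ∧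
      Tendsto (fun ε : Param => eLpNorm (fun x => bdryAvg ε (u ε) x - v x) 2 (surf n))
        toZero (𝓝 0) ∧
      limsup (fun ε : Param => energy a ε (u ε)) toZero ≤ energy₀ u₀ v by
    obtain ⟨u, hu, hlim, hlv, hsup⟩ := hsuff
    exact ⟨u, hu, hlim, hlv, tendsto_of_le_liminf_of_limsup_le
      (h.energy₀_le_liminf hp hu hu₀ hv.1 hlim hlv) hsup⟩
  by_cases hdom : MemH1 u₀ ∧ IsTrace u₀ v
  · refine ⟨fun _ => u₀, fun _ => hu₀, by simp, (hdom.2.tendsto_bdryAvg hu₀ hv.1).comp tendsto_val,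
      ?_⟩
    rw [energy₀, if_pos hdom]
    exact h.limsup_energy_le hdom.1
  · refine ⟨fun ε => replaceInLayer ε u₀ v, fun ε => memLp_replaceInLayer ε hu₀ hv,
      (tendsto_replaceInLayer hu₀ hv).comp tendsto_val,
      tendsto_const_nhds.congr fun ε => (eLpNorm_bdryAvg_replaceInLayer_sub ε.2 u₀ v).symm, ?_⟩
    rw [energy₀, if_neg hdom]
    exact le_top

end Recovery

theorem tendsto_eLpNorm_smul_measure_iff {α ι F : Type*} [MeasurableSpace α] {μ : Measure α}
    [NormedAddCommGroup F] {l : Filter ι} {f : ι → α → F} {q c : ℝ≥0∞} (hc0 : c ≠ 0)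
    (hc : c ≠ ⊤) :
    Tendsto (fun i => eLpNorm (f i) q (c • μ)) l (𝓝 0) ↔
      Tendsto (fun i => eLpNorm (f i) q μ) l (𝓝 0) := by
  have hscale : ∀ {b : ℝ≥0∞} {ν : Measure α}, b ≠ 0 → b ≠ ⊤ →
      Tendsto (fun i => eLpNorm (f i) q ν) l (𝓝 0) →
      Tendsto (fun i => eLpNorm (f i) q (b • ν)) l (𝓝 0) := fun hb0 hb h => by
    simp only [eLpNorm_smul_measure_of_ne_zero hb0, smul_eq_mul]
    simpa only [mul_zero] using ENNReal.Tendsto.const_mul h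
      (.inr (ENNReal.rpow_ne_top_of_nonneg ENNReal.toReal_nonneg hb))
  refine ⟨fun h => ?_, hscale hc0 hc⟩
  simpa only [smul_smul, ENNReal.inv_mul_cancel hc0 hc, one_smul] using
    hscale (ENNReal.inv_ne_zero.2 hc) (ENNReal.inv_ne_top.2 hc0) h

theorem layerAvg_congr_ae {Y : Type*} [MeasurableSpace Y] {μ : Measure Y} {f g : Y × ℝ → ℝ}
    {c d : ℝ} (hcd : c ≤ d) (h : f =ᵐ[μ.prod (volume.restrict (Ioo c d))] g) :
    layerAvg c d f =ᵐ[μ] layerAvg c d g := by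
  filter_upwards [Measure.ae_ae_of_ae_prod h] with y hy
  rw [layerAvg_eq_integral_Ioo hcd, layerAvg_eq_integral_Ioo hcd, integral_congr_ae hy]

section Classes

variable {n : ℕ} {κ : ℝ} {φ : ℝ → ℝ} {a : ℝ → ℝ → ℝ} {ε : ℝ} {u u' : Cyl n → ℝ}

theorem volOmega_absolutelyContinuous (hφ : 0 < φ ε) : volOmega n ≪ capMeasure n φ ε := by
  refine withDensity_absolutelyContinuous' (measurable_capacity φ ε).ennreal_ofReal.aemeasurable
    (.of_forall fun x => ?_)
  unfold capacity
  split_ifs <;> simp [hφ]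

theorem isWeakGrad_congr (h : u =ᵐ[volOmega n] u')
    {G : Cyl n → EuclideanSpace ℝ (Fin (n + 1))} : IsWeakGrad u G ↔ IsWeakGrad u' G := by
  have hint : ∀ ζ : Cyl n → ℝ, ∫ x, u x * ζ x ∂(volOmega n) = ∫ x, u' x * ζ x ∂(volOmega n) :=
    fun ζ => integral_congr_ae (h.mul .rfl)
  simp only [IsWeakGrad, hint]

theorem memH1loc_congr (h : u =ᵐ[volOmega n] u') : MemH1loc u ↔ MemH1loc u' := by
  simp only [MemH1loc, isWeakGrad_congr h,
    fun δ => memLp_congr_ae (p := 2) (ae_restrict_of_ae (s := innerDomain n δ) h)]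

theorem dirichlet_congr (h : u =ᵐ[volOmega n] u') (w : Cyl n → ℝ) :
    dirichlet w u = dirichlet w u' := by
  simp only [dirichlet, isWeakGrad_congr h]

theorem energy_congr (h : u =ᵐ[volOmega n] u') (ε : ℝ) : energy a ε u = energy a ε u' := by
  classical exact if_congr (memH1loc_congr h) (dirichlet_congr h _) rfl

theorem bdryAvg_congr_ae (hε : ε ∈ Icc (0 : ℝ) 1) (h : u =ᵐ[volOmega n] u') :
    bdryAvg ε u =ᵐ[surf n] bdryAvg ε u' := by
  have hlayer : ∀ {f g : Cyl n → ℝ}, f =ᵐ[volOmega n] g →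
      layerAvg 0 ε f =ᵐ[volume] layerAvg 0 ε g := fun hfg =>
    layerAvg_congr_ae hε.1 (ae_mono (slab_le_volOmega le_rfl hε.2) hfg)
  rw [surf_eq_map, EventuallyEq, ae_add_measure_iff,
    (measurableEmbedding_prod_mk_right 0).ae_map_iff,
    (measurableEmbedding_prod_mk_right 1).ae_map_iff]
  simp only [bdryAvg_zero, bdryAvg_one]
  exact ⟨hlayer h,
    hlayer ((measurePreserving_reflect n).quasiMeasurePreserving.ae_eq_comp h)⟩

theorem tendsto_immersion_iff (hκ : 0 < κ) {hφ : ∀ ε ∈ Ioo (0 : ℝ) (1 / 2), 0 < φ ε}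
    {u : ∀ ε : Param, L2cap n φ ε} {w : X₀ n κ} {l : Filter Param} :
    Tendsto (fun ε => immersion n κ φ hφ ε (u ε)) l (𝓝 w) ↔
      Tendsto (fun ε => eLpNorm (fun x => u ε x - w.fst x) 2 (volOmega n)) l (𝓝 0) ∧
      Tendsto (fun ε : Param => eLpNorm (fun x => bdryAvg ε (u ε) x - w.snd x) 2 (surf n)) l
        (𝓝 0) := by
  have hu : ∀ ε : Param, MemLp (u ε) 2 (volOmega n) := fun ε =>
    (memLp_capMeasure_iff (hφ ε ε.2) _).1 (Lp.memLp (u ε))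
  have hb : ∀ ε : Param, MemLp (bdryAvg ε (u ε)) 2 (ENNReal.ofReal κ • surf n) := fun ε =>
    memLp_bdryAvg ε.2.1 (ε.2.2.trans one_half_lt_one) (hu ε) κ
  rw [(WithLp.homeomorphProd 2 (Lp ℝ 2 (volOmega n))
    (Lp ℝ 2 (ENNReal.ofReal κ • surf n))).isInducing.tendsto_nhds_iff, nhds_prod_eq,
    tendsto_prod_iff', Lp.tendsto_Lp_iff_tendsto_eLpNorm', Lp.tendsto_Lp_iff_tendsto_eLpNorm',
    ← tendsto_eLpNorm_smul_measure_iff (μ := surf n) (ENNReal.ofReal_pos.2 hκ).ne'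
      ENNReal.ofReal_ne_top]
  exact and_congr
    (tendsto_congr fun ε => eLpNorm_congr_ae ((hu ε).coeFn_toLp.sub (ae_eq_refl _)))
    (tendsto_congr fun ε => eLpNorm_congr_ae ((hb ε).coeFn_toLp.sub (ae_eq_refl _)))

theorem memLp_X₀_snd (hκ : 0 < κ) (w : X₀ n κ) : MemLp w.snd 2 (surf n) := by
  have hκ0 : ENNReal.ofReal κ ≠ 0 := (ENNReal.ofReal_pos.2 hκ).ne'
  refine (Lp.memLp w.snd).of_measure_le_smul (ENNReal.inv_ne_top.2 hκ0) ?_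
  rw [smul_smul, ENNReal.inv_mul_cancel hκ0 ENNReal.ofReal_ne_top, one_smul]

end Classes

/-! ### Conductivities that vanish linearly at the boundary -/

theorem lintegral_Ioo_zero_rpow {r b : ℝ} (hr : -1 < r) (hb : 0 ≤ b) :
    ∫⁻ s in Ioo 0 b, ENNReal.ofReal (s ^ r) = ENNReal.ofReal (b ^ (r + 1) / (r + 1)) := by
  have hint : IntegrableOn (fun s : ℝ => s ^ r) (Ioo 0 b) :=
    (integrableOn_Ioc_iff_integrableOn_Ioo).1 (intervalIntegral.intervalIntegrable_rpow' hr).1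
  rw [← ofReal_integral_eq_lintegral_ofReal hint ((ae_restrict_mem measurableSet_Ioo).mono
      fun s hs => Real.rpow_nonneg hs.1.le _),
    ← integral_Ioc_eq_integral_Ioo, ← intervalIntegral.integral_of_le hb,
    integral_rpow (.inl hr), Real.zero_rpow (by linarith), sub_zero]

theorem lintegral_one_div_min_le {s ε : ℝ} (hs : 0 < s) (hsε : s < ε) :
    ∫⁻ σ in Ioo s ε, ENNReal.ofReal (1 / min (σ / ε) 1) ≤ ENNReal.ofReal (ε ^ 2 / s) := by
  have hε : 0 < ε := hs.trans hsε
  calc ∫⁻ σ in Ioo s ε, ENNReal.ofReal (1 / min (σ / ε) 1)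
      ≤ ∫⁻ _ in Ioo s ε, ENNReal.ofReal (ε / s) := by
        refine setLIntegral_mono' measurableSet_Ioo fun σ hσ => ENNReal.ofReal_le_ofReal ?_
        rw [min_eq_left ((div_le_one hε).2 hσ.2.le), one_div_div]
        exact div_le_div_of_nonneg_left hε.le hs hσ.1.le
    _ = ENNReal.ofReal (ε / s * (ε - s)) := by
        rw [setLIntegral_const, Real.volume_Ioo, ENNReal.ofReal_mul (div_pos hε hs).le]
    _ ≤ ENNReal.ofReal (ε ^ 2 / s) := by
        rw [div_mul_eq_mul_div, sq]
        gcongr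
        linarith

theorem lintegral_sqrt_resistance_min_le {ε : ℝ} (hε : 0 < ε) :
    (ENNReal.ofReal ε)⁻¹ * ∫⁻ s in Ioo 0 ε,
      (∫⁻ σ in Ioo s ε, ENNReal.ofReal (1 / min (σ / ε) 1)) ^ (1 / 2 : ℝ) ≤
    2 * ENNReal.ofReal ε ^ (1 / 2 : ℝ) := by
  have hsqrt : ∀ s ∈ Ioo 0 ε,
      (∫⁻ σ in Ioo s ε, ENNReal.ofReal (1 / min (σ / ε) 1)) ^ (1 / 2 : ℝ) ≤
        ENNReal.ofReal ε * ENNReal.ofReal (s ^ (-(1 / 2) : ℝ)) := fun s hs => by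
    refine (ENNReal.rpow_le_rpow (lintegral_one_div_min_le hs.1 hs.2) one_half_pos.le).trans_eq ?_
    rw [ENNReal.ofReal_rpow_of_nonneg (div_nonneg (sq_nonneg _) hs.1.le) one_half_pos.le,
      Real.div_rpow (sq_nonneg _) hs.1.le, ← Real.sqrt_eq_rpow, Real.sqrt_sq hε.le,
      ← ENNReal.ofReal_mul hε.le, Real.rpow_neg hs.1.le, div_eq_mul_inv]
  calc (ENNReal.ofReal ε)⁻¹ * ∫⁻ s in Ioo 0 ε,
        (∫⁻ σ in Ioo s ε, ENNReal.ofReal (1 / min (σ / ε) 1)) ^ (1 / 2 : ℝ)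
      ≤ (ENNReal.ofReal ε)⁻¹ *
          ∫⁻ s in Ioo 0 ε, ENNReal.ofReal ε * ENNReal.ofReal (s ^ (-(1 / 2) : ℝ)) :=
        mul_le_mul' le_rfl (setLIntegral_mono' measurableSet_Ioo hsqrt)
    _ = ∫⁻ s in Ioo 0 ε, ENNReal.ofReal (s ^ (-(1 / 2) : ℝ)) := by
        rw [lintegral_const_mul' _ _ ENNReal.ofReal_ne_top, ← mul_assoc,
          ENNReal.inv_mul_cancel (ENNReal.ofReal_pos.2 hε).ne' ENNReal.ofReal_ne_top, one_mul]
    _ = 2 * ENNReal.ofReal ε ^ (1 / 2 : ℝ) := by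
        rw [lintegral_Ioo_zero_rpow (by norm_num) hε.le,
          ENNReal.ofReal_rpow_of_nonneg hε.le one_half_pos.le, ← ENNReal.ofReal_ofNat 2,
          ← ENNReal.ofReal_mul zero_le_two]
        congr 1
        rw [show -(1 / 2 : ℝ) + 1 = 1 / 2 by norm_num]
        ring

theorem admissible_min : Admissible (1 / 2) fun ε d => min (d / ε) 1 where
  continuousOn ε _ := by fun_prop
  ne_zero ε hε d hd := (lt_min (div_pos hd.1 hε.1) one_pos).ne'
  tendsto_one := by
    rw [Metric.tendstoLocallyUniformlyOn_iff]
    intro r hr x hx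
    have hx2 : 0 < x / 2 := half_pos hx.1
    refine ⟨Ioi (x / 2), mem_nhdsWithin_of_mem_nhds (Ioi_mem_nhds (half_lt_self hx.1)), ?_⟩
    filter_upwards [Ioo_mem_nhdsGT hx2] with ε hε y hy
    rw [min_eq_right ((one_le_div hε.1).2 (hε.2.trans hy).le)]
    simpa using hr
  lower := ⟨1, one_pos, fun ε hε d hd => le_min ((one_le_div hε.1).2 hd.1) le_rfl⟩
  upper := ⟨1, fun _ _ _ _ => min_le_right _ _⟩
  nondegenerate := by
    have hlim := tendsto_ofReal_rpow_half_mul (M := 2) ENNReal.ofNat_ne_top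
    simp only [mul_comm _ (2 : ℝ≥0∞)] at hlim
    refine tendsto_of_tendsto_of_tendsto_of_le_of_le' tendsto_const_nhds hlim
      (.of_forall fun _ => zero_le) ?_
    filter_upwards [self_mem_nhdsWithin] with ε hε using lintegral_sqrt_resistance_min_le hε

end ThinLayer

end

theorem mainTheorem8_general (n : ℕ) (κ : ℝ) (hκ : 0 < κ) (φ : ℝ → ℝ)
    (hφ : ∀ ε ∈ Set.Ioo (0 : ℝ) (1 / 2), 0 < φ ε) (p : ℝ) (hp : 1 / 2 ≤ p) (a : ℝ → ℝ → ℝ)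
    (h : ThinLayer.Admissible p a) :
    ThinLayer.GammaConverges
      (fun (ε : ThinLayer.Param) (u : ThinLayer.L2cap n φ ε) => ThinLayer.energy a ε u)
      (fun w : ThinLayer.X₀ n κ => ThinLayer.energy₀ w.fst w.snd)
      (ThinLayer.immersion n κ φ hφ) := by
  refine ⟨fun u w huw => ?_, fun w => ?_⟩
  · obtain ⟨hlim, hlv⟩ := (ThinLayer.tendsto_immersion_iff hκ).1 huw
    exact h.energy₀_le_liminf hp
      (fun ε => (ThinLayer.memLp_capMeasure_iff (hφ ε ε.2) _).1 (Lp.memLp (u ε)))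
      (Lp.memLp w.fst) (ThinLayer.memLp_X₀_snd hκ w).1 hlim hlv
  · obtain ⟨u, hu, hlim, hlv, henergy⟩ :=
      h.exists_recovery hp (Lp.memLp w.fst) (ThinLayer.memLp_X₀_snd hκ w)
    have hcap := fun ε : ThinLayer.Param =>
      (ThinLayer.memLp_capMeasure_iff (hφ ε ε.2) (u ε)).2 (hu ε)
    have hae : ∀ ε, u ε =ᵐ[ThinLayer.volOmega n] (hcap ε).toLp (u ε) := fun ε =>
      (ThinLayer.volOmega_absolutelyContinuous (hφ ε ε.2)).ae_le (hcap ε).coeFn_toLp.symm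
    have hε : ∀ ε : ThinLayer.Param, ε.1 ∈ Icc (0 : ℝ) 1 := fun ε =>
      ⟨ε.2.1.le, ε.2.2.le.trans one_half_lt_one.le⟩
    exact ⟨fun ε => (hcap ε).toLp (u ε),
      henergy.congr fun ε => ThinLayer.energy_congr (hae ε) ε,
      (ThinLayer.tendsto_immersion_iff hκ).2
        ⟨hlim.congr fun ε => eLpNorm_congr_ae ((hae ε).sub (ae_eq_refl _)),
          hlv.congr fun ε => eLpNorm_congr_ae
            ((ThinLayer.bdryAvg_congr_ae (hε ε) (hae ε)).sub (ae_eq_refl _))⟩⟩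

theorem mainTheorem8 (n : ℕ) (κ : ℝ) (hκ : 0 < κ) (φ : ℝ → ℝ)
    (hφ : ∀ ε ∈ Set.Ioo (0 : ℝ) (1 / 2), 0 < φ ε)
    (hφκ : Filter.Tendsto (fun ε : ℝ => φ ε * ε) (nhdsWithin 0 (Set.Ioi 0)) (nhds κ)) :
    (∀ (p : ℝ) (a : ℝ → ℝ → ℝ), (p = 1 / 2 ∨ p = 1) → ThinLayer.Admissible p a →
      ThinLayer.GammaConverges
        (fun (ε : ThinLayer.Param) (u : ThinLayer.L2cap n φ ε) => ThinLayer.energy a ε u)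
        (fun w : ThinLayer.X₀ n κ => ThinLayer.energy₀ w.fst w.snd)
        (ThinLayer.immersion n κ φ hφ)) ∧
    ThinLayer.GammaConverges
      (fun (ε : ThinLayer.Param) (u : ThinLayer.L2cap n φ ε) =>
        ThinLayer.energy (fun ε d => min (d / ε) 1) ε u)
      (fun w : ThinLayer.X₀ n κ => ThinLayer.energy₀ w.fst w.snd)
      (ThinLayer.immersion n κ φ hφ) :=
  ⟨fun p a hp => mainTheorem8_general n κ hκ φ hφ p (by rcases hp with rfl | rfl <;> norm_num) a,
    mainTheorem8_general n κ hκ φ hφ (1 / 2) le_rfl _ ThinLayer.admissible_min⟩
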